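/- Fix an integer $K\ge 3$ (number of users), integers $\tau<T$, reals $P_{\rm p},P_{\rm u},P_{\rm r}>0$, $\beta_1,\dots,\beta_K>0$, and a matrix $\Phi\in\mathbb C^{K\times\tau}$ of orthonormal pilot sequences, $\Phi\Phi^H=I_K$. User indices are read modulo $K$. For each $M$ (number of relay antennas) let $H\in\mathbb C^{M\times K}$, $N_{\rm p}\in\mathbb C^{M\times \tau}$, $n_{\rm r}\in\mathbb C^M$, $n_{\rm u}\in\mathbb C^K$ have i.i.d. $\mathcal{CN}(0,1)$ entries and let $x\in\mathbb C^K$ have independent entries with $\mathbb E x_k=0$, $\mathbb E|x_k|^2=1$, all of them independent. Put - $G=HD^{1/2}$ with $D=\mathrm{diag}(\beta_1,\dots,\beta_K)$; $Y_{\rm p}=\sqrt{\tau P_{\rm p}}\,G\Phi+N_{\rm p}$; $\hat G=\mathbb E[G\mid Y_{\rm p}]$ (the MMSE channel estimate); - $W^T=(\hat G^H\hat G)^{-1}\hat G^H$, $A=\hat G^*(\hat G^T\hat G^*)^{-1}$ (zero-forcing receiver and precoder), and $\Pi$ the permutation matrix with $(\Pi y)_k=y_{k+1}$; - $y_{\rm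 R}=\sqrt{P_{\rm u}}\,Gx+n_{\rm r}$, $s_{\rm R}=\sqrt{\alpha_M}\,A\Pi W^T y_{\rm R}$, where $\alpha_M>0$ is determined by $\mathbb E\|s_{\rm R}\|^2=P_{\rm r}$, and $y_{\rm u}=G^Ts_{\rm R}+n_{\rm u}$; - $B=A\Pi W^TG$, with $g_k,b_k$ the $k$-th columns of $G,B$, and the effective noise $\tilde N_k=y_{{\rm u},k}-\sqrt{\alpha_M P_{\rm u}}\,\mathbb E\{g_k^Tb_{k+1}\}\,x_{k+1}$. The achievable spectral efficiency of user $k$ in the first broadcast slot is $$\mathrm{SE}_k(M)=\frac{T-\tau}{T}\,\frac{K-1}{K}\,\log_2\!\Big(1+\frac{\alpha_M P_{\rm u}\,|\mathbb E\{g_k^Tb_{k+1}\}|^2}{\mathrm{Var}(\tilde N_k)}\Big).$$ Let $\sigma_k^2=\frac{\tau P_{\rm p}\beta_k^2}{\tau P_{\rm p}\beta_k+1}$, $\sigma_{e,k}^2=\beta_k-\sigma_k^2$, $\varrho=\sum_{k'=1}^K\frac1{\sigma_{k'}^2\sigma_{k'+1}^2}$, $$\alpha=\frac{M(M-K)P_{\rm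 r}}{MP_{\rm u}\sum_{k'}\frac1{\sigma_{k'}^2}+P_{\rm u}\sum_{k'}\sigma_{e,k'}^2\,\varrho+\varrho},$$ $$\mathcal I_{k,i}=\frac{M\sigma_{i-1}^2\sigma_{e,i}^2+M\sigma_{k+1}^2\sigma_{e,k}^2+\sigma_{k+1}^2\sigma_{i-1}^2\sigma_{e,k}^2\sigma_{e,i}^2\varrho}{M(M-K)\sigma_{i-1}^2\sigma_{k+1}^2},\qquad \mathcal J_k=\frac{M+\sigma_{k+1}^2\sigma_{e,k}^2\varrho}{M(M-K)\sigma_{k+1}^2},$$ $$\widetilde{\mathrm{SE}}_k(M)=\frac{T-\tau}{T}\,\frac{K-1}{K}\,\log_2\!\Big(1+\frac{\alpha P_{\rm u}}{\alpha P_{\rm u}\sum_{i=1}^K\mathcal I_{k,i}+\alpha\mathcal J_k+1}\Big).$$ Then for every user $k$: for all sufficiently large $M$ the quantities defining $\mathrm{SE}_k(M)$ are well defined ($\mathbb E\|s_{\rm R}\|^2=P_{\rm r}$ is attained, $g_k^Tb_{k+1}$ is integrable, $\tilde N_k$ is square integrable), and as $M\to\infty$ $$\mathrm{SE}_k(M)-\widetilde{\mathrm{SE}}_k(M)\to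 0,\qquad\text{and indeed}\qquad M\big(\mathrm{SE}_k(M)-\widetilde{\mathrm{SE}}_k(M)\big)\to0 .$$ -/

import Mathlib

open MeasureTheory ProbabilityTheory Matrix Filter Topology

noncomputable section

namespace MultiWayRelay

/-- The circularly symmetric complex Gaussian law `CN(0,1)`: real and imaginary part are
independent `N(0,1/2)`. -/
def stdComplexGaussian : Measure ℂ :=
  ((gaussianReal 0 (1 / 2)).prod (gaussianReal 0 (1 / 2))).map
    Complex.measurableEquivRealProd.symm

/-- The deterministic parameters of a network with `K` users. Users are indexed by `Fin K`, whose
addition is modulo `K`, so that `k + 1` and `k - 1` wrap around. -/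
structure Params (K : ℕ) where
  /-- length of the coherence interval, in symbols -/
  T : ℕ
  /-- training duration, in symbols -/
  τ : ℕ
  /-- normalized SNR per pilot symbol -/
  Pp : ℝ
  /-- normalized SNR of the users -/
  Pu : ℝ
  /-- transmit power of the relay -/
  Pr : ℝ
  /-- large-scale fading coefficients -/
  β : Fin K → ℝ
  /-- the pilot sequences; row `k` is the sequence of user `k` -/
  Φ : Matrix (Fin K) (Fin τ) ℂ

/-- Admissible parameters: positive powers and fading coefficients, training shorter than the
coherence interval, and pairwise orthogonal (normalized) pilot sequences. -/
structure Params.Admissible {K : ℕ} (p : Params K) : Prop where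
  τ_lt_T : p.τ < p.T
  Pp_pos : 0 < p.Pp
  Pu_pos : 0 < p.Pu
  Pr_pos : 0 < p.Pr
  β_pos : ∀ k, 0 < p.β k
  pilots : p.Φ * p.Φᴴ = 1

/-- The sources of randomness, for a relay with `M` antennas: the small-scale fading `H`, the noise
`Np` of the training phase, the data symbols `x`, the noise `nr` at the relay in the
multiple-access phase and the noise `nu` at the users in the first broadcast slot. -/
structure Sources (M K τ : ℕ) (Ω : Type*) where
  H : Ω → Matrix (Fin M) (Fin K) ℂ
  Np : Ω → Matrix (Fin M) (Fin τ) ℂ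
  x : Ω → Fin K → ℂ
  nr : Ω → Fin M → ℂ
  nu : Ω → Fin K → ℂ

namespace Sources

variable {M K τ : ℕ} {Ω : Type*}

/-- All scalar sources as one family of random variables. -/
def family (S : Sources M K τ Ω) :
    (Fin M × Fin K) ⊕ (Fin M × Fin τ) ⊕ Fin K ⊕ Fin M ⊕ Fin K → Ω → ℂ
  | .inl (m, k) => fun ω => S.H ω m k
  | .inr (.inl (m, t)) => fun ω => S.Np ω m t
  | .inr (.inr (.inl k)) => fun ω => S.x ω k
  | .inr (.inr (.inr (.inl m))) => fun ω => S.nr ω m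
  | .inr (.inr (.inr (.inr k))) => fun ω => S.nu ω k

/-- The statistical model: all sources are independent; fading and noise are `CN(0,1)`; the data
symbols have mean zero and unit power (their law is otherwise arbitrary). -/
structure IsModel [MeasurableSpace Ω] (S : Sources M K τ Ω) (P : Measure Ω) : Prop where
  measurable : ∀ j, Measurable (S.family j)
  indep : iIndepFun S.family P
  law_H : ∀ m k, P.map (fun ω => S.H ω m k) = stdComplexGaussian
  law_Np : ∀ m t, P.map (fun ω => S.Np ω m t) = stdComplexGaussian
  law_nr : ∀ m, P.map (fun ω => S.nr ω m) = stdComplexGaussian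
  law_nu : ∀ k, P.map (fun ω => S.nu ω k) = stdComplexGaussian
  mean_x : ∀ k, ∫ ω, S.x ω k ∂P = 0
  power_x : ∀ k, ∫ ω, ‖S.x ω k‖ ^ 2 ∂P = 1

end Sources

/-- `E |X - E X|²` for a complex random variable. -/
def complexVariance {Ω : Type*} [MeasurableSpace Ω] (X : Ω → ℂ) (P : Measure Ω) : ℝ :=
  ∫ ω, ‖X ω - ∫ ω', X ω' ∂P‖ ^ 2 ∂P

section Transmission

variable {M K : ℕ} {Ω : Type*}

/-- The channel matrix `G = H D^{1/2}`. -/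
def channel (p : Params K) (S : Sources M K p.τ Ω) (ω : Ω) : Matrix (Fin M) (Fin K) ℂ :=
  S.H ω * Matrix.diagonal fun k => ((Real.sqrt (p.β k) : ℝ) : ℂ)

/-- The signal received by the relay in the training phase, `√(τ Pp) G Φ + Np`. -/
def pilotSignal (p : Params K) (S : Sources M K p.τ Ω) (ω : Ω) : Matrix (Fin M) (Fin p.τ) ℂ :=
  ((Real.sqrt (p.τ * p.Pp) : ℝ) : ℂ) • (channel p S ω * p.Φ) + S.Np ω

/-- The information available to the relay after training. -/
abbrev pilotSigmaAlgebra (p : Params K) (S : Sources M K p.τ Ω) : MeasurableSpace Ω :=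
  MeasurableSpace.comap (fun ω (j : Fin M × Fin p.τ) => pilotSignal p S ω j.1 j.2)
    MeasurableSpace.pi

variable [MeasurableSpace Ω] (P : Measure Ω)

/-- The MMSE estimate `Ĝ` of the channel: the conditional mean given the pilot signal. -/
def estimate (p : Params K) (S : Sources M K p.τ Ω) (ω : Ω) : Matrix (Fin M) (Fin K) ℂ :=
  Matrix.of fun m k => (P[fun ω' => channel p S ω' m k | pilotSigmaAlgebra p S]) ω

/-- The zero-forcing receiver `Wᵀ = (Ĝᴴ Ĝ)⁻¹ Ĝᴴ`. -/
def zfReceiver (p : Params K) (S : Sources M K p.τ Ω) (ω : Ω) : Matrix (Fin K) (Fin M) ℂ :=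
  ((estimate P p S ω)ᴴ * estimate P p S ω)⁻¹ * (estimate P p S ω)ᴴ

/-- The zero-forcing precoder `A = Ĝ* (Ĝᵀ Ĝ*)⁻¹`. -/
def zfPrecoder (p : Params K) (S : Sources M K p.τ Ω) (ω : Ω) : Matrix (Fin M) (Fin K) ℂ :=
  (estimate P p S ω).map star * ((estimate P p S ω)ᵀ * (estimate P p S ω).map star)⁻¹

/-- The permutation matrix of the first broadcast slot: `(Π y)ₖ = yₖ₊₁`. -/
def slotPerm (K : ℕ) [NeZero K] : Matrix (Fin K) (Fin K) ℂ :=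
  Matrix.of fun k j => if j = k + 1 then 1 else 0

/-- The signal received by the relay in the multiple-access phase, `√Pu G x + n_r`. -/
def relayReceived (p : Params K) (S : Sources M K p.τ Ω) (ω : Ω) : Fin M → ℂ :=
  ((Real.sqrt p.Pu : ℝ) : ℂ) • (channel p S ω *ᵥ S.x ω) + S.nr ω

variable [NeZero K]

/-- The relay signal of the first slot before power scaling, `A Π Wᵀ y_R`. -/
def unscaledSignal (p : Params K) (S : Sources M K p.τ Ω) (ω : Ω) : Fin M → ℂ :=
  zfPrecoder P p S ω *ᵥ (slotPerm K *ᵥ (zfReceiver P p S ω *ᵥ relayReceived p S ω))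

/-- The power scaling `α`, determined by the constraint `E ‖√α A Π Wᵀ y_R‖² = Pr`. -/
def powerScaling (p : Params K) (S : Sources M K p.τ Ω) : ℝ :=
  p.Pr / ∫ ω, ∑ m, ‖unscaledSignal P p S ω m‖ ^ 2 ∂P

/-- The signal sent by the relay in the first slot. -/
def relaySent (p : Params K) (S : Sources M K p.τ Ω) (ω : Ω) : Fin M → ℂ :=
  ((Real.sqrt (powerScaling P p S) : ℝ) : ℂ) • unscaledSignal P p S ω

/-- The signals received by the users in the first slot, `Gᵀ s_R + n_u`. -/
def userReceived (p : Params K) (S : Sources M K p.τ Ω) (ω : Ω) : Fin K → ℂ :=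
  (channel p S ω)ᵀ *ᵥ relaySent P p S ω + S.nu ω

/-- The coefficients `gₖᵀ bᵢ` of `Gᵀ B`, where `B = A Π Wᵀ G`. -/
def effectiveGain (p : Params K) (S : Sources M K p.τ Ω) (ω : Ω) : Matrix (Fin K) (Fin K) ℂ :=
  (channel p S ω)ᵀ * (zfPrecoder P p S ω * slotPerm K * zfReceiver P p S ω * channel p S ω)

/-- `E {gₖᵀ bₖ₊₁}`. -/
def meanGain (p : Params K) (S : Sources M K p.τ Ω) (k : Fin K) : ℂ :=
  ∫ ω, effectiveGain P p S ω k (k + 1) ∂P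

/-- The effective noise of user `k`: the received signal minus the desired signal
`√(α Pu) E{gₖᵀ bₖ₊₁} xₖ₊₁`. -/
def effectiveNoise (p : Params K) (S : Sources M K p.τ Ω) (k : Fin K) (ω : Ω) : ℂ :=
  userReceived P p S ω k -
    ((Real.sqrt (powerScaling P p S * p.Pu) : ℝ) : ℂ) * meanGain P p S k * S.x ω (k + 1)

/-- The achievable spectral efficiency of user `k` in the first slot. -/
def spectralEfficiency (p : Params K) (S : Sources M K p.τ Ω) (k : Fin K) : ℝ :=
  (((p.T : ℝ) - p.τ) / p.T) * (((K : ℝ) - 1) / K) *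
    Real.logb 2 (1 + powerScaling P p S * p.Pu * ‖meanGain P p S k‖ ^ 2 /
      complexVariance (effectiveNoise P p S k) P)

end Transmission

section ClosedForm

variable {K : ℕ} (p : Params K)

/-- The variance `σₖ²` of the channel estimate. -/
def estVar (k : Fin K) : ℝ :=
  p.τ * p.Pp * p.β k ^ 2 / (p.τ * p.Pp * p.β k + 1)

/-- The variance `σ²ₑ,ₖ` of the estimation error. -/
def errVar (k : Fin K) : ℝ := p.β k - estVar p k

variable [NeZero K]

/-- The constant `ϱ`. -/
def rhoConst : ℝ := ∑ k, 1 / (estVar p k * estVar p (k + 1))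

/-- The closed form of `α`. -/
def alphaApprox (M : ℕ) : ℝ :=
  (M : ℝ) * ((M : ℝ) - K) * p.Pr /
    (M * p.Pu * (∑ k, 1 / estVar p k) + p.Pu * (∑ k, errVar p k * rhoConst p) + rhoConst p)

/-- The interference coefficient `I_{k,i}`. -/
def interference (M : ℕ) (k i : Fin K) : ℝ :=
  (M * estVar p (i - 1) * errVar p i + M * estVar p (k + 1) * errVar p k +
      estVar p (k + 1) * estVar p (i - 1) * errVar p k * errVar p i * rhoConst p) /
    ((M : ℝ) * ((M : ℝ) - K) * estVar p (i - 1) * estVar p (k + 1))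

/-- The noise coefficient `J_k`. -/
def noiseCoeff (M : ℕ) (k : Fin K) : ℝ :=
  (M + estVar p (k + 1) * errVar p k * rhoConst p) /
    ((M : ℝ) * ((M : ℝ) - K) * estVar p (k + 1))

/-- The closed-form approximation of the spectral efficiency. -/
def spectralEfficiencyApprox (M : ℕ) (k : Fin K) : ℝ :=
  (((p.T : ℝ) - p.τ) / p.T) * (((K : ℝ) - 1) / K) *
    Real.logb 2 (1 + alphaApprox p M * p.Pu /
      (alphaApprox p M * p.Pu * (∑ i, interference p M k i) +
        alphaApprox p M * noiseCoeff p M k + 1))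

end ClosedForm

end MultiWayRelay

end

/-! Write `G = Ĝ + E`, `Q = (Ĝᴴ Ĝ)⁻¹` and `R = A Π Wᵀ`. Despreading the pilots rotates fading and
training noise into two independent standard Gaussian matrices (`fromRows_mul_conjTranspose`,
`channel_eq`); their columns, scaled by `σₖ` and `σₑ,ₖ`, are those of `Ĝ` and `E`. The first is the
conditional mean (`ae_estimate_eq`), because a reflection preserving the Gaussian law fixes the
pilot signal and negates the error.

The precoder is the transposed receiver, and the receiver inverts `Ĝ`. Hence `Gᵀ R G` is `Π` plus a
deviation that is linear and quadratic in `E` and has mean zero (`moments_gainDeviation`). So `E{gₖᵀ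
bₖ₊₁} = 1` exactly. The relay power is an exact expression in the energies `qₖ = E Qₖₖ`
(`receiverEnergy`) and `r = E ‖R‖²` (`relayEnergy`); the noise variance also involves the
correlation `s` of `R` with its transpose (`relayCorrelation`). After division by `α` the
signal-to-noise ratio is `Pu / relativeNoise(q, r, Re s)`. The closed form is the same function at
`qₖ = 1 / (σₖ² (M - K))`, `r = ϱ / (M (M - K))`, `s = 0` (`spectralEfficiency_eq`,
`spectralEfficiencyApprox_eq`).

Since `relativeNoise` is linear in the triple and of exact order `1/M`, it suffices that the two
triples differ by `o(M⁻²)`: the logarithms then differ by `o(M⁻¹)`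
(`tendsto_mul_log_one_add_div_sub`). What has to be shown is `M (M qₖ - 1/σₖ²) → K/σₖ²`, `M² r → ϱ`
and `M² s → 0`. With `D` the deviation of the normalized Gram matrix from `1` and `N` its normalized
inverse, `N = 1 - D + D² - D³ N`. Here `E D = 0` and `E (D²)ₐₐ = K/M`, which yields `q`; convergence
of the mean products of entries of `N` yields `r` and `s`. The limit of `M² s` is a sum of terms
carrying `δ(k, l+1) δ(k+1, l)`, all zero because `2 ≠ 0` modulo `K`; this is where `K ≥ 3` enters.

Controlling the remainder needs fourth moments of `N` bounded uniformly in `M`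
(`exists_lintegral_inv_gram_pow_four_le`). The rows are cut into square blocks. Each block has a
lower bound for its squared smallest singular value with a finite negative moment, because `E
|det|^(-1/2)` is finite. The Gram matrix dominates the sum of these bounds, and the
arithmetic-geometric mean inequality, independence and Jensen turn many weak moments into one strong
moment. -/

noncomputable section

namespace MultiWayRelay

/-! ### The standard complex Gaussian law -/

instance : IsProbabilityMeasure stdComplexGaussian :=
  Measure.isProbabilityMeasure_map Complex.measurableEquivRealProd.symm.measurable.aemeasurable

/-- The law of a family of independent standard complex Gaussian variables. -/
abbrev gaussianFamily (ι : Type*) [Fintype ι] : Measure (ι → ℂ) :=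
  Measure.pi fun _ => stdComplexGaussian

/-- Each real coordinate has variance `1/2`, whence the factor `1/4`. Dependence on `‖t‖` alone is
what gives invariance under co-isometries. -/
lemma charFun_stdComplexGaussian (t : ℂ) :
    charFun stdComplexGaussian t = Complex.exp (-(‖t‖ ^ 2 / 4 : ℝ)) := by
  rw [charFun_apply, stdComplexGaussian, integral_map_equiv]
  have h : ∀ x : ℝ × ℝ,
      Complex.exp ((inner ℝ (Complex.measurableEquivRealProd.symm x) t : ℝ) * Complex.I) =
        Complex.exp (t.re * x.1 * Complex.I) * Complex.exp (t.im * x.2 * Complex.I) := by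
    intro x
    rw [← Complex.exp_add, Complex.inner]
    congr 1
    simp [Complex.measurableEquivRealProd]
    ring
  simp_rw [h]
  rw [integral_prod_mul (fun x : ℝ => Complex.exp (t.re * x * Complex.I))
    (fun x : ℝ => Complex.exp (t.im * x * Complex.I)), ← charFun_apply_real, ← charFun_apply_real,
    charFun_gaussianReal, charFun_gaussianReal, ← Complex.exp_add, ← Complex.normSq_eq_norm_sq,
    Complex.normSq_apply]
  congr 1
  push_cast
  simp
  ring

lemma re_star_dotProduct_self {ι : Type*} [Fintype ι] (v : ι → ℂ) :
    (star v ⬝ᵥ v).re = ∑ i, ‖v i‖ ^ 2 := by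
  simp [dotProduct, ← Complex.normSq_eq_norm_sq, Complex.normSq_apply]

/-- The law of independent standard complex Gaussian variables is preserved by co-isometries. -/
theorem map_mulVec_gaussianFamily {I J : Type*} [Fintype I] [DecidableEq I] [Fintype J]
    (A : Matrix I J ℂ) (hA : A * Aᴴ = 1) :
    (gaussianFamily J).map (fun x => A *ᵥ x) = gaussianFamily I := by
  have hm : Measurable fun x : J → ℂ => A *ᵥ x := by
    refine measurable_pi_lambda _ fun i => ?_
    simp only [Matrix.mulVec, dotProduct]
    fun_prop
  have : IsProbabilityMeasure ((gaussianFamily J).map (fun x => A *ᵥ x)) :=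
    Measure.isProbabilityMeasure_map hm.aemeasurable
  refine charFun_eq_pi_iff.1 fun t => ?_
  have hmt : Measurable (WithLp.toLp 2 : (I → ℂ) → PiLp 2 fun _ : I => ℂ) :=
    (MeasurableEquiv.toLp 2 (I → ℂ)).measurable
  have hmt' : Measurable (WithLp.toLp 2 : (J → ℂ) → PiLp 2 fun _ : J => ℂ) :=
    (MeasurableEquiv.toLp 2 (J → ℂ)).measurable
  -- The adjoint moves `A` to the argument: `⟨A x, t⟩ = ⟨x, Aᴴ t⟩`. It then remains to see that `Aᴴ`
  -- is isometric, which is `A Aᴴ = 1`.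
  have key : charFun (((gaussianFamily J).map (fun x => A *ᵥ x)).map (WithLp.toLp 2)) t =
      charFun ((gaussianFamily J).map (WithLp.toLp 2))
        (WithLp.toLp 2 (Aᴴ *ᵥ (WithLp.ofLp t))) := by
    rw [Measure.map_map hmt hm, charFun_apply, charFun_apply,
      integral_map (hmt.comp hm).aemeasurable (by fun_prop),
      integral_map hmt'.aemeasurable (by fun_prop)]
    refine integral_congr_ae (Eventually.of_forall fun x => ?_)
    have : (inner ℝ ((WithLp.toLp 2 ∘ fun x => A *ᵥ x) x) t : ℝ) =
        inner ℝ (WithLp.toLp 2 x) (WithLp.toLp 2 (Aᴴ *ᵥ (WithLp.ofLp t))) := by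
      have h1 : (star (A *ᵥ x) ⬝ᵥ WithLp.ofLp t) = star x ⬝ᵥ (Aᴴ *ᵥ WithLp.ofLp t) := by
        rw [Matrix.star_mulVec, ← Matrix.dotProduct_mulVec]
      have h2 := congrArg Complex.re h1
      simpa [PiLp.inner_apply, Complex.inner, dotProduct, mul_comm] using h2
    simp only [this]
  rw [key, charFun_pi]
  simp_rw [charFun_stdComplexGaussian]
  rw [← Complex.exp_sum, ← Complex.exp_sum]
  congr 1
  have h1 : (star (Aᴴ *ᵥ WithLp.ofLp t) ⬝ᵥ (Aᴴ *ᵥ WithLp.ofLp t)) =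
      star (WithLp.ofLp t) ⬝ᵥ WithLp.ofLp t := by
    rw [Matrix.star_mulVec, Matrix.conjTranspose_conjTranspose, ← Matrix.dotProduct_mulVec,
      Matrix.mulVec_mulVec, hA, Matrix.one_mulVec]
  have h4 : ∑ j, ‖(Aᴴ *ᵥ WithLp.ofLp t) j‖ ^ 2 = ∑ i, ‖t i‖ ^ 2 := by
    have h2 := congrArg Complex.re h1
    rwa [re_star_dotProduct_self, re_star_dotProduct_self] at h2
  simp only [← Complex.ofReal_neg, ← Complex.ofReal_sum]
  congr 1
  simp only [Finset.sum_neg_distrib, ← Finset.sum_div]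
  rw [← h4]

lemma map_precomp_gaussianFamily {I J : Type*} [Fintype I] [Fintype J] {g : I → J}
    (hg : Function.Injective g) :
    (gaussianFamily J).map (fun x => x ∘ g) = gaussianFamily I := by
  classical
  have h := (iIndepFun_pi (X := fun _ : J => (id : ℂ → ℂ))
    (μ := fun _ => stdComplexGaussian) (fun _ => aemeasurable_id)).precomp hg
  replace h := h.map_fun_eq_pi_map (fun i => (measurable_pi_apply (g i)).aemeasurable)
  refine h.trans (congrArg Measure.pi (funext fun i => ?_))
  exact (measurePreserving_eval (fun _ => stdComplexGaussian) (g i)).map_eq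

/-- Multiplication of the coordinates by unit complex numbers preserves the law. -/
lemma measurePreserving_mul_gaussianFamily {ι : Type*} [Fintype ι] (u : ι → ℂ)
    (hu : ∀ i, ‖u i‖ = 1) :
    MeasurePreserving (fun (x : ι → ℂ) i => u i * x i) (gaussianFamily ι) (gaussianFamily ι) := by
  classical
  refine ⟨by fun_prop, ?_⟩
  have h := map_mulVec_gaussianFamily (Matrix.diagonal u) (by
    rw [Matrix.diagonal_conjTranspose, Matrix.diagonal_mul_diagonal, ← Matrix.diagonal_one]
    congr 1
    ext i
    simp [Complex.mul_conj, Complex.normSq_eq_norm_sq, hu i])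
  convert h using 2
  ext x i
  simp [Matrix.mulVec_diagonal]

lemma measurePreserving_eval_gaussianFamily {ι : Type*} [Fintype ι] (i : ι) :
    MeasurePreserving (fun x : ι → ℂ => x i) (gaussianFamily ι) stdComplexGaussian :=
  measurePreserving_eval (fun _ => stdComplexGaussian) i

/-! ### Moments -/

lemma measurePreserving_re_stdComplexGaussian :
    MeasurePreserving Complex.re stdComplexGaussian (gaussianReal 0 (1 / 2)) := by
  refine ⟨Complex.measurable_re, ?_⟩
  rw [stdComplexGaussian, Measure.map_map Complex.measurable_re (MeasurableEquiv.measurable _)]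
  have : (Complex.re ∘ Complex.measurableEquivRealProd.symm : ℝ × ℝ → ℝ) = Prod.fst := by
    ext x; simp [Complex.measurableEquivRealProd]
  rw [this, Measure.map_fst_prod]; simp

lemma measurePreserving_im_stdComplexGaussian :
    MeasurePreserving Complex.im stdComplexGaussian (gaussianReal 0 (1 / 2)) := by
  refine ⟨Complex.measurable_im, ?_⟩
  rw [stdComplexGaussian, Measure.map_map Complex.measurable_im (MeasurableEquiv.measurable _)]
  have : (Complex.im ∘ Complex.measurableEquivRealProd.symm : ℝ × ℝ → ℝ) = Prod.snd := by
    ext x; simp [Complex.measurableEquivRealProd]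
  rw [this, Measure.map_snd_prod]; simp

lemma memLp_id_stdComplexGaussian {q : ENNReal} (hq : q ≠ ⊤) :
    MemLp (fun z : ℂ => z) q stdComplexGaussian := by
  have h1 : MemLp Complex.re q stdComplexGaussian :=
    (memLp_id_gaussianReal' q hq).comp_measurePreserving measurePreserving_re_stdComplexGaussian
  have h2 : MemLp Complex.im q stdComplexGaussian :=
    (memLp_id_gaussianReal' q hq).comp_measurePreserving measurePreserving_im_stdComplexGaussian
  refine (h1.norm.add h2.norm).mono' measurable_id.aestronglyMeasurable
    (Eventually.of_forall fun z => ?_)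
  simpa using Complex.norm_le_abs_re_add_abs_im z

/-- The value is the fourth derivative at `0` of the moment generating function `exp (v t² / 2)`. -/
lemma integral_pow_four_gaussianReal (v : NNReal) :
    ∫ x, x ^ 4 ∂(gaussianReal 0 v) = 3 * v ^ 2 := by
  have h0 : ∀ t : ℝ, HasDerivAt (fun t => Real.exp (v * t ^ 2 / 2))
      (v * t * Real.exp (v * t ^ 2 / 2)) t := by
    intro t
    have := (((hasDerivAt_pow 2 t).const_mul (v : ℝ)).div_const 2).exp
    convert this using 1
    simp
    ring
  have h1 : deriv (fun t => Real.exp (v * t ^ 2 / 2)) =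
      fun t => v * t * Real.exp (v * t ^ 2 / 2) := funext fun t => (h0 t).deriv
  have h2 : deriv (fun t => (v * t * Real.exp (v * t ^ 2 / 2) : ℝ)) =
      fun t => (v + v ^ 2 * t ^ 2) * Real.exp (v * t ^ 2 / 2) := funext fun t => by
    have := ((hasDerivAt_id t).const_mul (v : ℝ)).mul (h0 t)
    exact (this.congr_deriv (by simp; ring)).deriv
  have h3 : deriv (fun t => ((v + v ^ 2 * t ^ 2) * Real.exp (v * t ^ 2 / 2) : ℝ)) =
      fun t => (3 * v ^ 2 * t + v ^ 3 * t ^ 3) * Real.exp (v * t ^ 2 / 2) := funext fun t => by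
    have := (((hasDerivAt_pow 2 t).const_mul ((v : ℝ) ^ 2)).const_add (v : ℝ)).mul (h0 t)
    exact (this.congr_deriv (by simp; ring)).deriv
  have h4 : deriv (fun t => ((3 * v ^ 2 * t + v ^ 3 * t ^ 3) * Real.exp (v * t ^ 2 / 2) : ℝ)) 0 =
      3 * v ^ 2 := by
    have := (((hasDerivAt_id (0 : ℝ)).const_mul (3 * (v : ℝ) ^ 2)).add
      ((hasDerivAt_pow 3 (0 : ℝ)).const_mul ((v : ℝ) ^ 3))).mul (h0 0)
    exact (this.congr_deriv (by simp)).deriv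
  calc ∫ x, x ^ 4 ∂(gaussianReal 0 v)
      = iteratedDeriv 4 (mgf (fun x => x) (gaussianReal 0 v)) 0 := by
        rw [iteratedDeriv_mgf_zero] <;> simp
    _ = 3 * v ^ 2 := by
        rw [mgf_fun_id_gaussianReal]
        simp only [zero_mul, zero_add]
        rw [iteratedDeriv_succ, iteratedDeriv_succ, iteratedDeriv_succ, iteratedDeriv_one, h1, h2,
          h3, h4]

lemma integral_sq_gaussianReal (v : NNReal) :
    ∫ x, x ^ 2 ∂(gaussianReal 0 v) = v := by
  have h := variance_fun_id_gaussianReal (μ := 0) (v := v)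
  rw [variance_eq_integral measurable_id'.aemeasurable] at h
  simpa using h

theorem integral_comp_of_measurePreserving {α β E : Type*} {mα : MeasurableSpace α}
    {mβ : MeasurableSpace β} [NormedAddCommGroup E] [NormedSpace ℝ E] {μ : Measure α}
    {ν : Measure β} {f : α → β} (hf : MeasurePreserving f μ ν) {g : β → E}
    (hg : AEStronglyMeasurable g ν) : ∫ x, g (f x) ∂μ = ∫ y, g y ∂ν := by
  rw [← hf.map_eq] at hg ⊢
  rw [integral_map hf.measurable.aemeasurable hg]

lemma integral_id_stdComplexGaussian : ∫ z, z ∂stdComplexGaussian = 0 := by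
  have hi : Integrable (fun z : ℂ => z) stdComplexGaussian :=
    (memLp_id_stdComplexGaussian ENNReal.one_ne_top).integrable le_rfl
  apply Complex.ext
  · have h1 := integral_re hi
    have h2 := integral_comp_of_measurePreserving measurePreserving_re_stdComplexGaussian
      (g := fun x : ℝ => x) (by fun_prop)
    rw [integral_id_gaussianReal] at h2
    exact h1.symm.trans h2
  · have h1 := integral_im hi
    have h2 := integral_comp_of_measurePreserving measurePreserving_im_stdComplexGaussian
      (g := fun x : ℝ => x) (by fun_prop)
    rw [integral_id_gaussianReal] at h2
    exact h1.symm.trans h2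

lemma integral_norm_sq_stdComplexGaussian : ∫ z, ‖z‖ ^ 2 ∂stdComplexGaussian = 1 := by
  have h : Integrable (fun x : ℝ => x ^ 2) (gaussianReal 0 (1 / 2)) :=
    (memLp_id_gaussianReal 2).integrable_sq
  rw [stdComplexGaussian, integral_map_equiv]
  have h1 : ∀ x : ℝ × ℝ, ‖Complex.measurableEquivRealProd.symm x‖ ^ 2 = x.1 ^ 2 + x.2 ^ 2 := by
    intro x
    rw [← Complex.normSq_eq_norm_sq, Complex.normSq_apply]
    simp [Complex.measurableEquivRealProd]
    ring
  simp_rw [h1]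
  rw [integral_add (h.comp_fst _) (h.comp_snd _), integral_fun_fst (fun x : ℝ => x ^ 2),
    integral_fun_snd (fun x : ℝ => x ^ 2)]
  simp [integral_sq_gaussianReal]
  norm_num

lemma integral_norm_pow_four_stdComplexGaussian : ∫ z, ‖z‖ ^ 4 ∂stdComplexGaussian = 2 := by
  have h : Integrable (fun x : ℝ => x ^ 2) (gaussianReal 0 (1 / 2)) :=
    (memLp_id_gaussianReal 2).integrable_sq
  have h4 := (memLp_id_gaussianReal (μ := 0) (v := 1 / 2) 4).integrable_norm_pow (by norm_num)
  have h4' : Integrable (fun x : ℝ => x ^ 4) (gaussianReal 0 (1 / 2)) := by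
    refine h4.congr (Eventually.of_forall fun x => ?_)
    simp [Even.pow_abs (by decide : Even 4)]
  rw [stdComplexGaussian, integral_map_equiv]
  have h1 : ∀ x : ℝ × ℝ, ‖Complex.measurableEquivRealProd.symm x‖ ^ 4 =
      x.1 ^ 4 + x.2 ^ 4 + 2 * (x.1 ^ 2 * x.2 ^ 2) := by
    intro x
    rw [show 4 = 2 * 2 from rfl, pow_mul, ← Complex.normSq_eq_norm_sq, Complex.normSq_apply]
    simp [Complex.measurableEquivRealProd]
    ring
  simp_rw [h1]
  have h5 : Integrable (fun x : ℝ × ℝ => x.1 ^ 4 + x.2 ^ 4)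
      ((gaussianReal 0 (1 / 2)).prod (gaussianReal 0 (1 / 2))) :=
    (h4'.comp_fst _).add (h4'.comp_snd _)
  rw [integral_add h5 ((h.mul_prod h).const_mul 2),
    integral_add (h4'.comp_fst _) (h4'.comp_snd _), integral_fun_fst (fun x : ℝ => x ^ 4),
    integral_fun_snd (fun x : ℝ => x ^ 4), integral_const_mul,
    integral_prod_mul (fun x : ℝ => x ^ 2) (fun x : ℝ => x ^ 2)]
  simp [integral_sq_gaussianReal, integral_pow_four_gaussianReal]
  norm_num

/-! ### Negative moments of Gaussian determinants -/

lemma lintegral_enorm_rpow_neg_half_lt_top :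
    ∫⁻ x in Set.Ioo (-1 : ℝ) 1, ‖x‖ₑ ^ (-(1 / 2) : ℝ) < ⊤ := by
  have hint : IntegrableOn (fun x : ℝ => x ^ (-(1 / 2) : ℝ)) (Set.Ioo 0 1) :=
    (intervalIntegral.integrableOn_Ioo_rpow_iff zero_lt_one).2 (by norm_num)
  have hpos : ∫⁻ x in Set.Ioo (0 : ℝ) 1, ‖x‖ₑ ^ (-(1 / 2) : ℝ) < ⊤ := by
    refine lt_of_le_of_lt (setLIntegral_mono_ae' measurableSet_Ioo
      (Eventually.of_forall fun x hx => ?_)) hint.2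
    rw [Real.enorm_eq_ofReal hx.1.le, Real.enorm_eq_ofReal (Real.rpow_nonneg hx.1.le _),
      ENNReal.ofReal_rpow_of_pos hx.1]
  have hneg : ∫⁻ x in Set.Ioo (-1 : ℝ) 0, ‖x‖ₑ ^ (-(1 / 2) : ℝ) < ⊤ := by
    have h := (Measure.measurePreserving_neg (volume : Measure ℝ)).setLIntegral_comp_preimage
      (measurableSet_Ioo (a := (0 : ℝ)) (b := 1))
      (f := fun x => ‖x‖ₑ ^ (-(1 / 2) : ℝ)) (by fun_prop)
    simp only [enorm_neg, Set.neg_preimage, Set.neg_Ioo, neg_zero] at h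
    rw [h]
    exact hpos
  have hsub : Set.Ioo (-1 : ℝ) 1 ⊆ Set.Ioo (-1 : ℝ) 0 ∪ {0} ∪ Set.Ioo (0 : ℝ) 1 := by
    intro x hx
    rcases lt_trichotomy x 0 with h | h | h
    · exact Or.inl (Or.inl ⟨hx.1, h⟩)
    · exact Or.inl (Or.inr h)
    · exact Or.inr ⟨h, hx.2⟩
  refine lt_of_le_of_lt (lintegral_mono_set hsub) (lt_of_le_of_lt (lintegral_union_le _ _ _)
    (ENNReal.add_lt_top.2 ⟨lt_of_le_of_lt (lintegral_union_le _ _ _)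
      (ENNReal.add_lt_top.2 ⟨hneg, ?_⟩), hpos⟩))
  simp

/-- The integrand is at most `1` off the window `|x + b| < 1`. On the window the Gaussian density is
bounded by its maximum, and translation invariance of Lebesgue measure removes `b`. The exponent
`-1/2 > -1` makes the singularity integrable. -/
lemma exists_lintegral_add_const_rpow_gaussianReal_le :
    ∃ C : ENNReal, C ≠ ⊤ ∧ 1 ≤ C ∧ ∀ b : ℝ,
      ∫⁻ x, ‖x + b‖ₑ ^ (-(1 / 2) : ℝ) ∂(gaussianReal 0 (1 / 2)) ≤ C := by
  refine ⟨1 + ENNReal.ofReal (√(2 * Real.pi * (1 / 2 : NNReal)))⁻¹ *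
    ∫⁻ x in Set.Ioo (-1 : ℝ) 1, ‖x‖ₑ ^ (-(1 / 2) : ℝ), ?_, le_self_add, fun b => ?_⟩
  · exact ENNReal.add_ne_top.2 ⟨by simp, ENNReal.mul_ne_top ENNReal.ofReal_ne_top
      lintegral_enorm_rpow_neg_half_lt_top.ne⟩
  set F : ℝ → ENNReal := (Set.Ioo (-1 : ℝ) 1).indicator fun x => ‖x‖ₑ ^ (-(1 / 2) : ℝ) with hF
  have hFm : Measurable F := by
    refine Measurable.indicator (by fun_prop) measurableSet_Ioo
  have h1 : ∀ x : ℝ, ‖x + b‖ₑ ^ (-(1 / 2) : ℝ) ≤ 1 + F (x + b) := by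
    intro x
    by_cases hx : x + b ∈ Set.Ioo (-1 : ℝ) 1
    · rw [hF, Set.indicator_of_mem hx]
      exact le_add_self
    · refine le_trans ?_ le_self_add
      refine ENNReal.rpow_le_one_of_one_le_of_neg ?_ (by norm_num)
      rw [Real.enorm_eq_ofReal_abs, ← ENNReal.ofReal_one]
      apply ENNReal.ofReal_le_ofReal
      by_contra! hlt
      exact hx (abs_lt.1 hlt)
  calc ∫⁻ x, ‖x + b‖ₑ ^ (-(1 / 2) : ℝ) ∂(gaussianReal 0 (1 / 2))
      ≤ ∫⁻ x, 1 + F (x + b) ∂(gaussianReal 0 (1 / 2)) := lintegral_mono h1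
    _ = 1 + ∫⁻ x, F (x + b) ∂(gaussianReal 0 (1 / 2)) := by
        rw [lintegral_add_left measurable_const]; simp
    _ ≤ _ := by
        gcongr
        rw [gaussianReal_of_var_ne_zero _ (by norm_num),
          lintegral_withDensity_eq_lintegral_mul _ (measurable_gaussianPDF _ _) (by fun_prop)]
        calc _ ≤ ∫⁻ x, ENNReal.ofReal (√(2 * Real.pi * (1 / 2 : NNReal)))⁻¹ * F (x + b) := by
              refine lintegral_mono fun x => ?_
              simp only [Pi.mul_apply]
              gcongr
              rw [gaussianPDF, gaussianPDFReal]
              refine ENNReal.ofReal_le_ofReal (mul_le_of_le_one_right (by positivity) ?_)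
              rw [Real.exp_le_one_iff]
              have : 0 ≤ (x - 0) ^ 2 / (2 * ((1 / 2 : NNReal) : ℝ)) := by positivity
              rw [neg_div]
              linarith
          _ = _ := by
              rw [lintegral_const_mul _ (by fun_prop), lintegral_add_right_eq_self F b, hF,
                lintegral_indicator measurableSet_Ioo]

/-- After factoring out `a`, the modulus dominates the absolute value of its real part, which
reduces the claim to the real line. -/
lemma exists_lintegral_affine_rpow_stdComplexGaussian_le :
    ∃ C : ENNReal, C ≠ ⊤ ∧ 1 ≤ C ∧ ∀ a b : ℂ,
      ∫⁻ z, ‖a * z + b‖ₑ ^ (-(1 / 2) : ℝ) ∂stdComplexGaussian ≤ C * ‖a‖ₑ ^ (-(1 / 2) : ℝ) := by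
  obtain ⟨C, hC, hC1, h⟩ := exists_lintegral_add_const_rpow_gaussianReal_le
  refine ⟨C, hC, hC1, fun a b => ?_⟩
  -- For `a = 0` the right side is `C * ⊤`, and `1 ≤ C` makes it `⊤`. No nondegeneracy has to be
  -- assumed when `a` is a random minor.
  rcases eq_or_ne a 0 with rfl | ha
  · simp only [enorm_zero]
    rw [ENNReal.zero_rpow_of_neg (by norm_num), ENNReal.mul_top (by positivity)]
    exact le_top
  have h1 : ∀ z : ℂ, ‖a * z + b‖ₑ ^ (-(1 / 2) : ℝ) ≤
      ‖a‖ₑ ^ (-(1 / 2) : ℝ) * ‖z.re + (b / a).re‖ₑ ^ (-(1 / 2) : ℝ) := by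
    intro z
    have : a * z + b = a * (z + b / a) := by field_simp
    rw [this, enorm_mul, ENNReal.mul_rpow_of_ne_top (by simp) (by simp)]
    refine mul_le_mul_right ?_ _
    rw [ENNReal.rpow_neg, ENNReal.rpow_neg, ENNReal.inv_le_inv]
    refine ENNReal.rpow_le_rpow ?_ (by norm_num)
    rw [← Complex.add_re, enorm_le_iff_norm_le]
    exact Complex.abs_re_le_norm _
  calc _ ≤ ∫⁻ z : ℂ, ‖a‖ₑ ^ (-(1 / 2) : ℝ) * ‖z.re + (b / a).re‖ₑ ^ (-(1 / 2) : ℝ)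
        ∂stdComplexGaussian := lintegral_mono h1
    _ = ‖a‖ₑ ^ (-(1 / 2) : ℝ) * ∫⁻ z : ℂ, ‖z.re + (b / a).re‖ₑ ^ (-(1 / 2) : ℝ)
        ∂stdComplexGaussian := lintegral_const_mul _ (by fun_prop)
    _ = ‖a‖ₑ ^ (-(1 / 2) : ℝ) * ∫⁻ x, ‖x + (b / a).re‖ₑ ^ (-(1 / 2) : ℝ)
        ∂(gaussianReal 0 (1 / 2)) := by
        rw [← measurePreserving_re_stdComplexGaussian.lintegral_comp
          (f := fun x : ℝ => ‖x + (b / a).re‖ₑ ^ (-(1 / 2) : ℝ)) (by fun_prop)]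
    _ ≤ _ := by
        rw [mul_comm]
        gcongr
        exact h _

/-- The matrix with the given family of entries. -/
abbrev matOf {m n : Type*} (X : m × n → ℂ) : Matrix m n ℂ := Matrix.of fun i j => X (i, j)

lemma measurable_det_comp {α n : Type*} [MeasurableSpace α] [Fintype n] [DecidableEq n]
    {A : α → Matrix n n ℂ} (hA : ∀ i j, Measurable fun x => A x i j) :
    Measurable fun x => (A x).det := by
  simp only [Matrix.det_apply]
  refine Finset.measurable_sum _ fun σ _ => ?_
  refine Measurable.const_smul (Finset.measurable_prod _ fun i _ => hA _ _) _

/-- The determinant is affine in the corner entry, with the complementary minor as slope.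
Integrating this entry first costs a factor `C` and leaves the same integral for a matrix of size
one less. -/
theorem exists_lintegral_det_rpow_le :
    ∃ C : ENNReal, C ≠ ⊤ ∧ ∀ n : ℕ, ∫⁻ X, ‖(matOf X).det‖ₑ ^ (-(1 / 2) : ℝ)
      ∂(gaussianFamily (Fin n × Fin n)) ≤ C ^ n := by
  obtain ⟨C, hC, hC1, h⟩ := exists_lintegral_affine_rpow_stdComplexGaussian_le
  refine ⟨C, hC, fun n => ?_⟩
  induction n with
  | zero => simp
  | succ n ih =>
    have hmeas : ∀ n : ℕ, Measurable fun X : Fin n × Fin n → ℂ =>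
        ‖(matOf X).det‖ₑ ^ (-(1 / 2) : ℝ) := fun n =>
      (measurable_det_comp fun i j => by simp only [Matrix.of_apply]; fun_prop).enorm.pow_const _
    set g : Fin n × Fin n → Fin (n + 1) × Fin (n + 1) := fun x => (x.1.succ, x.2.succ) with hg
    have hginj : Function.Injective g := by
      rintro ⟨a, b⟩ ⟨c, d⟩ hx
      simpa [hg] using hx
    have hgm : Measurable fun X : Fin (n + 1) × Fin (n + 1) → ℂ => X ∘ g :=
      measurable_pi_lambda _ fun i => measurable_pi_apply _
    have hmeas' : Measurable fun X : Fin (n + 1) × Fin (n + 1) → ℂ =>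
        ‖(matOf (X ∘ g)).det‖ₑ ^ (-(1 / 2) : ℝ) := (hmeas n).comp hgm
    have hstep : ∫⁻ X, ‖(matOf X).det‖ₑ ^ (-(1 / 2) : ℝ)
        ∂(gaussianFamily (Fin (n + 1) × Fin (n + 1))) ≤
        ∫⁻ X, C * ‖(matOf (X ∘ g)).det‖ₑ ^ (-(1 / 2) : ℝ)
          ∂(gaussianFamily (Fin (n + 1) × Fin (n + 1))) := by
      refine lintegral_le_of_lmarginal_le {((0 : Fin (n + 1)), (0 : Fin (n + 1)))} (hmeas _)
        (hmeas'.const_mul C) fun X => ?_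
      rw [lmarginal_singleton, lmarginal_singleton]
      have hcomp : ∀ z, Function.update X (0, 0) z ∘ g = X ∘ g := by
        intro z
        ext i
        simp only [Function.comp_apply]
        rw [Function.update_of_ne]
        simp [hg, Prod.ext_iff]
      simp only [hcomp, lintegral_const, measure_univ, mul_one]
      have hdet : ∃ b : ℂ, ∀ z, (matOf (Function.update X (0, 0) z)).det =
          (matOf (X ∘ g)).det * z + b := by
        refine ⟨∑ j : Fin n, (-1) ^ (j.succ : ℕ) * X (0, j.succ) *
          ((matOf X).submatrix Fin.succ j.succ.succAbove).det, fun z => ?_⟩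
        rw [Matrix.det_succ_row_zero, Fin.sum_univ_succ]
        congr 1
        simp only [Fin.val_zero, pow_zero, one_mul, Matrix.of_apply, Function.update_self]
        rw [mul_comm]
        congr 2
      obtain ⟨b, hb⟩ := hdet
      simp only [hb]
      exact h _ _
    refine hstep.trans ?_
    rw [lintegral_const_mul _ hmeas', pow_succ, mul_comm]
    gcongr
    have hmp : MeasurePreserving (fun X : Fin (n + 1) × Fin (n + 1) → ℂ => X ∘ g)
      (gaussianFamily _) (gaussianFamily _) := ⟨hgm, map_precomp_gaussianFamily hginj⟩
    rw [hmp.lintegral_comp (hmeas n)]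
    exact ih

/-! ### Functions with finite moments of all orders -/

/-- All absolute moments of `f` are finite. -/
def HasAllMoments {α : Type*} [MeasurableSpace α] (f : α → ℂ) (μ : Measure α) : Prop :=
  ∀ q : ENNReal, q ≠ ⊤ → MemLp f q μ

namespace HasAllMoments

variable {α : Type*} [MeasurableSpace α] {μ : Measure α} {f g : α → ℂ}

lemma mul (hf : HasAllMoments f μ) (hg : HasAllMoments g μ) :
    HasAllMoments (fun x => f x * g x) μ := by
  intro q hq
  have : ENNReal.HolderTriple (2 * q) (2 * q) q := ⟨by
    rw [ENNReal.mul_inv (by simp) (by simp), ← add_mul, ENNReal.inv_two_add_inv_two, one_mul]⟩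
  have h := ENNReal.mul_ne_top (ENNReal.ofNat_ne_top (n := 2)) hq
  exact (hg (2 * q) h).mul (hf (2 * q) h)

lemma const [IsFiniteMeasure μ] (c : ℂ) : HasAllMoments (fun _ => c) μ :=
  fun _ _ => memLp_const c

lemma const_mul (hf : HasAllMoments f μ) (c : ℂ) : HasAllMoments (fun x => c * f x) μ :=
  fun q hq => (hf q hq).const_mul c

lemma sub (hf : HasAllMoments f μ) (hg : HasAllMoments g μ) :
    HasAllMoments (fun x => f x - g x) μ :=
  fun q hq => (hf q hq).sub (hg q hq)

lemma star (hf : HasAllMoments f μ) : HasAllMoments (fun x => star (f x)) μ :=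
  fun q hq => (hf q hq).star

lemma sum {ι : Type*} (s : Finset ι) {f : ι → α → ℂ} (hf : ∀ i ∈ s, HasAllMoments (f i) μ) :
    HasAllMoments (fun x => ∑ i ∈ s, f i x) μ :=
  fun q hq => memLp_finsetSum s fun i hi => hf i hi q hq

lemma prod [IsFiniteMeasure μ] {ι : Type*} (s : Finset ι) {f : ι → α → ℂ}
    (hf : ∀ i ∈ s, HasAllMoments (f i) μ) : HasAllMoments (fun x => ∏ i ∈ s, f i x) μ := by
  classical
  induction s using Finset.induction_on with
  | empty => simpa using const 1
  | insert a s ha ih =>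
    simp only [Finset.prod_insert ha]
    exact (hf a (by simp)).mul (ih fun i hi => hf i (by simp [hi]))

lemma det [IsFiniteMeasure μ] {n : Type*} [Fintype n] [DecidableEq n] {A : α → Matrix n n ℂ}
    (hA : ∀ i j, HasAllMoments (fun x => A x i j) μ) : HasAllMoments (fun x => (A x).det) μ := by
  simp only [Matrix.det_apply']
  exact sum _ fun σ _ => (prod _ fun i _ => hA _ _).const_mul _

lemma integrable_norm_pow [IsFiniteMeasure μ] (hf : HasAllMoments f μ) (n : ℕ) :
    Integrable (fun x => ‖f x‖ ^ n) μ :=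
  (hf n (by simp)).integrable_norm_pow'

lemma integrable (hf : HasAllMoments f μ) : Integrable f μ :=
  memLp_one_iff_integrable.1 (hf 1 (by simp))

end HasAllMoments

lemma hasAllMoments_eval {ι : Type*} [Fintype ι] (i : ι) :
    HasAllMoments (fun x : ι → ℂ => x i) (gaussianFamily ι) := fun _ hq =>
  (memLp_id_stdComplexGaussian hq).comp_measurePreserving (measurePreserving_eval_gaussianFamily i)

/-! ### Lower bounds for Gram matrices -/

/-- A lower bound for the square of the smallest singular value of a square matrix. -/
def singularBound {n : Type*} [Fintype n] [DecidableEq n] (A : Matrix n n ℂ) : ℝ :=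
  ‖A.det‖ ^ 2 / (∑ i, ∑ j, ‖A.adjugate i j‖ ^ 2 + 1)

lemma singularBound_nonneg {n : Type*} [Fintype n] [DecidableEq n] (A : Matrix n n ℂ) :
    0 ≤ singularBound A := by unfold singularBound; positivity

lemma singularBound_pos {n : Type*} [Fintype n] [DecidableEq n] {A : Matrix n n ℂ}
    (hA : A.det ≠ 0) : 0 < singularBound A := by
  have := norm_pos_iff.2 hA
  unfold singularBound
  positivity

lemma norm_dotProduct_sq_le {n : Type*} [Fintype n] (a b : n → ℂ) :
    ‖a ⬝ᵥ b‖ ^ 2 ≤ (∑ i, ‖a i‖ ^ 2) * ∑ i, ‖b i‖ ^ 2 := by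
  calc ‖a ⬝ᵥ b‖ ^ 2 ≤ (∑ i, ‖a i‖ * ‖b i‖) ^ 2 := by
        gcongr
        refine (norm_sum_le _ _).trans (le_of_eq ?_)
        simp
    _ ≤ _ := Finset.sum_mul_sq_le_sq_mul_sq _ _ _

/-- From `det A • v = adj(A) (A v)` and Cauchy-Schwarz on the rows of the adjugate. The `+ 1` in the
denominator of `singularBound` spares a case distinction when the adjugate vanishes. -/
lemma singularBound_mul_le {n : Type*} [Fintype n] [DecidableEq n] (A : Matrix n n ℂ)
    (v : n → ℂ) : singularBound A * ∑ i, ‖v i‖ ^ 2 ≤ ∑ i, ‖(A *ᵥ v) i‖ ^ 2 := by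
  have h1 : ∀ i, ‖A.det‖ ^ 2 * ‖v i‖ ^ 2 ≤
      (∑ j, ‖A.adjugate i j‖ ^ 2) * ∑ j, ‖(A *ᵥ v) j‖ ^ 2 := by
    intro i
    have : A.det * v i = (A.adjugate i) ⬝ᵥ (A *ᵥ v) := by
      have h := congrFun (congrArg (· *ᵥ v) (Matrix.adjugate_mul A)) i
      simp only [← Matrix.mulVec_mulVec, Matrix.smul_mulVec, Matrix.one_mulVec, Pi.smul_apply,
        smul_eq_mul] at h
      rw [← h]
      rfl
    rw [← mul_pow, ← norm_mul, this]
    exact norm_dotProduct_sq_le _ _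
  have h2 := Finset.sum_le_sum fun i (_ : i ∈ Finset.univ) => h1 i
  rw [← Finset.mul_sum, ← Finset.sum_mul] at h2
  rw [singularBound, div_mul_eq_mul_div, div_le_iff₀ (by positivity)]
  refine h2.trans ?_
  rw [mul_comm]
  gcongr
  simp

/-- The Gram matrix `Xᴴ X`. -/
abbrev gram {m n : Type*} [Fintype m] (A : Matrix m n ℂ) : Matrix n n ℂ := Aᴴ * A

lemma star_dotProduct_gram_mulVec {m n : Type*} [Fintype m] [Fintype n] (A : Matrix m n ℂ)
    (v : n → ℂ) : star v ⬝ᵥ (gram A *ᵥ v) = ((∑ i, ‖(A *ᵥ v) i‖ ^ 2 : ℝ) : ℂ) := by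
  rw [← Matrix.mulVec_mulVec, Matrix.dotProduct_mulVec, ← Matrix.star_mulVec]
  simp only [dotProduct, Pi.star_apply, RCLike.star_def, Complex.ofReal_sum, Complex.ofReal_pow]
  exact Finset.sum_congr rfl fun i _ => Complex.conj_mul' _

lemma isUnit_det_gram_of_bound {m n : Type*} [Fintype m] [Fintype n] [DecidableEq n]
    {A : Matrix m n ℂ} {c : ℝ} (hc : 0 < c)
    (h : ∀ v : n → ℂ, c * ∑ i, ‖v i‖ ^ 2 ≤ ∑ i, ‖(A *ᵥ v) i‖ ^ 2) :
    IsUnit (gram A).det := by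
  rw [isUnit_iff_ne_zero]
  intro h0
  obtain ⟨v, hv, hv0⟩ := Matrix.exists_mulVec_eq_zero_iff.2 h0
  have h1 := star_dotProduct_gram_mulVec A v
  rw [hv0, dotProduct_zero, eq_comm, Complex.ofReal_eq_zero] at h1
  have h2 := h v
  rw [h1] at h2
  apply hv
  have h3 : ∑ i, ‖v i‖ ^ 2 = 0 := by
    have : 0 ≤ ∑ i, ‖v i‖ ^ 2 := by positivity
    nlinarith
  rw [Finset.sum_eq_zero_iff_of_nonneg fun i _ => by positivity] at h3
  ext i
  simpa using h3 i (Finset.mem_univ i)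

/-- For `v` the column `b` of the inverse, `v* (AᴴA) v` is the conjugate of `v b`, so `c ‖v‖² ≤ |v
b|`. This bounds first `|v b|` by `c⁻¹` and then every other entry. -/
lemma norm_inv_gram_apply_le {m n : Type*} [Fintype m] [Fintype n] [DecidableEq n]
    {A : Matrix m n ℂ} {c : ℝ} (hc : 0 < c)
    (h : ∀ v : n → ℂ, c * ∑ i, ‖v i‖ ^ 2 ≤ ∑ i, ‖(A *ᵥ v) i‖ ^ 2) (a b : n) :
    ‖(gram A)⁻¹ a b‖ ≤ c⁻¹ := by
  set v : n → ℂ := fun i => (gram A)⁻¹ i b with hv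
  have hSv : gram A *ᵥ v = Pi.single b 1 := by
    have hu := isUnit_det_gram_of_bound hc h
    have : v = (gram A)⁻¹ *ᵥ Pi.single b 1 := by
      ext i; simp [hv]
    rw [this, Matrix.mulVec_mulVec, Matrix.mul_nonsing_inv _ hu, Matrix.one_mulVec]
  have h1 := star_dotProduct_gram_mulVec A v
  rw [hSv, dotProduct_single, mul_one] at h1
  have h2 : ∑ i, ‖(A *ᵥ v) i‖ ^ 2 = ‖v b‖ := by
    have := congrArg norm h1
    rw [Complex.norm_real, Real.norm_of_nonneg (by positivity)] at this
    rw [← this]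
    simp
  have h3 := h v
  rw [h2] at h3
  have hle : ∀ i, ‖v i‖ ^ 2 ≤ ∑ i, ‖v i‖ ^ 2 := fun i =>
    Finset.single_le_sum (f := fun i => ‖v i‖ ^ 2) (fun i _ => by positivity) (Finset.mem_univ i)
  have hb : ‖v b‖ ≤ c⁻¹ := by
    rcases eq_or_lt_of_le (norm_nonneg (v b)) with h0 | h0
    · rw [← h0]; positivity
    · rw [← one_div, le_div_iff₀ hc]
      have := (mul_le_mul_of_nonneg_left (hle b) hc.le).trans h3
      nlinarith
  have ha : ‖v a‖ ^ 2 ≤ (c⁻¹) ^ 2 := by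
    have h4 : ‖v a‖ ^ 2 ≤ c⁻¹ * ‖v b‖ := by
      rw [inv_mul_eq_div, le_div_iff₀ hc, mul_comm]
      exact (mul_le_mul_of_nonneg_left (hle a) hc.le).trans h3
    refine h4.trans ?_
    rw [sq]
    gcongr
  exact (sq_le_sq₀ (norm_nonneg _) (by positivity)).1 ha

/-- Arithmetic-geometric mean inequality. The exponent `-4/B` is factored as `(-1/8) * (32/B)`: the
first power has a finite mean for Gaussian blocks, and the second is at most `1` as soon as `B ≥
32`, as Jensen requires. -/
lemma inv_sum_pow_four_le {B : ℕ} (hB : 0 < B) (m : Fin B → ℝ) (hm : ∀ b, 0 < m b) :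
    (∑ b, m b)⁻¹ ^ 4 ≤ ((B : ℝ)⁻¹) ^ 4 * ∏ b, ((m b) ^ (-(1 / 8) : ℝ)) ^ (32 / B : ℝ) := by
  have hB' : (0 : ℝ) < B := by exact_mod_cast hB
  have h := Real.geom_mean_le_arith_mean_weighted Finset.univ (fun _ : Fin B => (B : ℝ)⁻¹) m
    (fun _ _ => by positivity) (by simp [hB'.ne']) (fun b _ => (hm b).le)
  rw [← Finset.mul_sum] at h
  have hpos : 0 < ∏ b, m b ^ (B : ℝ)⁻¹ := Finset.prod_pos fun b _ => Real.rpow_pos_of_pos (hm b) _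
  have h2 : (∑ b, m b)⁻¹ ≤ (B : ℝ)⁻¹ * (∏ b, m b ^ (B : ℝ)⁻¹)⁻¹ := by
    rw [← mul_inv]
    apply inv_anti₀ (by positivity)
    rw [inv_mul_eq_div, le_div_iff₀ hB'] at h
    linarith
  have hs : 0 ≤ (∑ b, m b)⁻¹ := inv_nonneg.2 (Finset.sum_nonneg fun b _ => (hm b).le)
  calc (∑ b, m b)⁻¹ ^ 4 ≤ ((B : ℝ)⁻¹ * (∏ b, m b ^ (B : ℝ)⁻¹)⁻¹) ^ 4 := by gcongr
    _ = _ := by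
      rw [mul_pow, ← Finset.prod_inv_distrib, ← Finset.prod_pow]
      congr 1
      refine Finset.prod_congr rfl fun b _ => ?_
      rw [← Real.rpow_neg (hm b).le, ← Real.rpow_natCast, ← Real.rpow_mul (hm b).le,
        ← Real.rpow_mul (hm b).le]
      congr 1
      field_simp
      norm_num

/-! ### Moments of inverse Gram matrices of Gaussian matrices -/

/-- With `d = |det A|` and `s` the denominator, the left side is `d^(-1/4) s^(1/8)`, and `x y ≤ x² +
y²` separates the determinant from the adjugate. Since `s ≥ 1`, `s^(1/4)` is at most `s`, a
polynomial moment. -/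
lemma ofReal_singularBound_rpow_le {n : Type*} [Fintype n] [DecidableEq n] (A : Matrix n n ℂ) :
    ENNReal.ofReal (singularBound A) ^ (-(1 / 8) : ℝ) ≤ ‖A.det‖ₑ ^ (-(1 / 2) : ℝ) +
      ENNReal.ofReal (∑ i, ∑ j, ‖A.adjugate i j‖ ^ 2 + 1) := by
  by_cases hA : A.det = 0
  · rw [hA, enorm_zero, ENNReal.zero_rpow_of_neg (by norm_num), top_add]
    exact le_top
  have hd := norm_pos_iff.2 hA
  rw [ENNReal.ofReal_rpow_of_pos (singularBound_pos hA), ← ofReal_norm,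
    ENNReal.ofReal_rpow_of_pos hd, ← ENNReal.ofReal_add (by positivity) (by positivity)]
  apply ENNReal.ofReal_le_ofReal
  rw [singularBound]
  set d := ‖A.det‖
  set s := ∑ i, ∑ j, ‖A.adjugate i j‖ ^ 2 + 1
  have hs : 1 ≤ s := le_add_of_nonneg_left (by positivity)
  have hs0 : 0 < s := by linarith
  have h1 : (d ^ 2 / s) ^ (-(1 / 8) : ℝ) = d ^ (-(1 / 4) : ℝ) * s ^ (1 / 8 : ℝ) := by
    rw [Real.div_rpow (by positivity) hs0.le, Real.rpow_neg hs0.le, div_inv_eq_mul,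
      ← Real.rpow_natCast, ← Real.rpow_mul hd.le]
    norm_num
  have h2 : d ^ (-(1 / 2) : ℝ) = (d ^ (-(1 / 4) : ℝ)) ^ 2 := by
    rw [← Real.rpow_natCast, ← Real.rpow_mul hd.le]
    norm_num
  have h3 : (s ^ (1 / 8 : ℝ)) ^ 2 ≤ s := by
    rw [← Real.rpow_natCast, ← Real.rpow_mul hs0.le]
    conv_rhs => rw [← Real.rpow_one s]
    exact Real.rpow_le_rpow_of_exponent_le hs (by norm_num)
  rw [h1, h2]
  nlinarith [sq_nonneg (d ^ (-(1 / 4) : ℝ) - s ^ (1 / 8 : ℝ)), sq_nonneg (d ^ (-(1 / 4) : ℝ)),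
    sq_nonneg (s ^ (1 / 8 : ℝ))]

lemma measurable_adjugate_apply {α n : Type*} [MeasurableSpace α] [Fintype n] [DecidableEq n]
    {A : α → Matrix n n ℂ} (hA : ∀ i j, Measurable fun x => A x i j) (i j : n) :
    Measurable fun x => (A x).adjugate i j := by
  simp only [Matrix.adjugate_apply]
  refine measurable_det_comp fun a b => ?_
  simp only [Matrix.updateRow_apply]
  split_ifs
  · exact measurable_const
  · exact hA _ _

lemma HasAllMoments.adjugate {α n : Type*} [MeasurableSpace α] {μ : Measure α} [IsFiniteMeasure μ]
    [Fintype n] [DecidableEq n] {A : α → Matrix n n ℂ}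
    (hA : ∀ i j, HasAllMoments (fun x => A x i j) μ) (i j : n) :
    HasAllMoments (fun x => (A x).adjugate i j) μ := by
  simp only [Matrix.adjugate_apply]
  refine HasAllMoments.det fun a b => ?_
  simp only [Matrix.updateRow_apply]
  split_ifs
  · exact HasAllMoments.const _
  · exact hA _ _

lemma measurable_singularBound_matOf (n : ℕ) :
    Measurable fun X : Fin n × Fin n → ℂ => singularBound (matOf X) := by
  have h : ∀ i j, Measurable fun X : Fin n × Fin n → ℂ => matOf X i j := fun i j => by
    simp only [Matrix.of_apply]; fun_prop
  unfold singularBound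
  refine ((measurable_det_comp h).norm.pow_const 2).div (Measurable.add_const ?_ 1)
  exact Finset.measurable_sum _ fun i _ => Finset.measurable_sum _ fun j _ =>
    (measurable_adjugate_apply h i j).norm.pow_const 2

lemma lintegral_singularBound_rpow_lt_top (n : ℕ) :
    ∫⁻ X, ENNReal.ofReal (singularBound (matOf X)) ^ (-(1 / 8) : ℝ)
      ∂(gaussianFamily (Fin n × Fin n)) < ⊤ := by
  obtain ⟨C, hC, h⟩ := exists_lintegral_det_rpow_le
  have hm : ∀ i j, Measurable fun X : Fin n × Fin n → ℂ => matOf X i j := fun i j => by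
    simp only [Matrix.of_apply]; fun_prop
  refine lt_of_le_of_lt (lintegral_mono fun X => ofReal_singularBound_rpow_le (matOf X)) ?_
  rw [lintegral_add_left ((measurable_det_comp hm).enorm.pow_const _)]
  refine ENNReal.add_lt_top.2 ⟨lt_of_le_of_lt (h n) (ENNReal.pow_lt_top hC.lt_top), ?_⟩
  have hi : Integrable (fun X : Fin n × Fin n → ℂ =>
      ∑ i, ∑ j, ‖(matOf X).adjugate i j‖ ^ 2 + 1) (gaussianFamily (Fin n × Fin n)) := by
    refine Integrable.add (integrable_finsetSum _ fun i _ => integrable_finsetSum _ fun j _ => ?_)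
      (integrable_const 1)
    exact (HasAllMoments.adjugate (fun a b => hasAllMoments_eval (a, b)) i j).integrable_norm_pow 2
  exact hi.lintegral_lt_top

/-- The negative power takes the value `⊤` at `0`, which its finite mean excludes almost everywhere.
-/
lemma ae_singularBound_pos (n : ℕ) :
    ∀ᵐ X ∂(gaussianFamily (Fin n × Fin n)), 0 < singularBound (matOf X) := by
  filter_upwards [ae_lt_top (((measurable_singularBound_matOf n).ennreal_ofReal).pow_const _)
    (lintegral_singularBound_rpow_lt_top n).ne] with X hX
  refine lt_of_le_of_ne (singularBound_nonneg _) fun h => ?_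
  rw [← h, ENNReal.ofReal_zero, ENNReal.zero_rpow_of_neg (by norm_num)] at hX
  exact lt_irrefl _ hX

lemma map_curry_gaussianFamily {I J : Type*} [Fintype I] [Fintype J] :
    (gaussianFamily (I × J)).map (MeasurableEquiv.curry I J ℂ) =
      Measure.pi fun _ : I => gaussianFamily J := by
  have h := Measure.infinitePi_map_curry (fun (_ : I) (_ : J) => stdComplexGaussian)
  simpa only [Measure.infinitePi_eq_pi] using h

/-- The index of row `i` in the `b`-th block of `K` consecutive rows. -/
def blockRow {M K : ℕ} (b : Fin (M / K)) (i : Fin K) : Fin M :=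
  Fin.castLE (Nat.div_mul_le_self M K) (finProdFinEquiv (b, i))

lemma blockRow_injective {M K : ℕ} :
    Function.Injective fun x : Fin (M / K) × Fin K => (blockRow x.1 x.2 : Fin M) := by
  intro x y h
  exact finProdFinEquiv.injective (Fin.castLE_injective _ h)

/-- The `b`-th square block of a family of entries. -/
def block {M K : ℕ} (X : Fin M × Fin K → ℂ) (b : Fin (M / K)) : Fin K × Fin K → ℂ :=
  fun ij => X (blockRow b ij.1, ij.2)

lemma measurePreserving_block (M K : ℕ) :
    MeasurePreserving (block : (Fin M × Fin K → ℂ) → _) (gaussianFamily (Fin M × Fin K))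
      (Measure.pi fun _ : Fin (M / K) => gaussianFamily (Fin K × Fin K)) := by
  set g : Fin (M / K) × (Fin K × Fin K) → Fin M × Fin K :=
    fun x => (blockRow x.1 x.2.1, x.2.2) with hg
  have hginj : Function.Injective g := by
    rintro ⟨a, b, c⟩ ⟨a', b', c'⟩ h
    simp only [hg, Prod.mk.injEq] at h
    have := blockRow_injective (a₁ := (a, b)) (a₂ := (a', b')) h.1
    simp_all
  have h1 : MeasurePreserving (fun X : Fin M × Fin K → ℂ => X ∘ g) (gaussianFamily _)
      (gaussianFamily _) :=
    ⟨measurable_pi_lambda _ fun i => measurable_pi_apply _, map_precomp_gaussianFamily hginj⟩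
  have h2 : MeasurePreserving (MeasurableEquiv.curry (Fin (M / K)) (Fin K × Fin K) ℂ)
      (gaussianFamily _) (Measure.pi fun _ => gaussianFamily _) :=
    ⟨MeasurableEquiv.measurable _, map_curry_gaussianFamily⟩
  exact h2.comp h1

/-- The blocks use disjoint rows; the fewer than `K` leftover rows only increase the right side. -/
lemma sum_singularBound_block_mul_le {M K : ℕ} (X : Fin M × Fin K → ℂ) (v : Fin K → ℂ) :
    (∑ b, singularBound (matOf (block X b))) * ∑ i, ‖v i‖ ^ 2 ≤
      ∑ m, ‖(matOf X *ᵥ v) m‖ ^ 2 := by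
  rw [Finset.sum_mul]
  calc _ ≤ ∑ b, ∑ i, ‖(matOf (block X b) *ᵥ v) i‖ ^ 2 :=
        Finset.sum_le_sum fun b _ => singularBound_mul_le _ _
    _ = ∑ x : Fin (M / K) × Fin K, ‖(matOf X *ᵥ v) (blockRow x.1 x.2)‖ ^ 2 := by
        rw [Fintype.sum_prod_type]
        rfl
    _ = ∑ m ∈ Finset.univ.map ⟨_, blockRow_injective⟩, ‖(matOf X *ᵥ v) m‖ ^ 2 := by
        rw [Finset.sum_map]
        rfl
    _ ≤ _ := Finset.sum_le_univ_sum_of_nonneg fun m => by positivity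

lemma ae_blocks_pos (M K : ℕ) : ∀ᵐ X ∂(gaussianFamily (Fin M × Fin K)),
    ∀ b, 0 < singularBound (matOf (block X b)) := by
  rw [ae_all_iff]
  intro b
  have h : MeasurePreserving (fun X : Fin M × Fin K → ℂ => block X b) (gaussianFamily _)
      (gaussianFamily _) :=
    (measurePreserving_eval (fun _ => gaussianFamily _) b).comp (measurePreserving_block M K)
  exact h.quasiMeasurePreserving.ae (ae_singularBound_pos K)

lemma ae_isUnit_det_gram {M K : ℕ} (hK : 0 < K) (hM : K ≤ M) :
    ∀ᵐ X ∂(gaussianFamily (Fin M × Fin K)), IsUnit (gram (matOf X)).det := by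
  filter_upwards [ae_blocks_pos M K] with X hX
  refine isUnit_det_gram_of_bound (Finset.sum_pos (fun b _ => hX b) ?_)
    (sum_singularBound_block_mul_le X)
  exact ⟨⟨0, Nat.div_pos hM hK⟩, Finset.mem_univ _⟩

/-- Jensen for the concave power `s`, obtained from monotonicity of the `L^p` norms under a
probability measure. -/
lemma lintegral_rpow_le_rpow_lintegral {α : Type*} [MeasurableSpace α] (μ : Measure α)
    [IsProbabilityMeasure μ] {f : α → ENNReal} (hf : Measurable f) {s : ℝ} (hs : 0 < s)
    (hs1 : s ≤ 1) : ∫⁻ x, f x ^ s ∂μ ≤ (∫⁻ x, f x ∂μ) ^ s := by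
  have h := eLpNorm'_le_eLpNorm'_of_exponent_le (f := f) hs hs1 μ hf.aestronglyMeasurable
  simp only [eLpNorm', enorm_eq_self, ENNReal.rpow_one, div_one] at h
  calc ∫⁻ x, f x ^ s ∂μ = ((∫⁻ x, f x ^ s ∂μ) ^ (1 / s)) ^ s := by
        rw [← ENNReal.rpow_mul, one_div_mul_cancel hs.ne', ENNReal.rpow_one]
    _ ≤ _ := ENNReal.rpow_le_rpow h hs.le

/-- The fourth moments of the normalized inverse Gram matrix are bounded uniformly in the number
of rows. -/
theorem exists_lintegral_inv_gram_pow_four_le {K : ℕ} (hK : 0 < K) :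
    ∃ C : ENNReal, C ≠ ⊤ ∧ ∀ M, 32 * K ≤ M → ∀ a b,
      ∫⁻ X, ‖(M : ℂ) * (gram (matOf X))⁻¹ a b‖ₑ ^ 4 ∂(gaussianFamily (Fin M × Fin K)) ≤ C := by
  set I := ∫⁻ X, ENNReal.ofReal (singularBound (matOf X)) ^ (-(1 / 8) : ℝ)
      ∂(gaussianFamily (Fin K × Fin K)) with hI
  have hItop : I ≠ ⊤ := (lintegral_singularBound_rpow_lt_top K).ne
  refine ⟨ENNReal.ofReal ((2 * K) ^ 4) * I ^ 32, ENNReal.mul_ne_top ENNReal.ofReal_ne_top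
    (ENNReal.pow_ne_top hItop), fun M hM a b => ?_⟩
  set B := M / K with hB
  -- The threshold `32 * K` is chosen so that `32 / B ≤ 1` in Jensen's inequality below.
  have hB32 : 32 ≤ B := (Nat.le_div_iff_mul_le hK).2 hM
  have hBpos : 0 < B := by omega
  have hBr : (0 : ℝ) < B := by exact_mod_cast hBpos
  -- The number of rows is comparable to the number of blocks, so the factor `M⁴` is absorbed by
  -- `B⁻⁴` from the mean inequality.
  have hMB : (M : ℝ) ≤ 2 * K * B := by
    have h1 : M < K * (B + 1) := Nat.lt_mul_div_succ M hK
    have h2 : M ≤ 2 * K * B := by nlinarith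
    exact_mod_cast h2
  set φ : (Fin K × Fin K → ℂ) → ENNReal :=
    fun Y => (ENNReal.ofReal (singularBound (matOf Y)) ^ (-(1 / 8) : ℝ)) ^ (32 / B : ℝ) with hφ
  have hφm : Measurable φ :=
    (((measurable_singularBound_matOf K).ennreal_ofReal).pow_const _).pow_const _
  have hpt : ∀ᵐ X ∂(gaussianFamily (Fin M × Fin K)),
      ‖(M : ℂ) * (gram (matOf X))⁻¹ a b‖ₑ ^ 4 ≤
        ENNReal.ofReal ((2 * K) ^ 4) * ∏ b, φ (block X b) := by
    filter_upwards [ae_blocks_pos M K] with X hX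
    have hpos : 0 < ∑ b, singularBound (matOf (block X b)) :=
      Finset.sum_pos (fun b _ => hX b) ⟨⟨0, hBpos⟩, Finset.mem_univ _⟩
    have h1 := norm_inv_gram_apply_le hpos (sum_singularBound_block_mul_le X) a b
    have h2 := inv_sum_pow_four_le hBpos _ hX
    have h3 : ∏ b, φ (block X b) = ENNReal.ofReal
        (∏ b, (singularBound (matOf (block X b)) ^ (-(1 / 8) : ℝ)) ^ (32 / B : ℝ)) := by
      rw [ENNReal.ofReal_prod_of_nonneg fun b _ =>
        Real.rpow_nonneg (Real.rpow_nonneg (hX b).le _) _]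
      refine Finset.prod_congr rfl fun b _ => ?_
      rw [← ENNReal.ofReal_rpow_of_pos (Real.rpow_pos_of_pos (hX b) _),
        ← ENNReal.ofReal_rpow_of_pos (hX b)]
    rw [h3, ← ENNReal.ofReal_mul (by positivity), ← ofReal_norm,
      ← ENNReal.ofReal_pow (norm_nonneg _)]
    apply ENNReal.ofReal_le_ofReal
    rw [norm_mul, mul_pow, Complex.norm_natCast]
    calc (M : ℝ) ^ 4 * ‖(gram (matOf X))⁻¹ a b‖ ^ 4
        ≤ (2 * K * B) ^ 4 * ((∑ b, singularBound (matOf (block X b)))⁻¹) ^ 4 := by gcongr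
      _ ≤ (2 * K * B) ^ 4 * (((B : ℝ)⁻¹) ^ 4 *
          ∏ b, (singularBound (matOf (block X b)) ^ (-(1 / 8) : ℝ)) ^ (32 / B : ℝ)) := by gcongr
      _ = _ := by field_simp
  -- Independence factors the integral, and Jensen bounds each of the `B` factors by `I^(32/B)`. The
  -- exponents multiply to `32`, so the bound does not depend on `M`.
  have hprod : ∫⁻ X, ∏ b, φ (block X b) ∂(gaussianFamily (Fin M × Fin K)) ≤ I ^ 32 := by
    rw [(measurePreserving_block M K).lintegral_comp (f := fun Y => ∏ b, φ (Y b))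
      (Finset.measurable_prod _ fun b _ => hφm.comp (measurable_pi_apply b))]
    have hind := iIndepFun_pi (μ := fun _ : Fin (M / K) => gaussianFamily (Fin K × Fin K))
      (X := fun _ => φ) (fun _ => hφm.aemeasurable)
    rw [lintegral_prod_eq_prod_lintegral_of_indepFun Finset.univ _ hind
      (fun b => hφm.comp (measurable_pi_apply b))]
    have h1 : ∀ b : Fin (M / K), ∫⁻ Y, φ (Y b)
        ∂(Measure.pi fun _ : Fin (M / K) => gaussianFamily (Fin K × Fin K)) ≤
          I ^ (32 / B : ℝ) := by
      intro b
      rw [(measurePreserving_eval (fun _ : Fin (M / K) => gaussianFamily (Fin K × Fin K))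
        b).lintegral_comp hφm]
      exact lintegral_rpow_le_rpow_lintegral _
        (((measurable_singularBound_matOf K).ennreal_ofReal).pow_const _) (by positivity)
        ((div_le_one hBr).2 (by exact_mod_cast hB32))
    refine (Finset.prod_le_prod' fun b _ => h1 b).trans (le_of_eq ?_)
    rw [Finset.prod_const, Finset.card_univ, Fintype.card_fin, ← hB, ← ENNReal.rpow_natCast,
      ← ENNReal.rpow_mul, div_mul_cancel₀ _ hBr.ne']
    exact_mod_cast ENNReal.rpow_natCast I 32
  calc _ ≤ ∫⁻ X, ENNReal.ofReal ((2 * K) ^ 4) * ∏ b, φ (block X b)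
        ∂(gaussianFamily (Fin M × Fin K)) := lintegral_mono_ae hpt
    _ = ENNReal.ofReal ((2 * K) ^ 4) * ∫⁻ X, ∏ b, φ (block X b)
        ∂(gaussianFamily (Fin M × Fin K)) :=
      lintegral_const_mul _ (Finset.measurable_prod _ fun b _ => hφm.comp
        ((measurable_pi_apply b).comp (measurePreserving_block M K).measurable))
    _ ≤ _ := by gcongr

/-! ### Sums of independent centered complex variables -/

lemma norm_add_sq_eq (a b : ℂ) : ‖a + b‖ ^ 2 = ‖a‖ ^ 2 + ‖b‖ ^ 2 + 2 * (a * star b).re := by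
  simp only [← Complex.normSq_eq_norm_sq, Complex.normSq_add]
  rfl

/-- Only the square of the cross term is estimated. The two terms linear in it are kept exactly,
since they integrate to zero for independent centered `a` and `b`. -/
lemma norm_add_pow_four_le (a b : ℂ) : ‖a + b‖ ^ 4 ≤ ‖a‖ ^ 4 + 6 * (‖a‖ ^ 2 * ‖b‖ ^ 2) + ‖b‖ ^ 4 +
    4 * ((((‖a‖ ^ 2 : ℝ) : ℂ) * a) * star b).re + 4 * (a * (((‖b‖ ^ 2 : ℝ) : ℂ) * star b)).re := by
  have h1 : ‖a + b‖ ^ 4 = (‖a‖ ^ 2 + ‖b‖ ^ 2 + 2 * (a * star b).re) ^ 2 := by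
    rw [← norm_add_sq_eq]; ring
  have h2 : (a * star b).re ^ 2 ≤ ‖a‖ ^ 2 * ‖b‖ ^ 2 := by
    rw [← mul_pow, ← sq_abs (a * star b).re]
    gcongr
    refine (Complex.abs_re_le_norm _).trans ?_
    simp
  have h3 : ((((‖a‖ ^ 2 : ℝ) : ℂ) * a) * star b).re = ‖a‖ ^ 2 * (a * star b).re := by
    rw [mul_assoc, Complex.re_ofReal_mul]
  have h4 : (a * (((‖b‖ ^ 2 : ℝ) : ℂ) * star b)).re = ‖b‖ ^ 2 * (a * star b).re := by
    rw [mul_left_comm, Complex.re_ofReal_mul]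
  rw [h1, h3, h4]
  nlinarith

lemma HasAllMoments.norm_sq_ofReal {α : Type*} [MeasurableSpace α] {μ : Measure α} {f : α → ℂ}
    (hf : HasAllMoments f μ) : HasAllMoments (fun x => ((‖f x‖ ^ 2 : ℝ) : ℂ)) μ := by
  have := hf.mul hf.star
  refine fun q hq => (this q hq).congr_norm ?_ (Eventually.of_forall fun x => ?_)
  · exact (Complex.continuous_ofReal.comp_aestronglyMeasurable
      ((hf 1 (by simp)).aestronglyMeasurable.norm.pow 2))
  · simp [sq]

/-- Induction on the summands. A new summand adds at most `w + 6 n v²` to the fourth moment, less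
than the increment `w + (6 n + 3) v²` of the bound up to the nonnegative term `3 v²`. -/
theorem moments_sum_of_iIndepFun {Ω ι : Type*} [MeasurableSpace Ω] {P : Measure Ω}
    [IsProbabilityMeasure P] {ζ : ι → Ω → ℂ} (hm : ∀ i, Measurable (ζ i)) (hi : iIndepFun ζ P)
    (hL : ∀ i, HasAllMoments (ζ i) P) (h0 : ∀ i, ∫ ω, ζ i ω ∂P = 0) {v w : ℝ}
    (h2 : ∀ i, ∫ ω, ‖ζ i ω‖ ^ 2 ∂P = v) (h4 : ∀ i, ∫ ω, ‖ζ i ω‖ ^ 4 ∂P ≤ w) (s : Finset ι) :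
    ∫ ω, ‖∑ i ∈ s, ζ i ω‖ ^ 2 ∂P = s.card * v ∧
      ∫ ω, ‖∑ i ∈ s, ζ i ω‖ ^ 4 ∂P ≤ s.card * w + 3 * (s.card * v) ^ 2 := by
  classical
  induction s using Finset.induction_on with
  | empty => simp
  | insert j s hj ih =>
    set T : Ω → ℂ := fun ω => ∑ i ∈ s, ζ i ω with hT
    have hTm : Measurable T := Finset.measurable_sum _ fun i _ => hm i
    have hTL : HasAllMoments T P := HasAllMoments.sum _ fun i _ => hL i
    have hT0 : ∫ ω, T ω ∂P = 0 := by
      rw [hT, integral_finsetSum _ fun i _ => (hL i).integrable]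
      simp [h0]
    have hind : IndepFun T (ζ j) P := by
      have := iIndepFun.indepFun_finsetSum_of_notMem hi hm hj
      convert this using 1
      ext ω
      simp [hT]
    have hv0 : ∫ ω, star (ζ j ω) ∂P = 0 := by
      have := integral_conj (μ := P) (f := ζ j)
      simp only [h0, map_zero] at this
      exact this
    -- Each mixed term splits by independence, and in each use one factor is centered.
    have cross : ∀ f g : ℂ → ℂ, Measurable f → Measurable g →
        HasAllMoments (fun ω => f (T ω)) P → HasAllMoments (fun ω => g (ζ j ω)) P →
        (∫ ω, f (T ω) ∂P) * (∫ ω, g (ζ j ω) ∂P) = 0 →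
        ∫ ω, (f (T ω) * g (ζ j ω)).re ∂P = 0 := by
      intro f g hf hg hfL hgL h
      have h1 := integral_re (hfL.mul hgL).integrable
      simp only [RCLike.re_eq_complex_re] at h1
      rw [h1, hind.integral_fun_comp_mul_comp hTm.aemeasurable (hm j).aemeasurable
        hf.aestronglyMeasurable hg.aestronglyMeasurable, h, Complex.zero_re]
    have hsum : ∀ ω, ∑ i ∈ insert j s, ζ i ω = T ω + ζ j ω := fun ω => by
      rw [Finset.sum_insert hj, add_comm]
    simp only [hsum, Finset.card_insert_of_notMem hj]
    have c1 : ∫ ω, (T ω * star (ζ j ω)).re ∂P = 0 :=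
      cross id star measurable_id continuous_star.measurable hTL (hL j).star (by rw [hv0, mul_zero])
    have c2 : ∫ ω, ((((‖T ω‖ ^ 2 : ℝ) : ℂ) * T ω) * star (ζ j ω)).re ∂P = 0 :=
      cross (fun z => ((‖z‖ ^ 2 : ℝ) : ℂ) * z) star (by fun_prop) continuous_star.measurable
        (hTL.norm_sq_ofReal.mul hTL) (hL j).star (by rw [hv0, mul_zero])
    have c3 : ∫ ω, (T ω * (((‖ζ j ω‖ ^ 2 : ℝ) : ℂ) * star (ζ j ω))).re ∂P = 0 :=
      cross id (fun z => ((‖z‖ ^ 2 : ℝ) : ℂ) * star z) measurable_id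
        (Continuous.measurable (by fun_prop)) hTL ((hL j).norm_sq_ofReal.mul (hL j).star)
        (by simp [hT0])
    have c4 : ∫ ω, ‖T ω‖ ^ 2 * ‖ζ j ω‖ ^ 2 ∂P = s.card * v * v := by
      rw [hind.integral_fun_comp_mul_comp (f := fun z => ‖z‖ ^ 2) (g := fun z => ‖z‖ ^ 2)
        hTm.aemeasurable (hm j).aemeasurable (by fun_prop) (by fun_prop), h2 j, ih.1]
    have i1 := hTL.integrable_norm_pow 2
    have i2 := (hL j).integrable_norm_pow 2
    have i3 := hTL.integrable_norm_pow 4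
    have i4 := (hL j).integrable_norm_pow 4
    have j1 : Integrable (fun ω => (T ω * star (ζ j ω)).re) P := (hTL.mul (hL j).star).integrable.re
    have j2 : Integrable (fun ω => ((((‖T ω‖ ^ 2 : ℝ) : ℂ) * T ω) * star (ζ j ω)).re) P :=
      ((hTL.norm_sq_ofReal.mul hTL).mul (hL j).star).integrable.re
    have j3 : Integrable (fun ω => (T ω * (((‖ζ j ω‖ ^ 2 : ℝ) : ℂ) * star (ζ j ω))).re) P :=
      (hTL.mul ((hL j).norm_sq_ofReal.mul (hL j).star)).integrable.re
    have j4 : Integrable (fun ω => ‖T ω‖ ^ 2 * ‖ζ j ω‖ ^ 2) P := by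
      refine ((hTL.mul (hL j)).integrable_norm_pow 2).congr (Eventually.of_forall fun ω => ?_)
      simp [mul_pow]
    constructor
    · simp_rw [norm_add_sq_eq]
      rw [integral_add (by fun_prop) (by fun_prop), integral_add i1 i2, integral_const_mul,
        c1, h2 j,
        ih.1]
      push_cast
      ring
    · calc _ ≤ ∫ ω, ‖T ω‖ ^ 4 + 6 * (‖T ω‖ ^ 2 * ‖ζ j ω‖ ^ 2) + ‖ζ j ω‖ ^ 4 +
            4 * ((((‖T ω‖ ^ 2 : ℝ) : ℂ) * T ω) * star (ζ j ω)).re +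
            4 * (T ω * (((‖ζ j ω‖ ^ 2 : ℝ) : ℂ) * star (ζ j ω))).re ∂P := by
            refine integral_mono_of_nonneg (Eventually.of_forall fun ω => by positivity)
              ((((i3.add (j4.const_mul 6)).add i4).add (j2.const_mul 4)).add (j3.const_mul 4))
              (Eventually.of_forall fun ω => norm_add_pow_four_le _ _)
        _ = ∫ ω, ‖T ω‖ ^ 4 ∂P + 6 * (s.card * v * v) + ∫ ω, ‖ζ j ω‖ ^ 4 ∂P := by
            rw [integral_add (by fun_prop) (by fun_prop), integral_add (by fun_prop) (by fun_prop),
              integral_add (by fun_prop) (by fun_prop), integral_add (by fun_prop) (by fun_prop),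
              integral_const_mul, integral_const_mul, integral_const_mul, c2, c3, c4]
            ring
        _ ≤ _ := by
            have := h4 j
            have := ih.2
            push_cast
            nlinarith [sq_nonneg v]

/-! ### Fluctuations of Gaussian Gram matrices -/

lemma measurePreserving_row (M K : ℕ) (m : Fin M) :
    MeasurePreserving (fun (X : Fin M × Fin K → ℂ) k => X (m, k))
      (gaussianFamily (Fin M × Fin K)) (gaussianFamily (Fin K)) :=
  ⟨by fun_prop, map_precomp_gaussianFamily (g := fun k : Fin K => (m, k))
    (fun a b h => by simpa using h)⟩

lemma iIndepFun_rows (M K : ℕ) :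
    iIndepFun (fun (m : Fin M) (X : Fin M × Fin K → ℂ) k => X (m, k))
      (gaussianFamily (Fin M × Fin K)) := by
  rw [iIndepFun_iff_map_fun_eq_pi_map (fun m => (measurePreserving_row M K m).aemeasurable)]
  simp only [(measurePreserving_row M K _).map_eq]
  exact map_curry_gaussianFamily

/-- The centered summands of an entry of the Gram matrix. -/
def gramSummand {K : ℕ} (a b : Fin K) (x : Fin K → ℂ) : ℂ :=
  star (x a) * x b - (1 : Matrix (Fin K) (Fin K) ℂ) a b

lemma measurable_gramSummand {K : ℕ} (a b : Fin K) : Measurable (gramSummand a b) :=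
  Continuous.measurable (by unfold gramSummand; fun_prop)

lemma hasAllMoments_gramSummand {K : ℕ} (a b : Fin K) :
    HasAllMoments (gramSummand a b) (gaussianFamily (Fin K)) :=
  ((hasAllMoments_eval a).star.mul (hasAllMoments_eval b)).sub (HasAllMoments.const _)

lemma integral_comp_eval {ι : Type*} [Fintype ι] {E : Type*} [NormedAddCommGroup E]
    [NormedSpace ℝ E] (i : ι) {f : ℂ → E} (hf : AEStronglyMeasurable f stdComplexGaussian) :
    ∫ x, f (x i) ∂(gaussianFamily ι) = ∫ z, f z ∂stdComplexGaussian :=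
  integral_comp_of_measurePreserving (measurePreserving_eval_gaussianFamily i) hf

lemma indepFun_eval {ι : Type*} [Fintype ι] {i j : ι} (h : i ≠ j) :
    IndepFun (fun x : ι → ℂ => x i) (fun x => x j) (gaussianFamily ι) :=
  (iIndepFun_pi (X := fun _ : ι => (id : ℂ → ℂ)) (μ := fun _ => stdComplexGaussian)
    (fun _ => aemeasurable_id)).indepFun h

lemma integral_star_mul_eval {ι : Type*} [Fintype ι] [DecidableEq ι] (a b : ι) :
    ∫ x, star (x a) * x b ∂(gaussianFamily ι) = (1 : Matrix ι ι ℂ) a b := by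
  by_cases h : a = b
  · subst h
    rw [Matrix.one_apply_eq, integral_comp_eval a (f := fun z => star z * z)
      (Continuous.aestronglyMeasurable (by fun_prop))]
    have : ∀ z : ℂ, star z * z = ((‖z‖ ^ 2 : ℝ) : ℂ) := fun z => by
      rw [Complex.star_def, Complex.conj_mul', Complex.ofReal_pow]
    simp_rw [this]
    rw [integral_complex_ofReal, integral_norm_sq_stdComplexGaussian, Complex.ofReal_one]
  · rw [Matrix.one_apply_ne h, (indepFun_eval h).integral_fun_comp_mul_comp (f := star)
      (g := fun z => z) (measurable_pi_apply a).aemeasurable (measurable_pi_apply b).aemeasurable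
      (continuous_star.aestronglyMeasurable) (by fun_prop),
      integral_comp_eval b (f := fun z => z) (by fun_prop),
      integral_id_stdComplexGaussian, mul_zero]

lemma integral_gramSummand {K : ℕ} (a b : Fin K) :
    ∫ x, gramSummand a b x ∂(gaussianFamily (Fin K)) = 0 := by
  unfold gramSummand
  rw [integral_sub ((hasAllMoments_eval a).star.mul (hasAllMoments_eval b)).integrable
    (integrable_const _), integral_star_mul_eval]
  simp

/-- On the diagonal the value is `E|z|⁴ - 2 E|z|² + 1 = 2 - 2 + 1`; off the diagonal it is a product
of two unit powers. This coincidence makes all entries of the Gram deviation have the same variance.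
-/
lemma integral_norm_sq_gramSummand {K : ℕ} (a b : Fin K) :
    ∫ x, ‖gramSummand a b x‖ ^ 2 ∂(gaussianFamily (Fin K)) = 1 := by
  unfold gramSummand
  by_cases h : a = b
  · subst h
    have : ∀ z : ℂ, ‖star z * z - 1‖ ^ 2 = ‖z‖ ^ 4 - 2 * ‖z‖ ^ 2 + 1 := fun z => by
      rw [Complex.star_def, Complex.conj_mul', ← Complex.ofReal_pow, ← Complex.ofReal_one,
        ← Complex.ofReal_sub, Complex.norm_real, Real.norm_eq_abs, sq_abs]
      ring
    rw [Matrix.one_apply_eq]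
    simp_rw [this]
    rw [integral_comp_eval a (f := fun z => ‖z‖ ^ 4 - 2 * ‖z‖ ^ 2 + 1) (by fun_prop)]
    have i4 : Integrable (fun z : ℂ => ‖z‖ ^ 4) stdComplexGaussian :=
      (memLp_id_stdComplexGaussian (q := 4) (by simp)).integrable_norm_pow (by norm_num)
    have i2 : Integrable (fun z : ℂ => ‖z‖ ^ 2) stdComplexGaussian :=
      (memLp_id_stdComplexGaussian (q := 2) (by simp)).integrable_norm_pow (by norm_num)
    rw [integral_add (by fun_prop) (by fun_prop), integral_sub i4 (by fun_prop), integral_const_mul,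
      integral_norm_pow_four_stdComplexGaussian, integral_norm_sq_stdComplexGaussian]
    simp
  · simp only [Matrix.one_apply_ne h, sub_zero, norm_mul, norm_star, mul_pow]
    rw [(indepFun_eval h).integral_fun_comp_mul_comp (f := fun z => ‖z‖ ^ 2)
      (g := fun z => ‖z‖ ^ 2) (measurable_pi_apply a).aemeasurable
      (measurable_pi_apply b).aemeasurable (by fun_prop) (by fun_prop),
      integral_comp_eval a (f := fun z => ‖z‖ ^ 2) (by fun_prop),
      integral_comp_eval b (f := fun z => ‖z‖ ^ 2) (by fun_prop),
      integral_norm_sq_stdComplexGaussian, one_mul]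

/-- The deviation of the normalized Gram matrix from the identity. -/
def gramDeviation {M K : ℕ} (X : Fin M × Fin K → ℂ) : Matrix (Fin K) (Fin K) ℂ :=
  (M : ℂ)⁻¹ • gram (matOf X) - 1

lemma gramDeviation_apply {M K : ℕ} (hM : 0 < M) (X : Fin M × Fin K → ℂ) (a b : Fin K) :
    gramDeviation X a b = (M : ℂ)⁻¹ * ∑ m, gramSummand a b fun k => X (m, k) := by
  have : (M : ℂ) ≠ 0 := by exact_mod_cast hM.ne'
  simp only [gramDeviation, gramSummand, Matrix.sub_apply, Matrix.smul_apply, smul_eq_mul,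
    Matrix.mul_apply, Matrix.conjTranspose_apply, Matrix.of_apply, Finset.sum_sub_distrib,
    Finset.sum_const, Finset.card_univ, Fintype.card_fin, nsmul_eq_mul, mul_sub]
  rw [inv_mul_cancel_left₀ this]

lemma hasAllMoments_gramDeviation {M K : ℕ} (a b : Fin K) :
    HasAllMoments (fun X => gramDeviation X a b) (gaussianFamily (Fin M × Fin K)) := by
  unfold gramDeviation
  simp only [Matrix.sub_apply, Matrix.smul_apply, smul_eq_mul, Matrix.mul_apply,
    Matrix.conjTranspose_apply, Matrix.of_apply]
  exact ((HasAllMoments.sum _ fun m _ => (hasAllMoments_eval (m, a)).star.mul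
    (hasAllMoments_eval (m, b))).const_mul _).sub (HasAllMoments.const _)

lemma moments_sum_gramSummand {K : ℕ} (M : ℕ) (a b : Fin K) :
    (∫ X, ‖∑ m : Fin M, gramSummand a b fun k => X (m, k)‖ ^ 2
      ∂(gaussianFamily (Fin M × Fin K)) = M) ∧
    ∫ X, ‖∑ m : Fin M, gramSummand a b fun k => X (m, k)‖ ^ 4
      ∂(gaussianFamily (Fin M × Fin K)) ≤
        M * (∫ x, ‖gramSummand a b x‖ ^ 4 ∂(gaussianFamily (Fin K))) + 3 * M ^ 2 := by
  have hm := measurable_gramSummand a b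
  have hmp := measurePreserving_row M K
  have h := moments_sum_of_iIndepFun (P := gaussianFamily (Fin M × Fin K))
    (ζ := fun m X => gramSummand a b fun k => X (m, k))
    (fun m => hm.comp (hmp m).measurable)
    ((iIndepFun_rows M K).comp (fun _ => gramSummand a b) (fun _ => hm))
    (fun m q hq => (hasAllMoments_gramSummand a b q hq).comp_measurePreserving (hmp m))
    (fun m => (integral_comp_of_measurePreserving (hmp m) hm.aestronglyMeasurable).trans
      (integral_gramSummand a b))
    (fun m => (integral_comp_of_measurePreserving (hmp m)
      (g := fun x => ‖gramSummand a b x‖ ^ 2) (hm.norm.pow_const 2).aestronglyMeasurable).trans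
      (integral_norm_sq_gramSummand a b))
    (fun m => (integral_comp_of_measurePreserving (hmp m)
      (g := fun x => ‖gramSummand a b x‖ ^ 4) (hm.norm.pow_const 4).aestronglyMeasurable).le)
    Finset.univ
  simpa using h

lemma integral_gramDeviation {M K : ℕ} (hM : 0 < M) (a b : Fin K) :
    ∫ X, gramDeviation X a b ∂(gaussianFamily (Fin M × Fin K)) = 0 := by
  simp_rw [gramDeviation_apply hM]
  have hm := measurable_gramSummand a b
  rw [integral_const_mul, integral_finsetSum]
  · have : ∀ m : Fin M, ∫ X : Fin M × Fin K → ℂ, gramSummand a b (fun k => X (m, k))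
        ∂(gaussianFamily (Fin M × Fin K)) = 0 := fun m =>
      (integral_comp_of_measurePreserving (measurePreserving_row M K m)
        hm.aestronglyMeasurable).trans (integral_gramSummand a b)
    simp [this]
  · intro m _
    exact HasAllMoments.integrable fun q hq =>
      (hasAllMoments_gramSummand a b q hq).comp_measurePreserving (measurePreserving_row M K m)

lemma integral_norm_sq_gramDeviation {M K : ℕ} (hM : 0 < M) (a b : Fin K) :
    ∫ X, ‖gramDeviation X a b‖ ^ 2 ∂(gaussianFamily (Fin M × Fin K)) = (M : ℝ)⁻¹ := by
  simp_rw [gramDeviation_apply hM, norm_mul, mul_pow]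
  rw [integral_const_mul, (moments_sum_gramSummand M a b).1, norm_inv, Complex.norm_natCast]
  have : (M : ℝ) ≠ 0 := by exact_mod_cast hM.ne'
  field_simp

lemma exists_integral_gramDeviation_pow_four_le (K : ℕ) :
    ∃ C : ℝ, ∀ M, 0 < M → ∀ a b : Fin K,
      ∫ X, ‖gramDeviation X a b‖ ^ 4 ∂(gaussianFamily (Fin M × Fin K)) ≤ C / M ^ 2 := by
  -- For one entry with summand moment `w` the bound is `w / M + 3 ≤ w + 3`; summing the moments
  -- over all entries makes the constant uniform in `a` and `b`.
  refine ⟨∑ a : Fin K, ∑ b : Fin K, (∫ x, ‖gramSummand a b x‖ ^ 4 ∂(gaussianFamily (Fin K))) + 3,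
    fun M hM a b => ?_⟩
  have hM' : (1 : ℝ) ≤ M := by exact_mod_cast hM
  have hnn : ∀ a b : Fin K, 0 ≤ ∫ x, ‖gramSummand a b x‖ ^ 4 ∂(gaussianFamily (Fin K)) :=
    fun a b => integral_nonneg fun x => by positivity
  have hle : ∫ x, ‖gramSummand a b x‖ ^ 4 ∂(gaussianFamily (Fin K)) ≤
      ∑ a : Fin K, ∑ b : Fin K, ∫ x, ‖gramSummand a b x‖ ^ 4 ∂(gaussianFamily (Fin K)) :=
    (Finset.single_le_sum (f := fun b => ∫ x, ‖gramSummand a b x‖ ^ 4 ∂(gaussianFamily (Fin K)))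
      (fun b _ => hnn a b) (Finset.mem_univ b)).trans
    (Finset.single_le_sum (f := fun a => ∑ b, ∫ x, ‖gramSummand a b x‖ ^ 4
      ∂(gaussianFamily (Fin K)))
      (fun a _ => Finset.sum_nonneg fun b _ => hnn a b) (Finset.mem_univ a))
  simp_rw [gramDeviation_apply hM, norm_mul, mul_pow]
  rw [integral_const_mul, norm_inv, Complex.norm_natCast, le_div_iff₀ (by positivity)]
  have h := (moments_sum_gramSummand M a b).2
  have hw := hnn a b
  generalize ∫ x, ‖gramSummand a b x‖ ^ 4 ∂(gaussianFamily (Fin K)) = w at *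
  calc _ ≤ (M : ℝ)⁻¹ ^ 4 * (M * w + 3 * M ^ 2) * M ^ 2 := by gcongr
    _ = w / M + 3 := by field_simp
    _ ≤ w + 3 := by
        gcongr
        exact div_le_self hw hM'
    _ ≤ _ := by gcongr

/-! ### Asymptotics of inverse Gram matrices -/

/-- The sum of the absolute values of the entries of a matrix. -/
def entrySum {K : ℕ} (A : Matrix (Fin K) (Fin K) ℂ) : ℝ := ∑ a, ∑ b, ‖A a b‖

lemma entrySum_nonneg {K : ℕ} (A : Matrix (Fin K) (Fin K) ℂ) : 0 ≤ entrySum A := by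
  unfold entrySum; positivity

lemma norm_apply_le_entrySum {K : ℕ} (A : Matrix (Fin K) (Fin K) ℂ) (a b : Fin K) :
    ‖A a b‖ ≤ entrySum A :=
  (Finset.single_le_sum (f := fun b => ‖A a b‖) (fun _ _ => norm_nonneg _)
    (Finset.mem_univ b)).trans
  (Finset.single_le_sum (f := fun a => ∑ b, ‖A a b‖)
    (fun _ _ => Finset.sum_nonneg fun _ _ => norm_nonneg _) (Finset.mem_univ a))

lemma entrySum_mul_le {K : ℕ} (A B : Matrix (Fin K) (Fin K) ℂ) :
    entrySum (A * B) ≤ entrySum A * entrySum B := by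
  have h : ∀ c, ∑ b, ‖B c b‖ ≤ entrySum B := fun c =>
    Finset.single_le_sum (f := fun c => ∑ b, ‖B c b‖)
      (fun _ _ => Finset.sum_nonneg fun _ _ => norm_nonneg _) (Finset.mem_univ c)
  calc entrySum (A * B) ≤ ∑ a, ∑ b, ∑ c, ‖A a c‖ * ‖B c b‖ := by
        refine Finset.sum_le_sum fun a _ => Finset.sum_le_sum fun b _ => ?_
        rw [Matrix.mul_apply]
        exact (norm_sum_le _ _).trans_eq (by simp)
    _ = ∑ a, ∑ c, ‖A a c‖ * ∑ b, ‖B c b‖ := by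
        refine Finset.sum_congr rfl fun a _ => ?_
        rw [Finset.sum_comm]
        simp [Finset.mul_sum]
    _ ≤ ∑ a, ∑ c, ‖A a c‖ * entrySum B := by
        gcongr
        exact h _
    _ = _ := by simp [entrySum, Finset.sum_mul]

/-- Power mean inequality over the `K²` entries, with constant `(K²)³`. -/
lemma entrySum_pow_four_le {K : ℕ} (A : Matrix (Fin K) (Fin K) ℂ) :
    entrySum A ^ 4 ≤ (K : ℝ) ^ 6 * ∑ a, ∑ b, ‖A a b‖ ^ 4 := by
  have h : entrySum A = ∑ x : Fin K × Fin K, ‖A x.1 x.2‖ := by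
    rw [entrySum, Fintype.sum_prod_type]
  have h2 : ∑ a, ∑ b, ‖A a b‖ ^ 4 = ∑ x : Fin K × Fin K, ‖A x.1 x.2‖ ^ 4 := by
    rw [Fintype.sum_prod_type]
  rw [h, h2]
  rcases Nat.eq_zero_or_pos K with rfl | hK
  · simp
  have := pow_sum_div_card_le_sum_pow (s := (Finset.univ : Finset (Fin K × Fin K)))
    (f := fun x => ‖A x.1 x.2‖) (fun _ _ => norm_nonneg _) 3
  have hK' : (0 : ℝ) < K := by exact_mod_cast hK
  rw [div_le_iff₀ (by simp; positivity)] at this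
  refine this.trans (le_of_eq ?_)
  simp
  ring

/-- The inverse of the normalized Gram matrix. -/
def normInv {M K : ℕ} (X : Fin M × Fin K → ℂ) : Matrix (Fin K) (Fin K) ℂ :=
  (M : ℂ) • (gram (matOf X))⁻¹

lemma measurable_inv_apply {α n : Type*} [MeasurableSpace α] [Fintype n] [DecidableEq n]
    {A : α → Matrix n n ℂ} (hA : ∀ i j, Measurable fun x => A x i j) (i j : n) :
    Measurable fun x => (A x)⁻¹ i j := by
  simp only [Matrix.inv_def, Matrix.smul_apply, smul_eq_mul, Ring.inverse_eq_inv']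
  exact (measurable_det_comp hA).inv.mul (measurable_adjugate_apply hA i j)

lemma measurable_gram_apply {M K : ℕ} (a b : Fin K) :
    Measurable fun X : Fin M × Fin K → ℂ => gram (matOf X) a b :=
  Continuous.measurable (by
    simp only [Matrix.mul_apply, Matrix.conjTranspose_apply, Matrix.of_apply]; fun_prop)

lemma measurable_normInv_apply {M K : ℕ} (a b : Fin K) :
    Measurable fun X : Fin M × Fin K → ℂ => normInv X a b :=
  (measurable_inv_apply measurable_gram_apply a b).const_mul (M : ℂ)

lemma memLp_normInv {M K : ℕ} (hK : 0 < K) (hM : 32 * K ≤ M) (a b : Fin K) :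
    MemLp (fun X => normInv X a b) 4 (gaussianFamily (Fin M × Fin K)) := by
  obtain ⟨C, hC, h⟩ := exists_lintegral_inv_gram_pow_four_le hK
  refine ⟨(measurable_normInv_apply a b).aestronglyMeasurable, ?_⟩
  rw [eLpNorm_lt_top_iff_lintegral_rpow_enorm_lt_top (by norm_num) (by norm_num)]
  refine lt_of_le_of_lt ?_ hC.lt_top
  refine le_of_eq_of_le (lintegral_congr fun X => ?_) (h M hM a b)
  simp only [normInv, Matrix.smul_apply, smul_eq_mul, ENNReal.toReal_ofNat]
  exact_mod_cast ENNReal.rpow_natCast _ 4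

lemma exists_integral_entrySum_normInv_le {K : ℕ} (hK : 0 < K) :
    ∃ C : ℝ, 0 ≤ C ∧ ∀ M, 32 * K ≤ M →
      Integrable (fun X => entrySum (normInv X) ^ 4) (gaussianFamily (Fin M × Fin K)) ∧
      ∫ X, entrySum (normInv X) ^ 4 ∂(gaussianFamily (Fin M × Fin K)) ≤ C := by
  obtain ⟨C, hC, h⟩ := exists_lintegral_inv_gram_pow_four_le hK
  refine ⟨(K : ℝ) ^ 6 * ∑ a : Fin K, ∑ b : Fin K, C.toReal, by positivity, fun M hM => ?_⟩
  have h4 : ∀ a b, Integrable (fun X => ‖normInv X a b‖ ^ 4) (gaussianFamily (Fin M × Fin K)) :=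
    fun a b => (memLp_normInv hK hM a b).integrable_norm_pow (by norm_num)
  have hle : ∀ a b, ∫ X, ‖normInv X a b‖ ^ 4 ∂(gaussianFamily (Fin M × Fin K)) ≤ C.toReal := by
    intro a b
    rw [integral_eq_lintegral_of_nonneg_ae (Eventually.of_forall fun X => by positivity)
      (h4 a b).aestronglyMeasurable]
    refine ENNReal.toReal_mono hC ?_
    convert h M hM a b using 3 with X
    rw [ENNReal.ofReal_pow (norm_nonneg _), ofReal_norm]
    rfl
  have hi : Integrable (fun X => (K : ℝ) ^ 6 * ∑ a, ∑ b, ‖normInv X a b‖ ^ 4)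
      (gaussianFamily (Fin M × Fin K)) :=
    (integrable_finsetSum _ fun a _ => integrable_finsetSum _ fun b _ => h4 a b).const_mul _
  have hm : Measurable fun X : Fin M × Fin K → ℂ => entrySum (normInv X) ^ 4 :=
    (Finset.measurable_sum _ fun a _ => Finset.measurable_sum _ fun b _ =>
      (measurable_normInv_apply a b).norm).pow_const 4
  refine ⟨hi.mono' hm.aestronglyMeasurable (Eventually.of_forall fun X => ?_), ?_⟩
  · rw [Real.norm_of_nonneg (pow_nonneg (entrySum_nonneg _) 4)]
    exact entrySum_pow_four_le _
  · refine (integral_mono_of_nonneg (Eventually.of_forall fun X => pow_nonneg (entrySum_nonneg _) 4)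
      hi (Eventually.of_forall fun X => entrySum_pow_four_le _)).trans ?_
    rw [integral_const_mul, integral_finsetSum _ fun a _ =>
      integrable_finsetSum _ fun b _ => h4 a b]
    gcongr with a
    rw [integral_finsetSum _ fun b _ => h4 a b]
    gcongr with b
    exact hle a b

lemma exists_integral_entrySum_gramDeviation_le (K : ℕ) :
    ∃ C : ℝ, 0 ≤ C ∧ ∀ M, 0 < M →
      Integrable (fun X => entrySum (gramDeviation X) ^ 4) (gaussianFamily (Fin M × Fin K)) ∧
      ∫ X, entrySum (gramDeviation X) ^ 4 ∂(gaussianFamily (Fin M × Fin K)) ≤ C / M ^ 2 := by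
  obtain ⟨C, h⟩ := exists_integral_gramDeviation_pow_four_le K
  refine ⟨(K : ℝ) ^ 6 * ∑ a : Fin K, ∑ b : Fin K, |C|, by positivity, fun M hM => ?_⟩
  have h4 : ∀ a b, Integrable (fun X => ‖gramDeviation X a b‖ ^ 4)
      (gaussianFamily (Fin M × Fin K)) :=
    fun a b => (hasAllMoments_gramDeviation a b).integrable_norm_pow 4
  have hi : Integrable (fun X => (K : ℝ) ^ 6 * ∑ a, ∑ b, ‖gramDeviation X a b‖ ^ 4)
      (gaussianFamily (Fin M × Fin K)) :=
    (integrable_finsetSum _ fun a _ => integrable_finsetSum _ fun b _ => h4 a b).const_mul _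
  have hm : Measurable fun X : Fin M × Fin K → ℂ => entrySum (gramDeviation X) ^ 4 :=
    (Finset.measurable_sum _ fun a _ => Finset.measurable_sum _ fun b _ =>
      (((measurable_gram_apply a b).const_mul _).sub_const _).norm).pow_const 4
  refine ⟨hi.mono' hm.aestronglyMeasurable (Eventually.of_forall fun X => ?_), ?_⟩
  · rw [Real.norm_of_nonneg (pow_nonneg (entrySum_nonneg _) 4)]
    exact entrySum_pow_four_le _
  · refine (integral_mono_of_nonneg (Eventually.of_forall fun X => pow_nonneg (entrySum_nonneg _) 4)
      hi (Eventually.of_forall fun X => entrySum_pow_four_le _)).trans ?_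
    rw [integral_const_mul, integral_finsetSum _ fun a _ =>
      integrable_finsetSum _ fun b _ => h4 a b,
      mul_div_assoc, Finset.sum_div]
    gcongr with a
    rw [integral_finsetSum _ fun b _ => h4 a b, Finset.sum_div]
    gcongr with b
    refine (h M hM a b).trans ?_
    gcongr
    exact le_abs_self C

/-- This is `(1 + D) N = 1` rearranged, for `D` the Gram deviation and `N` the normalized inverse.
-/
lemma normInv_sub_one {M K : ℕ} (hM : 0 < M) {X : Fin M × Fin K → ℂ}
    (hX : IsUnit (gram (matOf X)).det) : normInv X - 1 = -(gramDeviation X * normInv X) := by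
  have hM' : (M : ℂ) ≠ 0 := by exact_mod_cast hM.ne'
  rw [gramDeviation, sub_mul, one_mul, normInv, Matrix.smul_mul, Matrix.mul_smul, smul_smul,
    inv_mul_cancel₀ hM', one_smul, Matrix.mul_nonsing_inv _ hX]
  abel

lemma norm_normInv_sub_one_le {M K : ℕ} (hM : 0 < M) {X : Fin M × Fin K → ℂ}
    (hX : IsUnit (gram (matOf X)).det) (a b : Fin K) :
    ‖normInv X a b - (1 : Matrix (Fin K) (Fin K) ℂ) a b‖ ≤
      entrySum (gramDeviation X) * entrySum (normInv X) := by
  rw [← Matrix.sub_apply, normInv_sub_one hM hX, Matrix.neg_apply, norm_neg]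
  exact (norm_apply_le_entrySum _ a b).trans (entrySum_mul_le _ _)

/-- Iterating `N = 1 - D N` gives the remainder `-D³ N`. Third order is required: with `D` of size
`M^(-1/2)`, it is the first remainder that is `o(1/M)`. -/
lemma norm_normInv_expansion_le {M K : ℕ} (hM : 0 < M) {X : Fin M × Fin K → ℂ}
    (hX : IsUnit (gram (matOf X)).det) (a b : Fin K) :
    ‖normInv X a b - ((1 : Matrix (Fin K) (Fin K) ℂ) a b - gramDeviation X a b +
        (gramDeviation X * gramDeviation X) a b)‖ ≤
      entrySum (gramDeviation X) ^ 3 * entrySum (normInv X) := by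
  have h := normInv_sub_one hM hX
  set D := gramDeviation X
  set N := normInv X
  have hN : N = 1 - D * N := by rw [sub_eq_add_neg, ← h]; abel
  have h2 : N - (1 - D + D * D) = -(D * (D * (D * N))) := by
    have e1 : D * N = D - D * (D * N) := by
      conv_lhs => rw [hN]
      rw [mul_sub, mul_one]
    have e2 : D * (D * N) = D * D - D * (D * (D * N)) := by
      conv_lhs => rw [e1]
      rw [mul_sub]
    conv_lhs => rw [hN, e1, e2]
    abel
  have h3 : N a b - ((1 : Matrix (Fin K) (Fin K) ℂ) a b - D a b + (D * D) a b) =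
      (-(D * (D * (D * N)))) a b := by
    rw [← h2]; rfl
  rw [h3, Matrix.neg_apply, norm_neg]
  have hD := entrySum_nonneg D
  calc ‖(D * (D * (D * N))) a b‖ ≤ entrySum (D * (D * (D * N))) := norm_apply_le_entrySum _ _ _
    _ ≤ entrySum D * (entrySum D * (entrySum D * entrySum N)) := by
        refine (entrySum_mul_le _ _).trans (mul_le_mul_of_nonneg_left ?_ hD)
        exact (entrySum_mul_le _ _).trans (mul_le_mul_of_nonneg_left (entrySum_mul_le _ _) hD)
    _ = _ := by ring

/-- A substitute for Hölder with a free weight. At `s = √M` both terms on the right have mean of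
order `M^(-3/2)`, because the fourth moment of `d` is `O(M⁻²)` and that of `n` is bounded. -/
lemma young_cube {s d n : ℝ} (hs : 0 < s) (hd : 0 ≤ d) (hn : 0 ≤ n) :
    d ^ 3 * n ≤ 2 * s * d ^ 4 + n ^ 4 / s ^ 3 := by
  have h1 : d ^ 3 * n ≤ s * d ^ 4 + d ^ 2 * n ^ 2 / s := by
    have : 0 ≤ (s * d ^ 2 - d * n) ^ 2 + (s * d ^ 2 * (d * n)) := by positivity
    have h2 : s * d ^ 4 + d ^ 2 * n ^ 2 / s - d ^ 3 * n =
        ((s * d ^ 2 - d * n) ^ 2 + (s * d ^ 2 * (d * n))) / s := by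
      field_simp; ring
    have : 0 ≤ s * d ^ 4 + d ^ 2 * n ^ 2 / s - d ^ 3 * n := by rw [h2]; positivity
    linarith
  have h2 : d ^ 2 * n ^ 2 / s ≤ s * d ^ 4 + n ^ 4 / s ^ 3 := by
    have h2 : s * d ^ 4 + n ^ 4 / s ^ 3 - d ^ 2 * n ^ 2 / s =
        ((s ^ 2 * d ^ 2 - n ^ 2) ^ 2 + s ^ 2 * d ^ 2 * n ^ 2) / s ^ 3 := by
      field_simp; ring
    have : 0 ≤ s * d ^ 4 + n ^ 4 / s ^ 3 - d ^ 2 * n ^ 2 / s := by rw [h2]; positivity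
    linarith
  linarith

/-- The same device for a first-order remainder: at `s = √M` every term has mean of order
`M^(-1/2)`. -/
lemma young_mul_sq {s d : ℝ} (hs : 0 < s) (hd : 0 ≤ d) (n : ℝ) :
    d * n ^ 2 ≤ s ^ 3 * d ^ 4 + 1 / s + n ^ 4 / s := by
  have h1 : d * n ^ 2 ≤ s * d ^ 2 + n ^ 4 / s := by
    have h2 : s * d ^ 2 + n ^ 4 / s - d * n ^ 2 =
        ((s * d - n ^ 2) ^ 2 + s * d * n ^ 2) / s := by
      field_simp; ring
    have : 0 ≤ s * d ^ 2 + n ^ 4 / s - d * n ^ 2 := by rw [h2]; positivity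
    linarith
  have h2 : s * d ^ 2 ≤ s ^ 3 * d ^ 4 + 1 / s := by
    have h2 : s ^ 3 * d ^ 4 + 1 / s - s * d ^ 2 =
        ((s ^ 2 * d ^ 2 - 1) ^ 2 + s ^ 2 * d ^ 2) / s := by
      field_simp; ring
    have : 0 ≤ s ^ 3 * d ^ 4 + 1 / s - s * d ^ 2 := by rw [h2]; positivity
    linarith
  linarith

lemma tendsto_natCast_mul_inv_sqrt_cube :
    Tendsto (fun M : ℕ => (M : ℝ) * (1 / √M ^ 3)) atTop (𝓝 0) := by
  have h : Tendsto (fun M : ℕ => (√(M : ℝ))⁻¹) atTop (𝓝 0) :=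
    (Real.tendsto_sqrt_atTop.comp tendsto_natCast_atTop_atTop).inv_tendsto_atTop
  refine h.congr' ?_
  filter_upwards [eventually_gt_atTop 0] with M hM
  have hM' : (0 : ℝ) < M := by exact_mod_cast hM
  have := Real.sqrt_pos.2 hM'
  conv_rhs => rw [← Real.sq_sqrt hM'.le]
  rw [Real.sqrt_sq (Real.sqrt_nonneg _)]
  field_simp

/-- In the second-order expansion the linear term is centered, the quadratic one has mean `K/M`, and
the remainder is `O(M^(-3/2))`. The limit `K` is the coefficient that matches `1/(M - K)` to second
order. -/
theorem tendsto_integral_normInv_diag {K : ℕ} (hK : 0 < K) (a : Fin K) :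
    Tendsto (fun M : ℕ => (M : ℂ) *
      (∫ X, normInv X a a ∂(gaussianFamily (Fin M × Fin K)) - 1)) atTop (𝓝 K) := by
  obtain ⟨C₁, hC₁, h₁⟩ := exists_integral_entrySum_gramDeviation_le K
  obtain ⟨C₂, hC₂, h₂⟩ := exists_integral_entrySum_normInv_le hK
  have hbound : ∀ᶠ M : ℕ in atTop,
      ‖(M : ℂ) * (∫ X, normInv X a a ∂(gaussianFamily (Fin M × Fin K)) - 1) - K‖ ≤
        (2 * C₁ + C₂) * ((M : ℝ) * (1 / √M ^ 3)) := by
    filter_upwards [eventually_ge_atTop (32 * K)] with M hM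
    have hM0 : 0 < M := by omega
    have hMr : (0 : ℝ) < M := by exact_mod_cast hM0
    have hMc : (M : ℂ) ≠ 0 := by exact_mod_cast hM0.ne'
    have hs : 0 < √(M : ℝ) := Real.sqrt_pos.2 hMr
    set γ := gaussianFamily (Fin M × Fin K)
    have iN : Integrable (fun X => normInv X a a) γ :=
      (memLp_normInv hK hM a a).integrable (by norm_num)
    have iD : Integrable (fun X => gramDeviation X a a) γ :=
      (hasAllMoments_gramDeviation a a).integrable
    have iDD : Integrable (fun X => (gramDeviation X * gramDeviation X) a a) γ := by
      simp only [Matrix.mul_apply]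
      exact (HasAllMoments.sum _ fun b _ => (hasAllMoments_gramDeviation a b).mul
        (hasAllMoments_gramDeviation b a)).integrable
    have eDD : ∫ X, (gramDeviation X * gramDeviation X) a a ∂γ = (K : ℂ) * (M : ℂ)⁻¹ := by
      -- The deviation is Hermitian, so a diagonal entry of its square is the squared norm of a row:
      -- `K` entries, each of second moment `1/M`.
      have : ∀ X : Fin M × Fin K → ℂ, (gramDeviation X * gramDeviation X) a a =
          ((∑ b, ‖gramDeviation X a b‖ ^ 2 : ℝ) : ℂ) := by
        intro X
        have hH : (gramDeviation X)ᴴ = gramDeviation X := by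
          simp [gramDeviation, gram, Matrix.conjTranspose_mul]
        rw [Matrix.mul_apply, Complex.ofReal_sum]
        refine Finset.sum_congr rfl fun b _ => ?_
        rw [show gramDeviation X b a = star (gramDeviation X a b) by
          rw [← Matrix.conjTranspose_apply, hH], Complex.star_def, Complex.mul_conj',
          Complex.ofReal_pow]
      simp_rw [this]
      rw [integral_complex_ofReal, integral_finsetSum _ fun b _ =>
        (hasAllMoments_gramDeviation a b).integrable_norm_pow 2]
      simp [integral_norm_sq_gramDeviation hM0]
    have key : ‖∫ X, normInv X a a ∂γ - 1 - (K : ℂ) * (M : ℂ)⁻¹‖ ≤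
        (2 * C₁ + C₂) * (1 / √M ^ 3) := by
      have e1 : ∫ X, normInv X a a ∂γ - 1 - (K : ℂ) * (M : ℂ)⁻¹ =
          ∫ X, (normInv X a a - ((1 : Matrix (Fin K) (Fin K) ℂ) a a - gramDeviation X a a +
            (gramDeviation X * gramDeviation X) a a)) ∂γ := by
        rw [integral_sub iN (by fun_prop), integral_add (by fun_prop) iDD,
          integral_sub (by fun_prop) iD, eDD, integral_gramDeviation hM0]
        simp
        ring
      rw [e1]
      have hi : Integrable (fun X => 2 * √M * entrySum (gramDeviation X) ^ 4 +
          entrySum (normInv X) ^ 4 / √M ^ 3) γ :=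
        ((h₁ M hM0).1.const_mul _).add ((h₂ M hM).1.div_const _)
      calc _ ≤ ∫ X, 2 * √M * entrySum (gramDeviation X) ^ 4 +
            entrySum (normInv X) ^ 4 / √M ^ 3 ∂γ := by
            refine norm_integral_le_of_norm_le hi ?_
            filter_upwards [ae_isUnit_det_gram hK (by omega : K ≤ M)] with X hX
            exact (norm_normInv_expansion_le hM0 hX a a).trans
              (young_cube hs (entrySum_nonneg _) (entrySum_nonneg _))
        _ = 2 * √M * ∫ X, entrySum (gramDeviation X) ^ 4 ∂γ +
            (∫ X, entrySum (normInv X) ^ 4 ∂γ) / √M ^ 3 := by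
            rw [integral_add ((h₁ M hM0).1.const_mul _) ((h₂ M hM).1.div_const _),
              integral_const_mul, integral_div]
        _ ≤ 2 * √M * (C₁ / M ^ 2) + C₂ / √M ^ 3 := by
            gcongr
            · exact (h₁ M hM0).2
            · exact (h₂ M hM).2
        _ = _ := by
            have : (M : ℝ) ^ 2 = √M ^ 4 := by
              rw [show 4 = 2 * 2 from rfl, pow_mul, Real.sq_sqrt hMr.le]
            rw [this]
            field_simp
    have e2 : (M : ℂ) * (∫ X, normInv X a a ∂γ - 1) - K =
        (M : ℂ) * (∫ X, normInv X a a ∂γ - 1 - (K : ℂ) * (M : ℂ)⁻¹) := by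
      field_simp
    rw [e2, norm_mul, Complex.norm_natCast]
    calc _ ≤ (M : ℝ) * ((2 * C₁ + C₂) * (1 / √M ^ 3)) := by gcongr
      _ = _ := by ring
  rw [tendsto_iff_norm_sub_tendsto_zero]
  refine squeeze_zero' (Eventually.of_forall fun M => norm_nonneg _) hbound ?_
  simpa using tendsto_natCast_mul_inv_sqrt_cube.const_mul (2 * C₁ + C₂)

/-- Only the limit is needed, because relay energies carry two inverse Gram factors and are already
of order `M⁻²`. The product is compared with its limit one factor at a time. -/
theorem tendsto_integral_normInv_mul {K : ℕ} (hK : 0 < K) (a b c d : Fin K) :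
    Tendsto (fun M : ℕ => ∫ X, normInv X a b * normInv X c d ∂(gaussianFamily (Fin M × Fin K)))
      atTop (𝓝 ((1 : Matrix (Fin K) (Fin K) ℂ) a b * (1 : Matrix (Fin K) (Fin K) ℂ) c d)) := by
  obtain ⟨C₁, hC₁, h₁⟩ := exists_integral_entrySum_gramDeviation_le K
  obtain ⟨C₂, hC₂, h₂⟩ := exists_integral_entrySum_normInv_le hK
  set δ := (1 : Matrix (Fin K) (Fin K) ℂ)
  have hδ : ∀ a b, ‖δ a b‖ ≤ 1 := fun a b => by
    simp only [δ, Matrix.one_apply]; split_ifs <;> simp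
  have hbound : ∀ᶠ M : ℕ in atTop,
      ‖∫ X, normInv X a b * normInv X c d ∂(gaussianFamily (Fin M × Fin K)) - δ a b * δ c d‖ ≤
        (3 * C₁ + 4 + 2 * C₂) * (√M)⁻¹ := by
    filter_upwards [eventually_ge_atTop (32 * K)] with M hM
    have hM0 : 0 < M := by omega
    have hMr : (0 : ℝ) < M := by exact_mod_cast hM0
    have hs : 0 < √(M : ℝ) := Real.sqrt_pos.2 hMr
    set γ := gaussianFamily (Fin M × Fin K)
    have m2 : ∀ a b, MemLp (fun X => normInv X a b) 2 γ := fun a b =>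
      (memLp_normInv hK hM a b).mono_exponent (by norm_num)
    have iNN : Integrable (fun X => normInv X a b * normInv X c d) γ :=
      (m2 a b).integrable_mul (m2 c d)
    have i1 := (h₁ M hM0).1
    have i2 := (h₂ M hM).1
    have e1 : ∫ X, normInv X a b * normInv X c d ∂γ - δ a b * δ c d =
        ∫ X, (normInv X a b * normInv X c d - δ a b * δ c d) ∂γ := by
      rw [integral_sub iNN (by fun_prop)]
      simp
    rw [e1]
    set s := √(M : ℝ)
    calc _ ≤ ∫ X, (3 * s ^ 3 * entrySum (gramDeviation X) ^ 4 + 4 / s +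
          2 * entrySum (normInv X) ^ 4 / s) ∂γ := by
          refine norm_integral_le_of_norm_le (by fun_prop) ?_
          filter_upwards [ae_isUnit_det_gram hK (by omega : K ≤ M)] with X hX
          have n1 := norm_normInv_sub_one_le hM0 hX a b
          have n2 := norm_normInv_sub_one_le hM0 hX c d
          have n3 := norm_apply_le_entrySum (normInv X) c d
          set D := entrySum (gramDeviation X)
          set N := entrySum (normInv X)
          have hD : 0 ≤ D := entrySum_nonneg _
          have hN : 0 ≤ N := entrySum_nonneg _
          have y1 := young_mul_sq hs hD N
          have y2 := young_mul_sq hs hD 1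
          have y3 : D * N ≤ D * 1 ^ 2 + D * N ^ 2 := by nlinarith [sq_nonneg (N - 1)]
          calc _ = ‖(normInv X a b - δ a b) * normInv X c d + δ a b * (normInv X c d - δ c d)‖ := by
                congr 1; ring
            _ ≤ (D * N) * N + 1 * (D * N) := by
                refine (norm_add_le _ _).trans ?_
                rw [norm_mul, norm_mul]
                gcongr
                exact hδ a b
            _ ≤ (s ^ 3 * D ^ 4 + 1 / s + N ^ 4 / s) + ((s ^ 3 * D ^ 4 + 1 / s + 1 ^ 4 / s) +
                (s ^ 3 * D ^ 4 + 1 / s + N ^ 4 / s)) := by nlinarith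
            _ = _ := by ring
      _ = 3 * s ^ 3 * ∫ X, entrySum (gramDeviation X) ^ 4 ∂γ + 4 / s +
            2 * (∫ X, entrySum (normInv X) ^ 4 ∂γ) / s := by
          rw [integral_add (by fun_prop) (by fun_prop), integral_add (by fun_prop) (by fun_prop),
            integral_const_mul, integral_div, integral_div, integral_const_mul]
          simp
      _ ≤ 3 * s ^ 3 * (C₁ / M ^ 2) + 4 / s + 2 * C₂ / s := by
          gcongr
          · exact (h₁ M hM0).2
          · exact (h₂ M hM).2
      _ = _ := by
          have : (M : ℝ) ^ 2 = s ^ 4 := by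
            rw [show 4 = 2 * 2 from rfl, pow_mul, Real.sq_sqrt hMr.le]
          rw [this]
          field_simp
  rw [tendsto_iff_norm_sub_tendsto_zero]
  refine squeeze_zero' (Eventually.of_forall fun M => norm_nonneg _) hbound ?_
  have h : Tendsto (fun M : ℕ => (√(M : ℝ))⁻¹) atTop (𝓝 0) :=
    (Real.tendsto_sqrt_atTop.comp tendsto_natCast_atTop_atTop).inv_tendsto_atTop
  simpa using h.const_mul (3 * C₁ + 4 + 2 * C₂)

/-- Changing the sign of column `b` preserves the Gaussian law and negates this entry of the
inverse. -/
lemma integral_inv_gram_offDiag {M K : ℕ} {a b : Fin K} (hab : a ≠ b) :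
    ∫ X, (gram (matOf X))⁻¹ a b ∂(gaussianFamily (Fin M × Fin K)) = 0 := by
  set u : Fin K → ℂ := fun k => if k = b then -1 else 1 with hu
  have huu : ∀ k, u k * u k = 1 := fun k => by simp only [hu]; split_ifs <;> simp
  have hmp := measurePreserving_mul_gaussianFamily (fun x : Fin M × Fin K => u x.2)
    (fun x => by simp only [hu]; split_ifs <;> simp)
  have hD : Matrix.diagonal u * Matrix.diagonal u = 1 := by
    rw [Matrix.diagonal_mul_diagonal, ← Matrix.diagonal_one]
    exact congrArg _ (funext huu)
  have hDinv : (Matrix.diagonal u)⁻¹ = Matrix.diagonal u := Matrix.inv_eq_right_inv hD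
  have hflip : ∀ X : Fin M × Fin K → ℂ, (gram (matOf fun x => u x.2 * X x))⁻¹ a b =
      -(gram (matOf X))⁻¹ a b := by
    intro X
    have h1 : matOf (fun x => u x.2 * X x) = matOf X * Matrix.diagonal u := by
      ext i j; simp [mul_comm]
    have h2 : (Matrix.diagonal u)ᴴ = Matrix.diagonal u := by
      rw [Matrix.diagonal_conjTranspose]
      congr 1
      ext k
      simp only [hu, Pi.star_apply]
      split_ifs <;> simp
    rw [gram, h1, Matrix.conjTranspose_mul, h2, Matrix.mul_assoc, ← Matrix.mul_assoc (matOf X)ᴴ,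
      Matrix.mul_inv_rev, Matrix.mul_inv_rev, hDinv, Matrix.mul_diagonal, Matrix.diagonal_mul]
    simp [hu, hab]
  have h := integral_comp_of_measurePreserving hmp (g := fun X => (gram (matOf X))⁻¹ a b)
    (measurable_inv_apply measurable_gram_apply a b).aestronglyMeasurable
  simp only [hflip, integral_neg] at h
  exact CharZero.neg_eq_self_iff.1 h

/-! ### Second moments of random linear combinations -/

lemma integral_mul_star_self {Ω : Type*} [MeasurableSpace Ω] {P : Measure Ω} {f : Ω → ℂ} :
    ∫ ω, f ω * star (f ω) ∂P = ((∫ ω, ‖f ω‖ ^ 2 ∂P : ℝ) : ℂ) := by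
  rw [← integral_complex_ofReal]
  refine integral_congr_ae (Eventually.of_forall fun ω => ?_)
  simp only [Complex.star_def, Complex.mul_conj', Complex.ofReal_pow]

section RandomCombination

variable {Ω 𝓤 𝓥 J : Type*} [MeasurableSpace Ω] [MeasurableSpace 𝓤] [MeasurableSpace 𝓥] [Fintype J]
  {P : Measure Ω} {U : Ω → 𝓤} {V : Ω → 𝓥} {a : J → 𝓤 → ℂ}
  {Z : J → 𝓥 → ℂ}

lemma memLp_two_mul_of_indepFun (hUV : IndepFun U V P) {f : 𝓤 → ℂ} {g : 𝓥 → ℂ}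
    (hfm : Measurable f) (hgm : Measurable g)
    (hf : MemLp (fun ω => f (U ω)) 2 P) (hg : MemLp (fun ω => g (V ω)) 2 P) :
    MemLp (fun ω => f (U ω) * g (V ω)) 2 P := by
  refine (memLp_two_iff_integrable_sq_norm
    (hf.aestronglyMeasurable.mul hg.aestronglyMeasurable)).2 ?_
  have h1 := (memLp_two_iff_integrable_sq_norm hf.aestronglyMeasurable).1 hf
  have h2 := (memLp_two_iff_integrable_sq_norm hg.aestronglyMeasurable).1 hg
  have hind : IndepFun (fun ω => ‖f (U ω)‖ ^ 2) (fun ω => ‖g (V ω)‖ ^ 2) P :=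
    hUV.comp (φ := fun u => ‖f u‖ ^ 2) (ψ := fun v => ‖g v‖ ^ 2) (hfm.norm.pow_const 2)
      (hgm.norm.pow_const 2)
  refine (hind.integrable_mul h1 h2).congr (Eventually.of_forall fun ω => ?_)
  simp [mul_pow]

lemma memLp_two_combination (hUV : IndepFun U V P) (ham : ∀ j, Measurable (a j))
    (hZm : ∀ j, Measurable (Z j)) (ha : ∀ j, MemLp (fun ω => a j (U ω)) 2 P)
    (hZ : ∀ j, MemLp (fun ω => Z j (V ω)) 2 P) :
    MemLp (fun ω => ∑ j, a j (U ω) * Z j (V ω)) 2 P :=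
  memLp_finsetSum _ fun j _ => memLp_two_mul_of_indepFun hUV (ham j) (hZm j) (ha j) (hZ j)

lemma integral_combination [IsProbabilityMeasure P] (hU : Measurable U) (hV : Measurable V)
    (hUV : IndepFun U V P)
    (ham : ∀ j, Measurable (a j)) (hZm : ∀ j, Measurable (Z j))
    (ha : ∀ j, MemLp (fun ω => a j (U ω)) 2 P) (hZ : ∀ j, MemLp (fun ω => Z j (V ω)) 2 P) :
    ∫ ω, ∑ j, a j (U ω) * Z j (V ω) ∂P =
      ∑ j, (∫ ω, a j (U ω) ∂P) * ∫ ω, Z j (V ω) ∂P := by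
  rw [integral_finsetSum _ fun j _ =>
    (memLp_two_mul_of_indepFun hUV (ham j) (hZm j) (ha j) (hZ j)).integrable (by norm_num)]
  exact Finset.sum_congr rfl fun j _ => hUV.integral_fun_comp_mul_comp hU.aemeasurable
    hV.aemeasurable (ham j).aestronglyMeasurable (hZm j).aestronglyMeasurable

/-- The second moment of a linear combination whose coefficients are independent of the variables
is determined by the two Gram matrices. -/
theorem integral_norm_sq_combination (hU : Measurable U) (hV : Measurable V)
    (hUV : IndepFun U V P) (ham : ∀ j, Measurable (a j)) (hZm : ∀ j, Measurable (Z j))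
    (ha : ∀ j, MemLp (fun ω => a j (U ω)) 2 P) (hZ : ∀ j, MemLp (fun ω => Z j (V ω)) 2 P) :
    ((∫ ω, ‖∑ j, a j (U ω) * Z j (V ω)‖ ^ 2 ∂P : ℝ) : ℂ) =
      ∑ j, ∑ l, (∫ ω, a j (U ω) * star (a l (U ω)) ∂P) *
        ∫ ω, Z j (V ω) * star (Z l (V ω)) ∂P := by
  have hm : ∀ j, MemLp (fun ω => a j (U ω) * Z j (V ω)) 2 P := fun j =>
    memLp_two_mul_of_indepFun hUV (ham j) (hZm j) (ha j) (hZ j)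
  have hexp : ∀ ω, ((‖∑ j, a j (U ω) * Z j (V ω)‖ ^ 2 : ℝ) : ℂ) =
      ∑ j, ∑ l, (a j (U ω) * Z j (V ω)) * star (a l (U ω) * Z l (V ω)) := by
    intro ω
    rw [Complex.ofReal_pow, ← Complex.mul_conj', ← Complex.star_def, star_sum,
      Finset.sum_mul_sum]
  have hint : ∀ j l, Integrable
      (fun ω => (a j (U ω) * Z j (V ω)) * star (a l (U ω) * Z l (V ω))) P :=
    fun j l => (hm j).integrable_mul (hm l).star
  rw [← integral_complex_ofReal]
  simp_rw [hexp]
  rw [integral_finsetSum _ fun j _ => integrable_finsetSum _ fun l _ => hint j l]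
  refine Finset.sum_congr rfl fun j _ => ?_
  rw [integral_finsetSum _ fun l _ => hint j l]
  refine Finset.sum_congr rfl fun l _ => ?_
  have : ∀ ω, (a j (U ω) * Z j (V ω)) * star (a l (U ω) * Z l (V ω)) =
      (a j (U ω) * star (a l (U ω))) * (Z j (V ω) * star (Z l (V ω))) := fun ω => by
    rw [star_mul']; ring
  simp_rw [this]
  exact hUV.integral_fun_comp_mul_comp (f := fun u => a j u * star (a l u))
    (g := fun v => Z j v * star (Z l v)) hU.aemeasurable hV.aemeasurable
    ((ham j).mul (continuous_star.measurable.comp (ham l))).aestronglyMeasurable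
    ((hZm j).mul (continuous_star.measurable.comp (hZm l))).aestronglyMeasurable

theorem integral_norm_sq_combination_of_orthonormal [DecidableEq J] (hU : Measurable U)
    (hV : Measurable V)
    (hUV : IndepFun U V P) (ham : ∀ j, Measurable (a j)) (hZm : ∀ j, Measurable (Z j))
    (ha : ∀ j, MemLp (fun ω => a j (U ω)) 2 P) (hZ : ∀ j, MemLp (fun ω => Z j (V ω)) 2 P)
    (horth : ∀ j l, ∫ ω, Z j (V ω) * star (Z l (V ω)) ∂P = if j = l then 1 else 0) :
    ∫ ω, ‖∑ j, a j (U ω) * Z j (V ω)‖ ^ 2 ∂P = ∑ j, ∫ ω, ‖a j (U ω)‖ ^ 2 ∂P := by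
  have h := integral_norm_sq_combination hU hV hUV ham hZm ha hZ
  simp only [horth, mul_ite, mul_one, mul_zero, Finset.sum_ite_eq, Finset.mem_univ, if_true,
    integral_mul_star_self] at h
  exact_mod_cast h

end RandomCombination

/-! ### Mixed moments of Gaussian families -/

section Isserlis

variable {ι : Type*} [Fintype ι]

/-- Rotating one coordinate preserves the law; a function that is thereby multiplied by `c ≠ 1` has
integral equal to `c` times itself. -/
lemma integral_eq_zero_of_phase [DecidableEq ι] {f : (ι → ℂ) → ℂ} (hf : Measurable f) (i : ι)
    {c : ℂ} (hc : c ≠ 1)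
    {u : ℂ} (hu : ‖u‖ = 1) (h : ∀ x : ι → ℂ,
      f (fun j => (if j = i then u else 1) * x j) = c * f x) :
    ∫ x, f x ∂(gaussianFamily ι) = 0 := by
  have hmp := measurePreserving_mul_gaussianFamily (fun j : ι => if j = i then u else 1)
    (fun j => by split_ifs <;> simp [hu])
  have h1 := integral_comp_of_measurePreserving hmp hf.aestronglyMeasurable
  simp only [h, integral_const_mul] at h1
  have h2 : (c - 1) * ∫ x, f x ∂(gaussianFamily ι) = 0 := by rw [sub_mul, h1]; ring
  exact (mul_eq_zero.1 h2).resolve_left (sub_ne_zero.2 hc)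

lemma integral_eval (i : ι) : ∫ x, x i ∂(gaussianFamily ι) = 0 := by
  rw [integral_comp_eval i (f := fun z => z) (by fun_prop), integral_id_stdComplexGaussian]

lemma integral_mul_star_eval [DecidableEq ι] (i j : ι) :
    ∫ x, x i * star (x j) ∂(gaussianFamily ι) = if i = j then 1 else 0 := by
  have := integral_star_mul_eval j i
  simp_rw [mul_comm (star _)] at this
  rw [this, Matrix.one_apply]
  simp [eq_comm]

/-- Circular symmetry: a product without conjugates picks up a nontrivial phase. This makes the
quadratic error term of the gain centered, even when both factors come from one column. -/
lemma integral_mul_eval [DecidableEq ι] (i j : ι) : ∫ x, x i * x j ∂(gaussianFamily ι) = 0 := by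
  refine integral_eq_zero_of_phase (by fun_prop) i
    (c := if i = j then -1 else Complex.I) ?_ (u := Complex.I) (by simp) fun x => ?_
  · split_ifs
    · norm_num
    · intro h; simpa using congrArg Complex.re h
  · by_cases h : i = j
    · subst h
      simp only [if_true]
      linear_combination (x i * x i) * Complex.I_mul_I
    · simp [h, Ne.symm h, mul_assoc]

/-- Odd degree under a global sign change. It removes the correlation between the linear and the
quadratic part of the gain deviation. -/
lemma integral_mul_star_mul_eval (i j k : ι) :
    ∫ x, x i * star (x j * x k) ∂(gaussianFamily ι) = 0 := by
  have hmp := measurePreserving_mul_gaussianFamily (fun _ : ι => (-1 : ℂ)) (fun j => by simp)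
  have h1 := integral_comp_of_measurePreserving hmp
    (g := fun x : ι → ℂ => x i * star (x j * x k))
    (Continuous.aestronglyMeasurable (by fun_prop))
  have h2 : ∀ x : ι → ℂ, -1 * x i * star (-1 * x j * (-1 * x k)) = -(x i * star (x j * x k)) := by
    intro x
    have : -1 * x j * (-1 * x k) = x j * x k := by ring
    rw [this]
    ring
  simp only [h2, integral_neg] at h1
  exact CharZero.neg_eq_self_iff.1 h1

lemma integral_norm_sq_mul_norm_sq_eval [DecidableEq ι] (i j : ι) :
    ∫ x, (x i * x j) * star (x i * x j) ∂(gaussianFamily ι) = if i = j then 2 else 1 := by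
  have h0 : ∀ x : ι → ℂ, (x i * x j) * star (x i * x j) = ((‖x i‖ ^ 2 * ‖x j‖ ^ 2 : ℝ) : ℂ) := by
    intro x
    rw [Complex.star_def, Complex.mul_conj', norm_mul, ← mul_pow]
    push_cast
    rfl
  simp_rw [h0]
  rw [integral_complex_ofReal]
  by_cases h : i = j
  · subst h
    have : ∀ z : ℂ, ‖z‖ ^ 2 * ‖z‖ ^ 2 = ‖z‖ ^ 4 := fun z => by ring
    simp_rw [this]
    rw [integral_comp_eval i (f := fun z => ‖z‖ ^ 4) (by fun_prop),
      integral_norm_pow_four_stdComplexGaussian]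
    simp
  · rw [(indepFun_eval h).integral_fun_comp_mul_comp (f := fun z => ‖z‖ ^ 2)
      (g := fun z => ‖z‖ ^ 2) (measurable_pi_apply i).aemeasurable
      (measurable_pi_apply j).aemeasurable (by fun_prop) (by fun_prop),
      integral_comp_eval i (f := fun z => ‖z‖ ^ 2) (by fun_prop),
      integral_comp_eval j (f := fun z => ‖z‖ ^ 2) (by fun_prop),
      integral_norm_sq_stdComplexGaussian]
    simp [h]

/-- The fourth order moments of a family of independent standard complex Gaussian variables. -/
theorem integral_mul_mul_star_mul_eval [DecidableEq ι] (i j k l : ι) :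
    ∫ x, (x i * x j) * star (x k * x l) ∂(gaussianFamily ι) =
      (if i = k ∧ j = l then 1 else 0) + if i = l ∧ j = k then 1 else 0 := by
  by_cases h1 : i = k ∧ j = l
  · obtain ⟨rfl, rfl⟩ := h1
    rw [integral_norm_sq_mul_norm_sq_eval]
    by_cases h : i = j
    · subst h; norm_num
    · simp [h, Ne.symm h]
  by_cases h2 : i = l ∧ j = k
  · obtain ⟨rfl, rfl⟩ := h2
    have : ∀ x : ι → ℂ, (x i * x j) * star (x j * x i) = (x i * x j) * star (x i * x j) :=
      fun x => by rw [mul_comm (x j)]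
    simp_rw [this]
    rw [integral_norm_sq_mul_norm_sq_eval]
    have h : i ≠ j := fun h => h1 ⟨h, h.symm⟩
    simp [h, Ne.symm h]
  rw [if_neg h1, if_neg h2, add_zero]
  set φ : ι → ι → ℂ := fun p q => if q = p then Complex.I else 1 with hφ
  -- Rotating coordinate `p` by `I` multiplies the monomial by the displayed phase; it remains to
  -- find, for unmatched indices, a `p` whose phase is not `1`.
  have key : ∀ p, (φ p i * φ p j) * star (φ p k * φ p l) ≠ 1 →
      ∫ x, (x i * x j) * star (x k * x l) ∂(gaussianFamily ι) = 0 := by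
    intro p hp
    refine integral_eq_zero_of_phase (Continuous.measurable (by fun_prop)) p hp (u := Complex.I)
      (by simp) fun x => ?_
    simp only [hφ, star_mul']
    ring
  have hI1 : Complex.I ≠ 1 := fun h => by simpa using congrArg Complex.re h
  have hself : ∀ p q, φ p q * star (φ p q) = 1 := fun p q => by
    simp only [hφ]; split_ifs <;> simp
  by_cases hik : i = k
  · subst hik
    have hjl : l ≠ j := fun h => h1 ⟨rfl, h.symm⟩
    refine key j ?_
    have e : (φ j i * φ j j) * star (φ j i * φ j l) = Complex.I := by
      rw [star_mul', mul_mul_mul_comm, hself]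
      simp [hφ, hjl]
    rwa [e]
  by_cases hil : i = l
  · subst hil
    have hjk : k ≠ j := fun h => h2 ⟨rfl, h.symm⟩
    refine key j ?_
    have e : (φ j i * φ j j) * star (φ j k * φ j i) = Complex.I := by
      rw [mul_comm (φ j k), star_mul', mul_mul_mul_comm, hself]
      simp [hφ, hjk]
    rwa [e]
  -- Here `i` occurs among the conjugated indices not at all, so the phase is `I`, or `I² = -1` when
  -- `j = i`.
  · refine key i ?_
    simp only [hφ, if_neg (Ne.symm hik), if_neg (Ne.symm hil), if_true, mul_one, star_one]
    split_ifs
    · rw [Complex.I_mul_I]; norm_num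
    · simpa using hI1

end Isserlis

/-! ### Zero-forcing matrices -/

section ZeroForcing

variable {M K : ℕ}

/-- The zero-forcing receiver of a channel estimate. -/
def zf (G : Matrix (Fin M) (Fin K) ℂ) : Matrix (Fin K) (Fin M) ℂ := (gram G)⁻¹ * Gᴴ

/-- The matrix inverted in the precoder is the transposed Gram matrix. Thus precoder and receiver
are transposes of one another and only `zf` has to be studied. -/
lemma map_star_mul_inv_eq_zf_transpose (G : Matrix (Fin M) (Fin K) ℂ) :
    G.map star * (Gᵀ * G.map star)⁻¹ = (zf G)ᵀ := by
  have h : Gᵀ * G.map star = (gram G)ᵀ := by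
    rw [gram, Matrix.transpose_mul]
    rfl
  rw [h, ← Matrix.transpose_nonsing_inv, zf, Matrix.transpose_mul]
  rfl

lemma zf_mul_self {G : Matrix (Fin M) (Fin K) ℂ} (hG : IsUnit (gram G).det) : zf G * G = 1 := by
  rw [zf, Matrix.mul_assoc, Matrix.nonsing_inv_mul _ hG]

/-- Through this identity all energies of the relay processing become expressions in the inverse
Gram matrix. -/
lemma zf_mul_conjTranspose {G : Matrix (Fin M) (Fin K) ℂ} (hG : IsUnit (gram G).det) :
    zf G * (zf G)ᴴ = (gram G)⁻¹ := by
  have hH : ((gram G)⁻¹)ᴴ = (gram G)⁻¹ := by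
    rw [Matrix.conjTranspose_nonsing_inv, gram, Matrix.conjTranspose_mul,
      Matrix.conjTranspose_conjTranspose]
  rw [zf, Matrix.conjTranspose_mul, Matrix.conjTranspose_conjTranspose, hH, Matrix.mul_assoc,
    ← Matrix.mul_assoc Gᴴ, Matrix.mul_nonsing_inv _ hG, Matrix.mul_one]

lemma sum_zf_mul_star {G : Matrix (Fin M) (Fin K) ℂ} (hG : IsUnit (gram G).det) (k l : Fin K) :
    ∑ m, zf G k m * star (zf G l m) = (gram G)⁻¹ k l := by
  rw [← zf_mul_conjTranspose hG]
  rfl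

lemma sum_norm_sq_zf {G : Matrix (Fin M) (Fin K) ℂ} (hG : IsUnit (gram G).det) (k : Fin K) :
    ((∑ m, ‖zf G k m‖ ^ 2 : ℝ) : ℂ) = (gram G)⁻¹ k k := by
  rw [← sum_zf_mul_star hG]
  push_cast
  exact Finset.sum_congr rfl fun m _ => by rw [Complex.star_def, Complex.mul_conj']

variable [NeZero K]

/-- The matrix `A Π Wᵀ` by which the relay processes the received signal. -/
def relayMat (G : Matrix (Fin M) (Fin K) ℂ) : Matrix (Fin M) (Fin M) ℂ :=
  (zf G)ᵀ * slotPerm K * zf G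

lemma slotPerm_mul_apply {α : Type*} (A : Matrix (Fin K) α ℂ) (k : Fin K) (i : α) :
    (slotPerm K * A) k i = A (k + 1) i := by
  simp [slotPerm, Matrix.mul_apply]

lemma mul_slotPerm_apply {α : Type*} (A : Matrix α (Fin K) ℂ) (i : α) (k : Fin K) :
    (A * slotPerm K) i k = A i (k - 1) := by
  simp [slotPerm, Matrix.mul_apply, ← sub_eq_iff_eq_add]

lemma relayMat_apply (G : Matrix (Fin M) (Fin K) ℂ) (m n : Fin M) :
    relayMat G m n = ∑ k, zf G k m * zf G (k + 1) n := by
  rw [relayMat, Matrix.mul_assoc, Matrix.mul_apply]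
  simp only [slotPerm_mul_apply, Matrix.transpose_apply]

lemma sum_relayMat_mul_star {G : Matrix (Fin M) (Fin K) ℂ} (hG : IsUnit (gram G).det) :
    ∑ m, ∑ n, relayMat G m n * star (relayMat G m n) =
      ∑ k, ∑ l, (gram G)⁻¹ k l * (gram G)⁻¹ (k + 1) (l + 1) := by
  simp only [relayMat_apply, star_sum, Finset.sum_mul_sum, ← sum_zf_mul_star hG, star_mul']
  simp only [Finset.sum_comm (s := (Finset.univ : Finset (Fin M)))
    (t := (Finset.univ : Finset (Fin K)))]
  refine Finset.sum_congr rfl fun k _ => Finset.sum_congr rfl fun l _ =>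
    Finset.sum_congr rfl fun m _ => Finset.sum_congr rfl fun n _ => by ring

/-- Transposing one factor pairs row `k` of the receiver with row `l + 1` instead of `l`. For `K ≥
3` no pair `k`, `l` makes both inverse Gram entries diagonal. -/
lemma sum_relayMat_mul_star_swap {G : Matrix (Fin M) (Fin K) ℂ} (hG : IsUnit (gram G).det) :
    ∑ m, ∑ n, relayMat G m n * star (relayMat G n m) =
      ∑ k, ∑ l, (gram G)⁻¹ k (l + 1) * (gram G)⁻¹ (k + 1) l := by
  simp only [relayMat_apply, star_sum, Finset.sum_mul_sum, ← sum_zf_mul_star hG, star_mul']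
  simp only [Finset.sum_comm (s := (Finset.univ : Finset (Fin M)))
    (t := (Finset.univ : Finset (Fin K)))]
  refine Finset.sum_congr rfl fun k _ => Finset.sum_congr rfl fun l _ =>
    Finset.sum_congr rfl fun m _ => Finset.sum_congr rfl fun n _ => by ring

/-- The processed channel `A Π Wᵀ (Ĝ + E)`. -/
lemma relayMat_mul_add_apply {G : Matrix (Fin M) (Fin K) ℂ} (hG : IsUnit (gram G).det)
    (E : Matrix (Fin M) (Fin K) ℂ) (m : Fin M) (i : Fin K) :
    (relayMat G * (G + E)) m i = zf G (i - 1) m + ∑ n, relayMat G m n * E n i := by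
  rw [Matrix.mul_add, Matrix.add_apply]
  congr 1
  rw [relayMat, Matrix.mul_assoc, zf_mul_self hG, Matrix.mul_one, mul_slotPerm_apply]
  rfl

lemma transpose_mul_relayMat_apply {G : Matrix (Fin M) (Fin K) ℂ} (hG : IsUnit (gram G).det)
    (E : Matrix (Fin M) (Fin K) ℂ) (k : Fin K) (n : Fin M) :
    ((G + E)ᵀ * relayMat G) k n = zf G (k + 1) n + ∑ m, relayMat G m n * E m k := by
  rw [Matrix.transpose_add, Matrix.add_mul, Matrix.add_apply]
  congr 1
  · have h : Gᵀ * (zf G)ᵀ = 1 := by rw [← Matrix.transpose_mul, zf_mul_self hG, transpose_one]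
    rw [relayMat, ← Matrix.mul_assoc, ← Matrix.mul_assoc, h, Matrix.one_mul, slotPerm_mul_apply]
  · rw [Matrix.mul_apply]
    exact Finset.sum_congr rfl fun m _ => by rw [Matrix.transpose_apply, mul_comm]

/-- The deviation of the effective gain from its ideal value. -/
def gainDeviation (G E : Matrix (Fin M) (Fin K) ℂ) (k i : Fin K) : ℂ :=
  ∑ m, zf G (i - 1) m * E m k + ∑ m, zf G (k + 1) m * E m i +
    ∑ x : Fin M × Fin M, relayMat G x.1 x.2 * (E x.1 k * E x.2 i)

/-- Expansion of `(Ĝ + E)ᵀ R (Ĝ + E)`: the receiver inverts `Ĝ` on either side, so the term without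
`E` is `Π` and the two linear terms involve a single row of the receiver each. -/
lemma transpose_mul_relayMat_mul_apply {G : Matrix (Fin M) (Fin K) ℂ}
    (hG : IsUnit (gram G).det) (E : Matrix (Fin M) (Fin K) ℂ) (k i : Fin K) :
    ((G + E)ᵀ * (relayMat G * (G + E))) k i = slotPerm K k i + gainDeviation G E k i := by
  rw [← Matrix.mul_assoc, Matrix.mul_add, Matrix.add_apply, Matrix.mul_assoc, gainDeviation]
  have h1 : ((G + E)ᵀ * (relayMat G * G)) k i =
      slotPerm K k i + ∑ m, zf G (i - 1) m * E m k := by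
    rw [relayMat, Matrix.mul_assoc, zf_mul_self hG, Matrix.mul_one, Matrix.transpose_add,
      Matrix.add_mul,
      Matrix.add_apply, ← Matrix.mul_assoc, ← Matrix.mul_assoc, ← Matrix.transpose_mul,
      zf_mul_self hG, Matrix.transpose_one, Matrix.one_mul, mul_slotPerm_apply, Matrix.mul_apply]
    congr 1
    exact Finset.sum_congr rfl fun m _ => by simp [mul_comm]
  have h2 : ((G + E)ᵀ * relayMat G * E) k i = ∑ m, zf G (k + 1) m * E m i +
      ∑ x : Fin M × Fin M, relayMat G x.1 x.2 * (E x.1 k * E x.2 i) := by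
    rw [Matrix.mul_apply]
    simp only [transpose_mul_relayMat_apply hG, add_mul, Finset.sum_add_distrib]
    congr 1
    rw [Fintype.sum_prod_type, Finset.sum_comm]
    refine Finset.sum_congr rfl fun n _ => ?_
    rw [Finset.sum_mul]
    exact Finset.sum_congr rfl fun m _ => by ring
  rw [h1, h2, add_assoc, add_assoc]

end ZeroForcing

/-! ### Zero-forcing with independent Gaussian estimates and errors -/

section GaussianZeroForcing

variable {M K : ℕ}

/-- The matrix whose `k`-th column is `σ k` times the `k`-th column of the given family. -/
def scaledMat (σ : Fin K → ℝ) (X : Fin M × Fin K → ℂ) : Matrix (Fin M) (Fin K) ℂ :=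
  Matrix.of fun m k => (σ k : ℂ) * X (m, k)

lemma scaledMat_apply (σ : Fin K → ℝ) (X : Fin M × Fin K → ℂ) (m : Fin M) (k : Fin K) :
    scaledMat σ X m k = (σ k : ℂ) * X (m, k) := rfl

lemma gram_scaledMat (σ : Fin K → ℝ) (X : Fin M × Fin K → ℂ) :
    gram (scaledMat σ X) = Matrix.diagonal (fun k => (σ k : ℂ)) * gram (matOf X) *
      Matrix.diagonal (fun k => (σ k : ℂ)) := by
  have h1 : scaledMat σ X = matOf X * Matrix.diagonal fun k => (σ k : ℂ) := by
    ext m k; simp [scaledMat, mul_comm]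
  have h2 : (Matrix.diagonal fun k => (σ k : ℂ))ᴴ = Matrix.diagonal fun k => (σ k : ℂ) := by
    rw [Matrix.diagonal_conjTranspose]
    congr 1
    ext k
    simp
  rw [gram, h1, Matrix.conjTranspose_mul, h2]
  simp only [Matrix.mul_assoc]

lemma isUnit_det_gram_scaledMat {σ : Fin K → ℝ} (hσ : ∀ k, σ k ≠ 0) {X : Fin M × Fin K → ℂ}
    (hX : IsUnit (gram (matOf X)).det) : IsUnit (gram (scaledMat σ X)).det := by
  have h : IsUnit (Matrix.diagonal fun k => (σ k : ℂ)).det := by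
    rw [Matrix.det_diagonal, isUnit_iff_ne_zero, Finset.prod_ne_zero_iff]
    exact fun k _ => by exact_mod_cast hσ k
  rw [gram_scaledMat, Matrix.det_mul, Matrix.det_mul]
  exact (h.mul hX).mul h

lemma inv_gram_scaledMat_apply {σ : Fin K → ℝ} (hσ : ∀ k, σ k ≠ 0) (X : Fin M × Fin K → ℂ)
    (k l : Fin K) :
    (gram (scaledMat σ X))⁻¹ k l = (gram (matOf X))⁻¹ k l / (σ k * σ l) := by
  have hσ' : ∀ k, (σ k : ℂ) ≠ 0 := fun k => by exact_mod_cast hσ k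
  have h : (Matrix.diagonal fun k => (σ k : ℂ))⁻¹ = Matrix.diagonal fun k => (σ k : ℂ)⁻¹ := by
    refine Matrix.inv_eq_right_inv ?_
    rw [Matrix.diagonal_mul_diagonal, ← Matrix.diagonal_one]
    congr 1
    ext k
    exact mul_inv_cancel₀ (hσ' k)
  rw [gram_scaledMat, Matrix.mul_inv_rev, Matrix.mul_inv_rev, h, Matrix.diagonal_mul,
    Matrix.mul_diagonal]
  field_simp [hσ' k, hσ' l]

lemma measurable_gram_scaledMat_apply (σ : Fin K → ℝ) (k l : Fin K) :
    Measurable fun X : Fin M × Fin K → ℂ => gram (scaledMat σ X) k l :=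
  Continuous.measurable (by
    simp only [Matrix.mul_apply, Matrix.conjTranspose_apply, scaledMat_apply]; fun_prop)

lemma measurable_zf_apply (σ : Fin K → ℝ) (k : Fin K) (m : Fin M) :
    Measurable fun X : Fin M × Fin K → ℂ => zf (scaledMat σ X) k m := by
  simp only [zf, Matrix.mul_apply, Matrix.conjTranspose_apply, scaledMat_apply]
  refine Finset.measurable_sum _ fun l _ =>
    (measurable_inv_apply (measurable_gram_scaledMat_apply σ) k l).mul
      (Continuous.measurable (by fun_prop))

lemma ae_isUnit_det_gram_scaledMat {σ : Fin K → ℝ} (hσ : ∀ k, σ k ≠ 0) (hK : 0 < K)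
    (hM : K ≤ M) : ∀ᵐ X ∂(gaussianFamily (Fin M × Fin K)), IsUnit (gram (scaledMat σ X)).det := by
  filter_upwards [ae_isUnit_det_gram hK hM] with X hX
  exact isUnit_det_gram_scaledMat hσ hX

lemma memLp_inv_gram_scaledMat {σ : Fin K → ℝ} (hσ : ∀ k, σ k ≠ 0) (hK : 0 < K)
    (hM : 32 * K ≤ M) (k l : Fin K) :
    MemLp (fun X => (gram (scaledMat σ X))⁻¹ k l) 4 (gaussianFamily (Fin M × Fin K)) := by
  have hM0 : (M : ℂ) ≠ 0 := by
    have : 0 < M := by omega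
    exact_mod_cast this.ne'
  have h := (memLp_normInv hK hM k l).const_mul ((M : ℂ)⁻¹ * ((σ k : ℂ) * σ l)⁻¹)
  refine h.ae_eq (Eventually.of_forall fun X => ?_)
  simp only [normInv, inv_gram_scaledMat_apply hσ, Matrix.smul_apply, smul_eq_mul]
  field_simp

/-- The squared entry is dominated by a diagonal entry of the inverse Gram matrix, whose second
moment is finite. Fourth moments are needed because the relay matrix is quadratic in the receiver.
-/
lemma memLp_zf {σ : Fin K → ℝ} (hσ : ∀ k, σ k ≠ 0) (hK : 0 < K)
    (hM : 32 * K ≤ M) (k : Fin K) (m : Fin M) :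
    MemLp (fun X => zf (scaledMat σ X) k m) 4 (gaussianFamily (Fin M × Fin K)) := by
  have hmeas := (measurable_zf_apply σ k m).aestronglyMeasurable
    (μ := gaussianFamily (Fin M × Fin K))
  rw [← integrable_norm_rpow_iff hmeas (by norm_num) (by norm_num)]
  have hQ : Integrable (fun X => ‖(gram (scaledMat σ X))⁻¹ k k‖ ^ 2)
      (gaussianFamily (Fin M × Fin K)) :=
    ((memLp_inv_gram_scaledMat hσ hK hM k k).mono_exponent
      (by norm_num : (2 : ENNReal) ≤ 4)).integrable_norm_pow (by norm_num)
  refine hQ.mono' ((measurable_zf_apply σ k m).norm.pow_const _).aestronglyMeasurable ?_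
  filter_upwards [ae_isUnit_det_gram_scaledMat hσ hK (by omega : K ≤ M)] with X hX
  have h1 := sum_norm_sq_zf hX k
  have h2 : ‖zf (scaledMat σ X) k m‖ ^ 2 ≤ ‖(gram (scaledMat σ X))⁻¹ k k‖ := by
    rw [← h1, Complex.norm_real, Real.norm_of_nonneg (by positivity)]
    exact Finset.single_le_sum (f := fun m => ‖zf (scaledMat σ X) k m‖ ^ 2)
      (fun _ _ => by positivity) (Finset.mem_univ m)
  have h3 : ‖zf (scaledMat σ X) k m‖ ^ (4 : ENNReal).toReal =
      (‖zf (scaledMat σ X) k m‖ ^ 2) ^ 2 := by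
    rw [← pow_mul, ENNReal.toReal_ofNat]
    exact_mod_cast Real.rpow_natCast _ 4
  rw [h3, Real.norm_of_nonneg (by positivity)]
  gcongr

lemma memLp_two_zf {σ : Fin K → ℝ} (hσ : ∀ k, σ k ≠ 0) (hK : 0 < K)
    (hM : 32 * K ≤ M) (k : Fin K) (m : Fin M) :
    MemLp (fun X => zf (scaledMat σ X) k m) 2 (gaussianFamily (Fin M × Fin K)) :=
  (memLp_zf hσ hK hM k m).mono_exponent (by norm_num)

/-- The mean energy of a row of the zero-forcing receiver. -/
def receiverEnergy (M : ℕ) (σ : Fin K → ℝ) (k : Fin K) : ℝ :=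
  ∑ m : Fin M, ∫ X, ‖zf (scaledMat σ X) k m‖ ^ 2 ∂(gaussianFamily (Fin M × Fin K))

/-- The joint law of estimate and error, normalized. -/
abbrev gaussianPair (M K : ℕ) : Measure ((Fin M × Fin K → ℂ) × (Fin M × Fin K → ℂ)) :=
  (gaussianFamily (Fin M × Fin K)).prod (gaussianFamily (Fin M × Fin K))

lemma indepFun_gaussianPair (M K : ℕ) : IndepFun Prod.fst Prod.snd (gaussianPair M K) :=
  indepFun_prod (X := id) (Y := id) measurable_id measurable_id

lemma integral_fst_gaussianPair {E : Type*} [NormedAddCommGroup E] [NormedSpace ℝ E]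
    {f : (Fin M × Fin K → ℂ) → E} (hf : AEStronglyMeasurable f (gaussianFamily (Fin M × Fin K))) :
    ∫ z, f z.1 ∂(gaussianPair M K) = ∫ X, f X ∂(gaussianFamily (Fin M × Fin K)) :=
  integral_comp_of_measurePreserving measurePreserving_fst hf

lemma integral_snd_gaussianPair {E : Type*} [NormedAddCommGroup E] [NormedSpace ℝ E]
    {f : (Fin M × Fin K → ℂ) → E} (hf : AEStronglyMeasurable f (gaussianFamily (Fin M × Fin K))) :
    ∫ z, f z.2 ∂(gaussianPair M K) = ∫ X, f X ∂(gaussianFamily (Fin M × Fin K)) :=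
  integral_comp_of_measurePreserving measurePreserving_snd hf

/-- Second moment of an affine function of a column of the error. -/
lemma moments_affine_gaussianPair {b₀ : (Fin M × Fin K → ℂ) → ℂ}
    {b : Fin M → (Fin M × Fin K → ℂ) → ℂ}
    (hb₀m : Measurable b₀) (hbm : ∀ m, Measurable (b m))
    (hb₀ : MemLp b₀ 2 (gaussianFamily (Fin M × Fin K)))
    (hb : ∀ m, MemLp (b m) 2 (gaussianFamily (Fin M × Fin K))) (k : Fin K) :
    MemLp (fun z => b₀ z.1 + ∑ m, b m z.1 * z.2 (m, k)) 2 (gaussianPair M K) ∧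
    ∫ z, ‖b₀ z.1 + ∑ m, b m z.1 * z.2 (m, k)‖ ^ 2 ∂(gaussianPair M K) =
      ∫ X, ‖b₀ X‖ ^ 2 ∂(gaussianFamily (Fin M × Fin K)) +
        ∑ m, ∫ X, ‖b m X‖ ^ 2 ∂(gaussianFamily (Fin M × Fin K)) := by
  -- The index `none` carries the constant variable `1`, which is orthonormal to the centered
  -- Gaussian entries of the column.
  set a : Option (Fin M) → (Fin M × Fin K → ℂ) → ℂ := fun j => j.elim b₀ b with ha
  set Z : Option (Fin M) → (Fin M × Fin K → ℂ) → ℂ := fun j => j.elim (fun _ => 1)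
    (fun m x => x (m, k)) with hZ
  have ham : ∀ j, Measurable (a j) := by rintro (_ | m); exacts [hb₀m, hbm m]
  have hZm : ∀ j, Measurable (Z j) := by
    rintro (_ | m); exacts [measurable_const, measurable_pi_apply _]
  have haL : ∀ j, MemLp (fun z => a j z.1) 2 (gaussianPair M K) := by
    rintro (_ | m)
    exacts [hb₀.comp_measurePreserving measurePreserving_fst,
      (hb m).comp_measurePreserving measurePreserving_fst]
  have hZL : ∀ j, MemLp (fun z => Z j z.2) 2 (gaussianPair M K) := by
    rintro (_ | m)
    exacts [memLp_const 1, (hasAllMoments_eval (m, k) 2 (by simp)).comp_measurePreserving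
      measurePreserving_snd]
  have hsum : ∀ z : (Fin M × Fin K → ℂ) × (Fin M × Fin K → ℂ),
      b₀ z.1 + ∑ m, b m z.1 * z.2 (m, k) = ∑ j, a j z.1 * Z j z.2 := by
    intro z
    rw [Fintype.sum_option]
    simp [ha, hZ]
  simp_rw [hsum]
  refine ⟨memLp_two_combination (indepFun_gaussianPair M K) ham hZm haL hZL, ?_⟩
  rw [integral_norm_sq_combination_of_orthonormal measurable_fst measurable_snd
    (indepFun_gaussianPair M K) ham hZm haL hZL, Fintype.sum_option]
  · rw [integral_fst_gaussianPair (f := fun X => ‖a none X‖ ^ 2)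
      ((ham none).norm.pow_const 2).aestronglyMeasurable]
    congr 1
    exact Finset.sum_congr rfl fun m _ => integral_fst_gaussianPair
      (f := fun X => ‖a (some m) X‖ ^ 2) ((ham (some m)).norm.pow_const 2).aestronglyMeasurable
  · intro j l
    rw [integral_snd_gaussianPair (f := fun X => Z j X * star (Z l X))
      ((hZm j).mul (continuous_star.measurable.comp (hZm l))).aestronglyMeasurable]
    rcases j with _ | m <;> rcases l with _ | n
    · simp [hZ]
    · simp only [hZ, Option.elim, one_mul, reduceCtorEq, if_false]
      have := integral_conj (μ := gaussianFamily (Fin M × Fin K)) (f := fun x => x (n, k))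
      rw [integral_eval, map_zero] at this
      exact this
    · simpa [hZ] using integral_eval (m, k)
    · simp only [hZ, Option.elim, integral_mul_star_eval]
      simp [Prod.ext_iff]

variable [NeZero K]

lemma measurable_relayMat_apply (σ : Fin K → ℝ) (m n : Fin M) :
    Measurable fun X : Fin M × Fin K → ℂ => relayMat (scaledMat σ X) m n := by
  simp only [relayMat_apply]
  exact Finset.measurable_sum _ fun k _ =>
    (measurable_zf_apply σ k m).mul (measurable_zf_apply σ (k + 1) n)

lemma memLp_relayMat {σ : Fin K → ℝ} (hσ : ∀ k, σ k ≠ 0)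
    (hM : 32 * K ≤ M) (m n : Fin M) :
    MemLp (fun X => relayMat (scaledMat σ X) m n) 2 (gaussianFamily (Fin M × Fin K)) := by
  have hK : 0 < K := Nat.pos_of_neZero K
  simp only [relayMat_apply]
  have : ENNReal.HolderTriple 4 4 2 := ⟨by
    rw [show (4 : ENNReal) = 2 * 2 by norm_num, ENNReal.mul_inv (by simp) (by simp), ← add_mul,
      ENNReal.inv_two_add_inv_two, one_mul]⟩
  exact memLp_finsetSum _ fun k _ => (memLp_zf hσ hK hM (k + 1) n).mul (memLp_zf hσ hK hM k m)

/-- The mean energy of the relay matrix. -/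
def relayEnergy (M : ℕ) (σ : Fin K → ℝ) : ℝ :=
  ∑ m : Fin M, ∑ n : Fin M,
    ∫ X, ‖relayMat (scaledMat σ X) m n‖ ^ 2 ∂(gaussianFamily (Fin M × Fin K))

/-- The mean correlation of the relay matrix with its transpose. -/
def relayCorrelation (M : ℕ) (σ : Fin K → ℝ) : ℂ :=
  ∑ m : Fin M, ∑ n : Fin M, ∫ X, relayMat (scaledMat σ X) m n *
    star (relayMat (scaledMat σ X) n m) ∂(gaussianFamily (Fin M × Fin K))

end GaussianZeroForcing

/-! ### Mean energies of the zero-forcing matrices and moments of the effective gain -/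

section GainMoments

variable {M K : ℕ}

lemma memLp_two_inv_gram_scaledMat {σ : Fin K → ℝ} (hσ : ∀ k, σ k ≠ 0) (hK : 0 < K)
    (hM : 32 * K ≤ M) (k l : Fin K) :
    MemLp (fun X => (gram (scaledMat σ X))⁻¹ k l) 2 (gaussianFamily (Fin M × Fin K)) :=
  (memLp_inv_gram_scaledMat hσ hK hM k l).mono_exponent (by norm_num)

variable [NeZero K]

/-- This is how `K ≥ 3` enters. For `K = 2` the shifts by `1` and `-1` coincide, and the correlation
of the relay matrix with its transpose would survive at order `M⁻²`. -/
lemma one_add_one_ne_zero_of_three_le (hK : 3 ≤ K) : (1 + 1 : Fin K) ≠ 0 := by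
  intro h
  have h2 := congrArg Fin.val h
  have h1 : ((1 : Fin K) : ℕ) = 1 := by
    rw [Fin.val_one', Nat.mod_eq_of_lt (by omega)]
  rw [Fin.val_add, h1, Nat.mod_eq_of_lt (by omega)] at h2
  simp at h2

lemma sub_one_ne_add_one (hK : 3 ≤ K) (k : Fin K) : k - 1 ≠ k + 1 := by
  intro h
  apply one_add_one_ne_zero_of_three_le hK
  rw [sub_eq_iff_eq_add, add_assoc] at h
  exact left_eq_add.1 h

lemma integrable_mul_star {α : Type*} [MeasurableSpace α] {μ : Measure α} {f g : α → ℂ}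
    (hf : MemLp f 2 μ) (hg : MemLp g 2 μ) : Integrable (fun x => f x * star (g x)) μ :=
  hf.integrable_mul hg.star

lemma integrable_mul_fun {α : Type*} [MeasurableSpace α] {μ : Measure α} {f g : α → ℂ}
    (hf : MemLp f 2 μ) (hg : MemLp g 2 μ) : Integrable (fun x => f x * g x) μ :=
  hf.integrable_mul hg

lemma integral_sum_sum {α I J : Type*} [MeasurableSpace α] [Fintype I] [Fintype J] {μ : Measure α}
    {f : I → J → α → ℂ} (hf : ∀ i j, Integrable (f i j) μ) :
    ∫ x, ∑ i, ∑ j, f i j x ∂μ = ∑ i, ∑ j, ∫ x, f i j x ∂μ := by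
  rw [integral_finsetSum _ fun i _ => integrable_finsetSum _ fun j _ => hf i j]
  exact Finset.sum_congr rfl fun i _ => integral_finsetSum _ fun j _ => hf i j

lemma integral_const_mul_mul_star {α : Type*} [MeasurableSpace α] {μ : Measure α} (c d : ℂ)
    (f g : α → ℂ) : ∫ x, (c * f x) * star (d * g x) ∂μ =
      c * star d * ∫ x, f x * star (g x) ∂μ := by
  rw [← integral_const_mul]
  refine integral_congr_ae (Eventually.of_forall fun x => ?_)
  simp only [star_mul']
  ring

lemma integral_sum_zf_mul_star {σ : Fin K → ℝ} (hσ : ∀ k, σ k ≠ 0) (hM : 32 * K ≤ M)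
    (k l : Fin K) :
    ∑ m : Fin M, ∫ X, zf (scaledMat σ X) k m * star (zf (scaledMat σ X) l m)
      ∂(gaussianFamily (Fin M × Fin K)) =
    ∫ X, (gram (scaledMat σ X))⁻¹ k l ∂(gaussianFamily (Fin M × Fin K)) := by
  have hK : 0 < K := Nat.pos_of_neZero K
  rw [← integral_finsetSum]
  · refine integral_congr_ae ?_
    filter_upwards [ae_isUnit_det_gram_scaledMat hσ hK (by omega : K ≤ M)] with X hX
    exact sum_zf_mul_star hX k l
  · exact fun m _ => (memLp_two_zf hσ hK hM k m).integrable_mul (memLp_two_zf hσ hK hM l m).star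

lemma ofReal_receiverEnergy {σ : Fin K → ℝ} (hσ : ∀ k, σ k ≠ 0) (hM : 32 * K ≤ M) (k : Fin K) :
    (receiverEnergy M σ k : ℂ) =
      ∫ X, (gram (scaledMat σ X))⁻¹ k k ∂(gaussianFamily (Fin M × Fin K)) := by
  rw [← integral_sum_zf_mul_star hσ hM, receiverEnergy, Complex.ofReal_sum]
  exact Finset.sum_congr rfl fun m _ => integral_mul_star_self.symm

lemma ofReal_relayEnergy {σ : Fin K → ℝ} (hσ : ∀ k, σ k ≠ 0) (hM : 32 * K ≤ M) :
    (relayEnergy M σ : ℂ) = ∑ k, ∑ l, ∫ X, (gram (scaledMat σ X))⁻¹ k l *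
      (gram (scaledMat σ X))⁻¹ (k + 1) (l + 1) ∂(gaussianFamily (Fin M × Fin K)) := by
  have hK : 0 < K := Nat.pos_of_neZero K
  have hR := memLp_relayMat hσ hM
  have hQ := memLp_two_inv_gram_scaledMat hσ hK hM
  simp only [relayEnergy, Complex.ofReal_sum, ← integral_mul_star_self]
  rw [← integral_sum_sum fun m n => integrable_mul_star (hR m n) (hR m n),
    ← integral_sum_sum fun k l => integrable_mul_fun (hQ k l) (hQ (k + 1) (l + 1))]
  refine integral_congr_ae ?_
  filter_upwards [ae_isUnit_det_gram_scaledMat hσ hK (by omega : K ≤ M)] with X hX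
  exact sum_relayMat_mul_star hX

lemma relayCorrelation_eq {σ : Fin K → ℝ} (hσ : ∀ k, σ k ≠ 0) (hM : 32 * K ≤ M) :
    relayCorrelation M σ = ∑ k, ∑ l, ∫ X, (gram (scaledMat σ X))⁻¹ k (l + 1) *
      (gram (scaledMat σ X))⁻¹ (k + 1) l ∂(gaussianFamily (Fin M × Fin K)) := by
  have hK : 0 < K := Nat.pos_of_neZero K
  have hR := memLp_relayMat hσ hM
  have hQ := memLp_two_inv_gram_scaledMat hσ hK hM
  rw [relayCorrelation, ← integral_sum_sum fun m n => integrable_mul_star (hR m n) (hR n m),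
    ← integral_sum_sum fun k l => integrable_mul_fun (hQ k (l + 1)) (hQ (k + 1) l)]
  refine integral_congr_ae ?_
  filter_upwards [ae_isUnit_det_gram_scaledMat hσ hK (by omega : K ≤ M)] with X hX
  exact sum_relayMat_mul_star_swap hX

lemma tendsto_sq_mul_integral_inv_gram_mul {σ : Fin K → ℝ} (hσ : ∀ k, σ k ≠ 0) (a b c d : Fin K) :
    Tendsto (fun M : ℕ => (M : ℂ) ^ 2 * ∫ X, (gram (scaledMat σ X))⁻¹ a b *
      (gram (scaledMat σ X))⁻¹ c d ∂(gaussianFamily (Fin M × Fin K))) atTop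
      (𝓝 ((1 : Matrix (Fin K) (Fin K) ℂ) a b * (1 : Matrix (Fin K) (Fin K) ℂ) c d /
        ((σ a * σ b) * (σ c * σ d)))) := by
  have hK : 0 < K := Nat.pos_of_neZero K
  refine ((tendsto_integral_normInv_mul hK a b c d).div_const _).congr fun M => ?_
  rw [← integral_div, ← integral_const_mul]
  refine integral_congr_ae (Eventually.of_forall fun X => ?_)
  simp only [inv_gram_scaledMat_apply hσ, normInv, Matrix.smul_apply, smul_eq_mul]
  ring

/-- In the limit the inverse Gram matrices are diagonal, so of the double sum only `l = k` survives.
-/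
theorem tendsto_relayEnergy {σ : Fin K → ℝ} (hσ : ∀ k, σ k ≠ 0) :
    Tendsto (fun M : ℕ => (M : ℝ) ^ 2 * relayEnergy M σ) atTop
      (𝓝 (∑ k, 1 / (σ k ^ 2 * σ (k + 1) ^ 2))) := by
  have h : Tendsto (fun M : ℕ => ∑ k, ∑ l, (M : ℂ) ^ 2 * ∫ X, (gram (scaledMat σ X))⁻¹ k l *
      (gram (scaledMat σ X))⁻¹ (k + 1) (l + 1) ∂(gaussianFamily (Fin M × Fin K))) atTop
      (𝓝 (∑ k, ∑ l, (1 : Matrix (Fin K) (Fin K) ℂ) k l *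
        (1 : Matrix (Fin K) (Fin K) ℂ) (k + 1) (l + 1) /
          ((σ k * σ l) * (σ (k + 1) * σ (l + 1))))) :=
    tendsto_finsetSum _ fun k _ => tendsto_finsetSum _ fun l _ =>
      tendsto_sq_mul_integral_inv_gram_mul hσ _ _ _ _
  have hlim : (∑ k, ∑ l, (1 : Matrix (Fin K) (Fin K) ℂ) k l *
        (1 : Matrix (Fin K) (Fin K) ℂ) (k + 1) (l + 1) /
          ((σ k * σ l) * (σ (k + 1) * σ (l + 1)) : ℂ)) =
      ((∑ k, 1 / (σ k ^ 2 * σ (k + 1) ^ 2) : ℝ) : ℂ) := by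
    push_cast
    refine Finset.sum_congr rfl fun k _ => ?_
    rw [Finset.sum_eq_single k]
    · simp; ring
    · intro l _ hl
      rw [Matrix.one_apply_ne hl.symm, zero_mul, zero_div]
    · simp
  rw [hlim] at h
  have h2 := (Complex.continuous_re.tendsto _).comp h
  rw [Complex.ofReal_re] at h2
  refine h2.congr' ?_
  filter_upwards [eventually_ge_atTop (32 * K)] with M hM
  simp only [Function.comp_apply, ← Finset.mul_sum]
  rw [← ofReal_relayEnergy hσ hM]
  norm_cast

/-- A surviving term would need `l = k + 1` and `k = l + 1`, hence `1 + 1 = 0` modulo `K`. -/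
theorem tendsto_relayCorrelation {σ : Fin K → ℝ} (hσ : ∀ k, σ k ≠ 0) (hK3 : 3 ≤ K) :
    Tendsto (fun M : ℕ => (M : ℂ) ^ 2 * relayCorrelation M σ) atTop (𝓝 0) := by
  have h : Tendsto (fun M : ℕ => ∑ k, ∑ l, (M : ℂ) ^ 2 * ∫ X, (gram (scaledMat σ X))⁻¹ k (l + 1) *
      (gram (scaledMat σ X))⁻¹ (k + 1) l ∂(gaussianFamily (Fin M × Fin K))) atTop
      (𝓝 (∑ k, ∑ l, (1 : Matrix (Fin K) (Fin K) ℂ) k (l + 1) *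
        (1 : Matrix (Fin K) (Fin K) ℂ) (k + 1) l /
          ((σ k * σ (l + 1)) * (σ (k + 1) * σ l)))) :=
    tendsto_finsetSum _ fun k _ => tendsto_finsetSum _ fun l _ =>
      tendsto_sq_mul_integral_inv_gram_mul hσ _ _ _ _
  have hlim : (∑ k, ∑ l, (1 : Matrix (Fin K) (Fin K) ℂ) k (l + 1) *
        (1 : Matrix (Fin K) (Fin K) ℂ) (k + 1) l /
          ((σ k * σ (l + 1)) * (σ (k + 1) * σ l) : ℂ)) = 0 := by
    refine Finset.sum_eq_zero fun k _ => Finset.sum_eq_zero fun l _ => ?_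
    by_cases hl : k + 1 = l
    · subst hl
      rw [Matrix.one_apply_ne (i := k), zero_mul, zero_div]
      rw [add_assoc]
      intro h
      exact one_add_one_ne_zero_of_three_le hK3 (left_eq_add.1 h)
    · rw [Matrix.one_apply_ne hl, mul_zero, zero_div]
  rw [hlim] at h
  refine h.congr' ?_
  filter_upwards [eventually_ge_atTop (32 * K)] with M hM
  rw [relayCorrelation_eq hσ hM]
  simp only [← Finset.mul_sum]

theorem tendsto_receiverEnergy {σ : Fin K → ℝ} (hσ : ∀ k, σ k ≠ 0) (k : Fin K) :
    Tendsto (fun M : ℕ => (M : ℝ) * (M * receiverEnergy M σ k - 1 / σ k ^ 2)) atTop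
      (𝓝 (K / σ k ^ 2)) := by
  have hK : 0 < K := Nat.pos_of_neZero K
  have h := (Complex.continuous_re.tendsto _).comp
    ((tendsto_integral_normInv_diag hK k).div_const ((σ k ^ 2 : ℝ) : ℂ))
  have hlim : ((K : ℂ) / ((σ k ^ 2 : ℝ) : ℂ)).re = K / σ k ^ 2 := by
    norm_cast
  rw [hlim] at h
  refine h.congr' ?_
  filter_upwards [eventually_ge_atTop (32 * K)] with M hM
  have hN : ∫ X, normInv X k k ∂(gaussianFamily (Fin M × Fin K)) =
      ((M * receiverEnergy M σ k * σ k ^ 2 : ℝ) : ℂ) := by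
    push_cast
    rw [ofReal_receiverEnergy hσ hM, mul_assoc, ← integral_mul_const, ← integral_const_mul]
    refine integral_congr_ae (Eventually.of_forall fun X => ?_)
    have : (σ k : ℂ) ≠ 0 := by exact_mod_cast hσ k
    simp only [inv_gram_scaledMat_apply hσ, normInv, Matrix.smul_apply, smul_eq_mul]
    field_simp
  simp only [Function.comp_apply]
  rw [hN]
  norm_cast
  have := hσ k
  field_simp

/-- The second moment of the deviation of the effective gain. -/
theorem moments_gainDeviation (hK3 : 3 ≤ K) {σ : Fin K → ℝ} (hσ : ∀ k, σ k ≠ 0)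
    (ε : Fin K → ℝ) (hM : 32 * K ≤ M) (k i : Fin K) :
    MemLp (fun z => gainDeviation (scaledMat σ z.1) (scaledMat ε z.2) k i) 2 (gaussianPair M K) ∧
    ∫ z, gainDeviation (scaledMat σ z.1) (scaledMat ε z.2) k i ∂(gaussianPair M K) = 0 ∧
    ∫ z, ‖gainDeviation (scaledMat σ z.1) (scaledMat ε z.2) k i‖ ^ 2 ∂(gaussianPair M K) =
      ε k ^ 2 * receiverEnergy M σ (i - 1) + ε i ^ 2 * receiverEnergy M σ (k + 1) +
        ε k ^ 2 * ε i ^ 2 * (relayEnergy M σ + if k = i then (relayCorrelation M σ).re else 0) := by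
  have hK : 0 < K := Nat.pos_of_neZero K
  -- The deviation is a linear combination with coefficients depending on the estimate: two families
  -- of error entries and one of products of two entries. Its second moment is read off from the two
  -- Gram matrices.
  set a : (Fin M ⊕ Fin M) ⊕ (Fin M × Fin M) → (Fin M × Fin K → ℂ) → ℂ := fun j X =>
    Sum.elim (Sum.elim (fun m => ε k * zf (scaledMat σ X) (i - 1) m)
      (fun m => ε i * zf (scaledMat σ X) (k + 1) m))
      (fun x => (ε k * ε i) * relayMat (scaledMat σ X) x.1 x.2) j with ha
  set Z : (Fin M ⊕ Fin M) ⊕ (Fin M × Fin M) → (Fin M × Fin K → ℂ) → ℂ := fun j E =>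
    Sum.elim (Sum.elim (fun m => E (m, k)) (fun m => E (m, i)))
      (fun x => E (x.1, k) * E (x.2, i)) j with hZ
  have hsum : ∀ z : (Fin M × Fin K → ℂ) × (Fin M × Fin K → ℂ),
      gainDeviation (scaledMat σ z.1) (scaledMat ε z.2) k i = ∑ j, a j z.1 * Z j z.2 := by
    intro z
    rw [Fintype.sum_sum_type, Fintype.sum_sum_type, gainDeviation]
    simp only [ha, hZ, Sum.elim_inl, Sum.elim_inr, scaledMat_apply]
    congr 1
    · congr 1 <;> exact Finset.sum_congr rfl fun m _ => by ring
    · exact Finset.sum_congr rfl fun m _ => by ring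
  have ham : ∀ j, Measurable (a j) := by
    rintro ((m | m) | x)
    exacts [(measurable_zf_apply σ _ m).const_mul _, (measurable_zf_apply σ _ m).const_mul _,
      (measurable_relayMat_apply σ _ _).const_mul _]
  have hZm : ∀ j, Measurable (Z j) := by
    rintro ((m | m) | x)
    exacts [measurable_pi_apply _, measurable_pi_apply _,
      (measurable_pi_apply _).mul (measurable_pi_apply _)]
  have haL' : ∀ j, MemLp (a j) 2 (gaussianFamily (Fin M × Fin K)) := by
    rintro ((m | m) | x)
    exacts [(memLp_two_zf hσ hK hM _ m).const_mul _, (memLp_two_zf hσ hK hM _ m).const_mul _,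
      (memLp_relayMat hσ hM _ _).const_mul _]
  have haL : ∀ j, MemLp (fun z => a j z.1) 2 (gaussianPair M K) := fun j =>
    (haL' j).comp_measurePreserving measurePreserving_fst
  have hZL' : ∀ j, HasAllMoments (Z j) (gaussianFamily (Fin M × Fin K)) := by
    rintro ((m | m) | x)
    exacts [hasAllMoments_eval _, hasAllMoments_eval _,
      (hasAllMoments_eval _).mul (hasAllMoments_eval _)]
  have hZL : ∀ j, MemLp (fun z => Z j z.2) 2 (gaussianPair M K) := fun j =>
    (hZL' j 2 (by simp)).comp_measurePreserving measurePreserving_snd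
  simp_rw [hsum]
  refine ⟨memLp_two_combination (indepFun_gaussianPair M K) ham hZm haL hZL, ?_, ?_⟩
  · rw [integral_combination measurable_fst measurable_snd (indepFun_gaussianPair M K) ham hZm
      haL hZL]
    refine Finset.sum_eq_zero fun j _ => ?_
    rw [integral_snd_gaussianPair (f := Z j) (hZm j).aestronglyMeasurable]
    rcases j with (m | m) | x
    · simp only [hZ, Sum.elim_inl, integral_eval, mul_zero]
    · simp only [hZ, Sum.elim_inl, Sum.elim_inr, integral_eval, mul_zero]
    · simp only [hZ, Sum.elim_inr, integral_mul_eval, mul_zero]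
  · have h := integral_norm_sq_combination measurable_fst measurable_snd
      (indepFun_gaussianPair M K) ham hZm haL hZL
    have hA : ∀ j l, ∫ z, a j z.1 * star (a l z.1) ∂(gaussianPair M K) =
        ∫ X, a j X * star (a l X) ∂(gaussianFamily (Fin M × Fin K)) := fun j l =>
      integral_fst_gaussianPair (f := fun X => a j X * star (a l X))
        ((ham j).mul (continuous_star.measurable.comp (ham l))).aestronglyMeasurable
    have hB : ∀ j l, ∫ z, Z j z.2 * star (Z l z.2) ∂(gaussianPair M K) =
        ∫ X, Z j X * star (Z l X) ∂(gaussianFamily (Fin M × Fin K)) := fun j l =>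
      integral_snd_gaussianPair (f := fun X => Z j X * star (Z l X))
        ((hZm j).mul (continuous_star.measurable.comp (hZm l))).aestronglyMeasurable
    simp only [hA, hB] at h
    have flip : ∀ i j k : Fin M × Fin K,
        ∫ x, (x j * x k) * star (x i) ∂(gaussianFamily (Fin M × Fin K)) = 0 := by
      intro i j k
      have h0 := integral_mul_star_mul_eval i j k
      have h1 := integral_conj (μ := gaussianFamily (Fin M × Fin K))
          (f := fun x => x i * star (x j * x k))
      rw [h0, map_zero] at h1
      rw [← h1]
      refine integral_congr_ae (Eventually.of_forall fun x => ?_)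
      simp only [map_mul, Complex.star_def, Complex.conj_conj]
      ring
    have hzf : ∀ l, ∑ m : Fin M, ∫ X, zf (scaledMat σ X) l m * star (zf (scaledMat σ X) l m)
        ∂(gaussianFamily (Fin M × Fin K)) = (receiverEnergy M σ l : ℂ) := fun l => by
      simp only [receiverEnergy, Complex.ofReal_sum, ← integral_mul_star_self]
    have hR1 : ∑ x : Fin M × Fin M, ∫ X, relayMat (scaledMat σ X) x.1 x.2 *
        star (relayMat (scaledMat σ X) x.1 x.2) ∂(gaussianFamily (Fin M × Fin K)) =
          (relayEnergy M σ : ℂ) := by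
      simp only [relayEnergy, Complex.ofReal_sum, ← integral_mul_star_self, Fintype.sum_prod_type]
    have hR2 : ∑ x : Fin M × Fin M, ∫ X, relayMat (scaledMat σ X) x.1 x.2 *
        star (relayMat (scaledMat σ X) x.2 x.1) ∂(gaussianFamily (Fin M × Fin K)) =
          relayCorrelation M σ := by
      simp only [relayCorrelation, Fintype.sum_prod_type]
    have hstar : ∀ r : ℝ, star (r : ℂ) = r := fun r => Complex.conj_ofReal r
    have hstar2 : ∀ r s : ℝ, star ((r : ℂ) * s) = r * s := fun r s => by
      rw [← Complex.ofReal_mul, hstar]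
    -- For `k = i` the two linear families use the same error entries. Their correlation is the mean
    -- of an off-diagonal inverse Gram entry, which vanishes since `k - 1 ≠ k + 1`.
    have hcross : k = i → ∀ a b : Fin K, (a = k - 1 ∧ b = k + 1 ∨ a = k + 1 ∧ b = k - 1) →
        ∑ m : Fin M, ∫ X, zf (scaledMat σ X) a m * star (zf (scaledMat σ X) b m)
          ∂(gaussianFamily (Fin M × Fin K)) = 0 := by
      intro _ a b hab
      have hne : a ≠ b := by
        rcases hab with ⟨rfl, rfl⟩ | ⟨rfl, rfl⟩
        exacts [sub_one_ne_add_one hK3 k, (sub_one_ne_add_one hK3 k).symm]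
      rw [integral_sum_zf_mul_star hσ hM]
      simp only [inv_gram_scaledMat_apply hσ]
      rw [integral_div, integral_inv_gram_offDiag hne, zero_div]
    have hval : ((∫ z, ‖∑ j, a j z.1 * Z j z.2‖ ^ 2 ∂(gaussianPair M K) : ℝ) : ℂ) =
        ((ε k ^ 2 * receiverEnergy M σ (i - 1) + ε i ^ 2 * receiverEnergy M σ (k + 1) +
          ε k ^ 2 * ε i ^ 2 * relayEnergy M σ : ℝ) : ℂ) +
        ((ε k ^ 2 * ε i ^ 2 : ℝ) : ℂ) * if k = i then relayCorrelation M σ else 0 := by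
      rw [h]
      simp only [Fintype.sum_sum_type, ha, hZ, Sum.elim_inl, Sum.elim_inr, flip,
        integral_mul_star_mul_eval, integral_mul_star_eval, integral_mul_mul_star_mul_eval,
        mul_zero, Finset.sum_const_zero, add_zero, zero_add, integral_const_mul_mul_star,
        Prod.mk.injEq, and_true, hstar, hstar2, ← Prod.ext_iff, mul_add,
        Finset.sum_add_distrib, mul_ite, mul_one, Finset.sum_ite_eq, Finset.mem_univ, if_true]
      -- For `k = i` the products indexed by `(m, n)` and `(n, m)` are equal. This second pairing in
      -- the fourth moments produces `relayCorrelation`.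
      have hsw : ∀ x y : Fin M × Fin M, (x.1 = y.2 ∧ x.2 = y.1) ↔ (x.2, x.1) = y := fun x y => by
        rw [Prod.ext_iff]; exact and_comm
      by_cases hki : k = i
      · have hc := hcross hki
        subst hki
        simp only [and_true, if_true, hsw, Finset.sum_ite_eq, Finset.mem_univ, ← Finset.mul_sum,
          hzf, hR1, hR2, hc (k - 1) (k + 1) (by simp), hc (k + 1) (k - 1) (by simp)]
        push_cast
        ring
      · simp only [hki, Ne.symm hki, and_false, if_false, Finset.sum_const_zero,
          ← Finset.mul_sum, hzf, hR1]
        push_cast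
        ring
    have hre := congrArg Complex.re hval
    rw [Complex.ofReal_re, Complex.add_re, Complex.ofReal_re, Complex.re_ofReal_mul] at hre
    rw [hre]
    split_ifs
    · ring
    · rw [Complex.zero_re]
      ring

end GainMoments

/-! ### Row-wise linear maps of Gaussian matrices -/

section RowMap

variable {N I J L : Type*} [Fintype J]

/-- Apply a matrix to each row of a family indexed by rows and columns. -/
def rowMap (A : Matrix I J ℂ) (x : N × J → ℂ) : N × I → ℂ := fun q => ∑ j, A q.2 j * x (q.1, j)

lemma measurable_rowMap (A : Matrix I J ℂ) : Measurable (rowMap (N := N) A) := by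
  refine measurable_pi_lambda _ fun q => ?_
  simp only [rowMap]
  exact Finset.measurable_sum _ fun j _ =>
    Measurable.const_mul (f := fun x : N × J → ℂ => x (q.1, j)) (measurable_pi_apply _) _

lemma rowMap_mul [Fintype L] (A : Matrix I J ℂ) (B : Matrix J L ℂ) (x : N × L → ℂ) :
    rowMap (A * B) x = rowMap A (rowMap B x) := by
  ext q
  simp only [rowMap, Matrix.mul_apply, Finset.sum_mul, Finset.mul_sum]
  rw [Finset.sum_comm]
  exact Finset.sum_congr rfl fun j _ => Finset.sum_congr rfl fun l _ => by ring

/-- Acting on all rows at once is the matrix `1 ⊗ A`, a co-isometry whenever `A` is one. -/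
lemma rowMap_eq_kronecker_mulVec [Fintype N] [DecidableEq N] (A : Matrix I J ℂ) (x : N × J → ℂ) :
    rowMap A x = (kroneckerMap (· * ·) (1 : Matrix N N ℂ) A) *ᵥ x := by
  ext q
  simp only [rowMap, Matrix.mulVec, dotProduct, kroneckerMap_apply, Fintype.sum_prod_type]
  rw [Finset.sum_eq_single q.1]
  · simp
  · intro n _ hn
    simp [Matrix.one_apply_ne (Ne.symm hn)]
  · simp

lemma measurePreserving_rowMap [Fintype N] [Fintype I] [DecidableEq N] [DecidableEq I]
    {A : Matrix I J ℂ}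
    (hA : A * Aᴴ = 1) :
    MeasurePreserving (rowMap (N := N) A) (gaussianFamily (N × J)) (gaussianFamily (N × I)) := by
  refine ⟨measurable_rowMap A, ?_⟩
  have h := map_mulVec_gaussianFamily (kroneckerMap (· * ·) (1 : Matrix N N ℂ) A) (by
    rw [conjTranspose_kronecker, ← mul_kronecker_mul, hA, conjTranspose_one, Matrix.mul_one,
      one_kronecker_one])
  simp only [← rowMap_eq_kronecker_mulVec] at h
  exact h

/-- The reflection along the rows of a co-isometry is unitary. -/
lemma reflection_mul_conjTranspose [Fintype I] [DecidableEq I] [DecidableEq J] {A : Matrix I J ℂ}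
    (hA : A * Aᴴ = 1) :
    (1 - (2 : ℂ) • (Aᴴ * A)) * (1 - (2 : ℂ) • (Aᴴ * A))ᴴ = 1 := by
  have h1 : (1 - (2 : ℂ) • (Aᴴ * A))ᴴ = 1 - (2 : ℂ) • (Aᴴ * A) := by
    simp [conjTranspose_sub, conjTranspose_smul, conjTranspose_mul]
  have h2 : (Aᴴ * A) * (Aᴴ * A) = Aᴴ * A := by
    rw [Matrix.mul_assoc, ← Matrix.mul_assoc A, hA, Matrix.one_mul]
  rw [h1, sub_mul, mul_sub, mul_sub, Matrix.one_mul, Matrix.mul_one, Matrix.one_mul,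
    Matrix.smul_mul, Matrix.mul_smul, h2, smul_smul]
  module

/-- If the rows of `B` are orthogonal to those of the co-isometry `A`, then `A x` has mean zero
conditionally on `B x`. -/
lemma setIntegral_rowMap_eq_zero [Fintype N] [Fintype I] [DecidableEq N] [DecidableEq I]
    [DecidableEq J]
    {A : Matrix I J ℂ} {B : Matrix L J ℂ}
    (hA : A * Aᴴ = 1) (hB : B * Aᴴ = 0) {s : Set (N × L → ℂ)} (hs : MeasurableSet s) (q : N × I) :
    ∫ x in rowMap B ⁻¹' s, rowMap A x q ∂(gaussianFamily (N × J)) = 0 := by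
  have hmp := measurePreserving_rowMap (N := N) (reflection_mul_conjTranspose hA)
  have hAT : A * (1 - (2 : ℂ) • (Aᴴ * A)) = -A := by
    rw [Matrix.mul_sub, Matrix.mul_one, Matrix.mul_smul, ← Matrix.mul_assoc, hA, Matrix.one_mul]
    module
  have hBT : B * (1 - (2 : ℂ) • (Aᴴ * A)) = B := by
    rw [Matrix.mul_sub, Matrix.mul_one, Matrix.mul_smul, ← Matrix.mul_assoc, hB, Matrix.zero_mul,
      smul_zero, sub_zero]
  have hset : MeasurableSet (rowMap (N := N) B ⁻¹' s) := measurable_rowMap B hs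
  rw [← integral_indicator hset]
  have hm : Measurable (Set.indicator (rowMap (N := N) B ⁻¹' s) fun x => rowMap A x q) :=
    ((measurable_pi_apply q).comp (measurable_rowMap A)).indicator hset
  have h := integral_comp_of_measurePreserving hmp hm.aestronglyMeasurable
  -- The reflection `1 - 2 AᴴA` fixes `B x`, hence the event, and sends `A x` to `-A x`.
  have hneg : ∀ x : N × J → ℂ, Set.indicator (rowMap (N := N) B ⁻¹' s) (fun x => rowMap A x q)
      (rowMap (1 - (2 : ℂ) • (Aᴴ * A)) x) =
        -Set.indicator (rowMap (N := N) B ⁻¹' s) (fun x => rowMap A x q) x := by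
    intro x
    have hmem : rowMap (1 - (2 : ℂ) • (Aᴴ * A)) x ∈ rowMap B ⁻¹' s ↔ x ∈ rowMap B ⁻¹' s := by
      rw [Set.mem_preimage, ← rowMap_mul, hBT, Set.mem_preimage]
    by_cases hx : x ∈ rowMap B ⁻¹' s
    · rw [Set.indicator_of_mem hx, Set.indicator_of_mem (hmem.2 hx), ← rowMap_mul, hAT]
      simp [rowMap]
    · rw [Set.indicator_of_notMem hx, Set.indicator_of_notMem (mt hmem.1 hx), neg_zero]
  simp only [hneg, integral_neg] at h
  exact CharZero.neg_eq_self_iff.1 h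

end RowMap

/-! ### The channel estimate -/

lemma iIndepFun.indepFun_precomp {Ω ι I J : Type*} [MeasurableSpace Ω] {P : Measure Ω}
    {β : Type*} [MeasurableSpace β] [Fintype I] [Fintype J]
    {X : ι → Ω → β} (h : iIndepFun X P) (hX : ∀ i, Measurable (X i)) (f : I → ι) (g : J → ι)
    (hfg : ∀ i j, f i ≠ g j) :
    IndepFun (fun ω i => X (f i) ω) (fun ω j => X (g j) ω) P := by
  classical
  have hd : Disjoint (Finset.univ.image f) (Finset.univ.image g) := by
    rw [Finset.disjoint_left]
    intro a ha hb
    obtain ⟨i, -, rfl⟩ := Finset.mem_image.1 ha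
    obtain ⟨j, -, hj⟩ := Finset.mem_image.1 hb
    exact hfg i j hj.symm
  have h1 := h.indepFun_finset _ _ hd hX
  exact h1.comp
    (φ := fun w i => w ⟨f i, Finset.mem_image_of_mem f (Finset.mem_univ i)⟩)
    (ψ := fun w j => w ⟨g j, Finset.mem_image_of_mem g (Finset.mem_univ j)⟩)
    (measurable_pi_lambda _ fun i => measurable_pi_apply _)
    (measurable_pi_lambda _ fun j => measurable_pi_apply _)

section Estimate

variable {K : ℕ} (p : Params K)

/-- The cosine of the angle between channel and estimate. -/
def estCos (k : Fin K) : ℝ := Real.sqrt (p.τ * p.Pp * p.β k / (p.τ * p.Pp * p.β k + 1))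

/-- The sine of the angle between channel and estimate. -/
def estSin (k : Fin K) : ℝ := Real.sqrt (1 / (p.τ * p.Pp * p.β k + 1))

/-- The amplitude of the channel estimate. -/
def estAmp (k : Fin K) : ℝ := Real.sqrt (p.β k) * estCos p k

/-- The amplitude of the estimation error. -/
def errAmp (k : Fin K) : ℝ := Real.sqrt (p.β k) * estSin p k

variable {p}

lemma training_nonneg (hp : p.Admissible) (k : Fin K) : 0 ≤ p.τ * p.Pp * p.β k := by
  have := hp.Pp_pos
  have := hp.β_pos k
  positivity

lemma training_pos (hp : p.Admissible) (k : Fin K) : 0 < p.τ * p.Pp * p.β k := by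
  have h1 := hp.Pp_pos
  have h2 := hp.β_pos k
  -- With `τ = 0` the diagonal entry of `Φ Φᴴ` would be an empty sum, not `1`.
  have h3 : 0 < p.τ := by
    rcases Nat.eq_zero_or_pos p.τ with h | h
    · have h4 := congrFun (congrFun hp.pilots k) k
      have : IsEmpty (Fin p.τ) := by rw [h]; infer_instance
      rw [Matrix.mul_apply, Finset.univ_eq_empty, Finset.sum_empty, Matrix.one_apply_eq] at h4
      exact absurd h4 zero_ne_one
    · exact h
  positivity

lemma estCos_sq_add_estSin_sq (hp : p.Admissible) (k : Fin K) :
    estCos p k ^ 2 + estSin p k ^ 2 = 1 := by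
  have h := training_nonneg hp k
  rw [estCos, estSin, Real.sq_sqrt (by positivity), Real.sq_sqrt (by positivity)]
  field_simp

lemma estAmp_sq (hp : p.Admissible) (k : Fin K) : estAmp p k ^ 2 = estVar p k := by
  have h := training_nonneg hp k
  rw [estAmp, mul_pow, estCos, Real.sq_sqrt (hp.β_pos k).le, Real.sq_sqrt (by positivity), estVar]
  ring

lemma errAmp_sq (hp : p.Admissible) (k : Fin K) : errAmp p k ^ 2 = errVar p k := by
  have h := training_nonneg hp k
  rw [errAmp, mul_pow, estSin, Real.sq_sqrt (hp.β_pos k).le, Real.sq_sqrt (by positivity), errVar,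
    estVar]
  have h1 : p.τ * p.Pp * p.β k + 1 ≠ 0 := by positivity
  rw [eq_sub_iff_add_eq, mul_one_div, ← add_div, div_eq_iff h1]
  ring

lemma estVar_pos (hp : p.Admissible) (k : Fin K) : 0 < estVar p k := by
  have h := training_pos hp k
  have h2 := hp.β_pos k
  have : estVar p k = p.τ * p.Pp * p.β k * p.β k / (p.τ * p.Pp * p.β k + 1) := by
    rw [estVar]; ring
  rw [this]
  positivity

lemma estAmp_ne_zero (hp : p.Admissible) (k : Fin K) : estAmp p k ≠ 0 := by
  intro h
  have := estVar_pos hp k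
  rw [← estAmp_sq hp, h] at this
  simp at this

/-- The tangent relation that fixes the angle: it makes the error rows orthogonal to the pilot rows.
-/
lemma sqrt_training_mul_estSin (hp : p.Admissible) (k : Fin K) :
    Real.sqrt (p.τ * p.Pp) * Real.sqrt (p.β k) * estSin p k = estCos p k := by
  have h1 := hp.Pp_pos
  rw [← Real.sqrt_mul (by positivity), estSin, ← Real.sqrt_mul (training_nonneg hp k), estCos]
  congr 1
  ring

variable (p)

/-- Rows that combine the fading of a user with the correspondingly despread training noise. -/
def despreadRows (u v : Fin K → ℝ) : Matrix (Fin K) (Fin K ⊕ Fin p.τ) ℂ :=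
  fromCols (diagonal fun k => (u k : ℂ)) (diagonal (fun k => (v k : ℂ)) * p.Φ.map star)

/-- The rows that map fading and training noise to the normalized estimate. -/
abbrev estRows : Matrix (Fin K) (Fin K ⊕ Fin p.τ) ℂ := despreadRows p (estCos p) (estSin p)

/-- The rows that map fading and training noise to the normalized error. -/
abbrev errRows : Matrix (Fin K) (Fin K ⊕ Fin p.τ) ℂ :=
  despreadRows p (estSin p) fun k => -estCos p k

/-- The rows that map fading and training noise to the pilot signal. -/
def pilotRows : Matrix (Fin p.τ) (Fin K ⊕ Fin p.τ) ℂ :=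
  fromCols (p.Φᵀ * diagonal fun k => ((Real.sqrt (p.τ * p.Pp) * Real.sqrt (p.β k) : ℝ) : ℂ)) 1

variable {p}

lemma pilots_conj (hp : p.Admissible) : p.Φ.map star * p.Φᵀ = 1 := by
  have h := congrArg transpose hp.pilots
  rw [Matrix.transpose_mul, Matrix.transpose_one] at h
  exact h

lemma conjTranspose_diagonal_ofReal (u : Fin K → ℝ) :
    (diagonal fun k => (u k : ℂ))ᴴ = diagonal fun k => (u k : ℂ) := by
  rw [Matrix.diagonal_conjTranspose]
  congr 1
  ext k
  simp

lemma conjTranspose_despreadRows (u v : Fin K → ℝ) :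
    (despreadRows p u v)ᴴ =
      fromRows (diagonal fun k => (u k : ℂ)) (p.Φᵀ * diagonal fun k => (v k : ℂ)) := by
  rw [despreadRows, conjTranspose_fromCols_eq_fromRows_conjTranspose, conjTranspose_mul,
    conjTranspose_diagonal_ofReal, conjTranspose_diagonal_ofReal]
  congr 2
  ext i j
  simp

/-- Orthonormality of the pilots collapses the noise block. Orthogonality of all rows below becomes
`cos² + sin² = 1` and `sin cos - cos sin = 0`. -/
lemma despreadRows_mul_conjTranspose (hp : p.Admissible) (u v u' v' : Fin K → ℝ) :
    despreadRows p u v * (despreadRows p u' v')ᴴ =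
      diagonal fun k => ((u k * u' k + v k * v' k : ℝ) : ℂ) := by
  rw [conjTranspose_despreadRows, despreadRows, fromCols_mul_fromRows, diagonal_mul_diagonal,
    Matrix.mul_assoc, ← Matrix.mul_assoc (p.Φ.map star), pilots_conj hp, Matrix.one_mul,
    diagonal_mul_diagonal, diagonal_add]
  congr 1
  ext k
  push_cast
  rfl

lemma errRows_mul_conjTranspose (hp : p.Admissible) : errRows p * (errRows p)ᴴ = 1 := by
  rw [despreadRows_mul_conjTranspose hp, ← diagonal_one]
  congr 1
  ext k
  rw [← Complex.ofReal_one, ← estCos_sq_add_estSin_sq hp k]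
  congr 1
  ring

/-- A joint co-isometry makes normalized estimate and error jointly standard Gaussian, hence
independent of each other. -/
lemma fromRows_mul_conjTranspose (hp : p.Admissible) :
    fromRows (estRows p) (errRows p) * (fromRows (estRows p) (errRows p))ᴴ = 1 := by
  have h1 : estRows p * (estRows p)ᴴ = 1 := by
    rw [despreadRows_mul_conjTranspose hp, ← diagonal_one]
    congr 1
    ext k
    rw [← Complex.ofReal_one, ← estCos_sq_add_estSin_sq hp k]
    congr 1
    ring
  have h2 : estRows p * (errRows p)ᴴ = 0 := by
    rw [despreadRows_mul_conjTranspose hp, ← diagonal_zero]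
    congr 1
    ext k
    rw [← Complex.ofReal_zero]
    congr 1
    ring
  have h3 : errRows p * (estRows p)ᴴ = 0 := by
    rw [despreadRows_mul_conjTranspose hp, ← diagonal_zero]
    congr 1
    ext k
    rw [← Complex.ofReal_zero]
    congr 1
    ring
  rw [conjTranspose_fromRows_eq_fromCols_conjTranspose, fromRows_mul_fromCols, h1, h2, h3,
    errRows_mul_conjTranspose hp, fromBlocks_one]

lemma pilotRows_mul_errRows (hp : p.Admissible) : pilotRows p * (errRows p)ᴴ = 0 := by
  rw [conjTranspose_despreadRows, pilotRows, fromCols_mul_fromRows, Matrix.one_mul,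
    Matrix.mul_assoc, diagonal_mul_diagonal, ← Matrix.mul_add, diagonal_add]
  have h : (fun k => ((Real.sqrt (p.τ * p.Pp) * Real.sqrt (p.β k) : ℝ) : ℂ) * (estSin p k : ℂ) +
      ((-estCos p k : ℝ) : ℂ)) = fun _ => 0 := by
    ext k
    rw [← Complex.ofReal_mul, sqrt_training_mul_estSin hp, ← Complex.ofReal_add]
    simp
  rw [h, diagonal_zero, Matrix.mul_zero]

/-- The estimate is a linear function of the pilot signal alone, which gives its measurability for
the conditional expectation. -/
lemma estRows_eq (hp : p.Admissible) :
    estRows p = diagonal (fun k => (estSin p k : ℂ)) * p.Φ.map star * pilotRows p := by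
  rw [pilotRows, mul_fromCols, Matrix.mul_one, Matrix.mul_assoc, ← Matrix.mul_assoc (p.Φ.map star),
    pilots_conj hp, Matrix.one_mul, diagonal_mul_diagonal, estRows, despreadRows]
  congr 2
  ext k
  rw [← Complex.ofReal_mul, mul_comm, sqrt_training_mul_estSin hp]

end Estimate

/-! ### The law of estimate and error, and the conditional mean of the channel -/

section Model

variable {M K : ℕ} {Ω : Type*}

/-- The position of an entry of fading and training noise in the family of all sources. -/
def trainingIndex {τ : ℕ} : Fin M × (Fin K ⊕ Fin τ) →
    (Fin M × Fin K) ⊕ (Fin M × Fin τ) ⊕ Fin K ⊕ Fin M ⊕ Fin K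
  | (m, .inl k) => .inl (m, k)
  | (m, .inr t) => .inr (.inl (m, t))

lemma trainingIndex_injective {τ : ℕ} :
    Function.Injective (trainingIndex (M := M) (K := K) (τ := τ)) := by
  rintro ⟨m, k | t⟩ ⟨n, l | s⟩ h <;> simp_all [trainingIndex]

/-- Fading and training noise as one family. -/
def trainingSources {τ : ℕ} (S : Sources M K τ Ω) (ω : Ω) : Fin M × (Fin K ⊕ Fin τ) → ℂ :=
  fun j => S.family (trainingIndex j) ω

/-- Data symbols and the noise of both transmission phases as one family. -/
def payload {τ : ℕ} (S : Sources M K τ Ω) (ω : Ω) : Fin K ⊕ Fin M ⊕ Fin K → ℂ :=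
  fun j => S.family (.inr (.inr j)) ω

/-- The normalized channel estimate and estimation error. -/
def normalizedPair (p : Params K) (S : Sources M K p.τ Ω) (ω : Ω) :
    (Fin M × Fin K → ℂ) × (Fin M × Fin K → ℂ) :=
  (rowMap (estRows p) (trainingSources S ω), rowMap (errRows p) (trainingSources S ω))

lemma rowMap_despreadRows (p : Params K) (S : Sources M K p.τ Ω) (u v : Fin K → ℝ) (ω : Ω)
    (m : Fin M) (k : Fin K) :
    rowMap (despreadRows p u v) (trainingSources S ω) (m, k) =
      u k * S.H ω m k + v k * ∑ t, star (p.Φ k t) * S.Np ω m t := by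
  rw [rowMap, Fintype.sum_sum_type]
  simp only [despreadRows, fromCols_apply_inl, fromCols_apply_inr, diagonal_mul, Matrix.map_apply,
    trainingSources, trainingIndex, Sources.family]
  congr 1
  · rw [Finset.sum_eq_single k]
    · rw [diagonal_apply_eq]
    · intro l _ hl
      rw [diagonal_apply_ne _ (Ne.symm hl), zero_mul]
    · simp
  · rw [Finset.mul_sum]
    exact Finset.sum_congr rfl fun t _ => mul_assoc _ _ _

lemma pilotSignal_apply (p : Params K) (S : Sources M K p.τ Ω) (ω : Ω) (j : Fin M × Fin p.τ) :
    pilotSignal p S ω j.1 j.2 = rowMap (pilotRows p) (trainingSources S ω) j := by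
  rw [rowMap, Fintype.sum_sum_type]
  simp only [pilotRows, fromCols_apply_inl, fromCols_apply_inr,
    trainingSources, trainingIndex, Sources.family, pilotSignal, Matrix.add_apply,
    Matrix.smul_apply, channel, mul_diagonal, smul_eq_mul, transpose_apply]
  congr 1
  · rw [Matrix.mul_apply, Finset.mul_sum]
    refine Finset.sum_congr rfl fun k _ => ?_
    rw [mul_diagonal]
    push_cast
    ring
  · simp [Matrix.one_apply]

/-- Undoes the rotation: `cos (cos h + sin n) + sin (sin h - cos n) = h`. -/
lemma channel_eq {p : Params K} (hp : p.Admissible) (S : Sources M K p.τ Ω) (ω : Ω) :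
    channel p S ω = scaledMat (estAmp p) (normalizedPair p S ω).1 +
      scaledMat (errAmp p) (normalizedPair p S ω).2 := by
  ext m k
  rw [Matrix.add_apply, scaledMat_apply, scaledMat_apply, channel, mul_diagonal, estAmp, errAmp]
  simp only [normalizedPair, rowMap_despreadRows]
  have h : (estCos p k : ℂ) ^ 2 + (estSin p k : ℂ) ^ 2 = 1 := by
    exact_mod_cast estCos_sq_add_estSin_sq hp k
  push_cast
  linear_combination -(S.H ω m k * (Real.sqrt (p.β k) : ℂ)) * h

variable [MeasurableSpace Ω] {P : Measure Ω}

lemma measurable_payload {τ : ℕ} {S : Sources M K τ Ω} (hS : S.IsModel P) :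
    Measurable (payload S) := measurable_pi_lambda _ fun _ => hS.measurable _

lemma measurePreserving_trainingSources [IsProbabilityMeasure P] {τ : ℕ} {S : Sources M K τ Ω}
    (hS : S.IsModel P) :
    MeasurePreserving (trainingSources S) P (gaussianFamily (Fin M × (Fin K ⊕ Fin τ))) := by
  refine ⟨measurable_pi_lambda _ fun _ => hS.measurable _, ?_⟩
  have h := (hS.indep.precomp trainingIndex_injective).map_fun_eq_pi_map
    fun j => (hS.measurable (trainingIndex j)).aemeasurable
  refine h.trans (congrArg Measure.pi (funext fun j => ?_))
  rcases j with ⟨m, k | t⟩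
  exacts [hS.law_H m k, hS.law_Np m t]

lemma measurePreserving_split (M K : ℕ) :
    MeasurePreserving (fun x : Fin M × (Fin K ⊕ Fin K) → ℂ =>
      ((fun q => x (q.1, .inl q.2), fun q => x (q.1, .inr q.2)) :
        (Fin M × Fin K → ℂ) × (Fin M × Fin K → ℂ)))
      (gaussianFamily (Fin M × (Fin K ⊕ Fin K))) (gaussianPair M K) := by
  let g : (Fin M × Fin K) ⊕ (Fin M × Fin K) → Fin M × (Fin K ⊕ Fin K) :=
    Sum.elim (fun q => (q.1, .inl q.2)) fun q => (q.1, .inr q.2)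
  have hg : Function.Injective g := by
    rintro (⟨m, k⟩ | ⟨m, k⟩) (⟨n, l⟩ | ⟨n, l⟩) h <;> simp_all [g]
  have h1 : MeasurePreserving (fun x : Fin M × (Fin K ⊕ Fin K) → ℂ => x ∘ g)
      (gaussianFamily _) (gaussianFamily ((Fin M × Fin K) ⊕ (Fin M × Fin K))) :=
    ⟨measurable_pi_lambda _ fun i => measurable_pi_apply (g i), map_precomp_gaussianFamily hg⟩
  exact (measurePreserving_sumPiEquivProdPi
    (fun _ : (Fin M × Fin K) ⊕ (Fin M × Fin K) => stdComplexGaussian)).comp h1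

lemma measurePreserving_normalizedPair [IsProbabilityMeasure P] {p : Params K}
    (hp : p.Admissible) {S : Sources M K p.τ Ω} (hS : S.IsModel P) :
    MeasurePreserving (normalizedPair p S) P (gaussianPair M K) :=
  (measurePreserving_split M K).comp
    ((measurePreserving_rowMap (fromRows_mul_conjTranspose hp)).comp
      (measurePreserving_trainingSources hS))

lemma indepFun_normalizedPair_payload {p : Params K} {S : Sources M K p.τ Ω} (hS : S.IsModel P) :
    IndepFun (normalizedPair p S) (payload S) P := by
  have h := iIndepFun.indepFun_precomp hS.indep hS.measurable
    (trainingIndex (M := M) (K := K) (τ := p.τ)) (fun j => .inr (.inr j)) (by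
      rintro ⟨m, k | t⟩ j <;> simp [trainingIndex])
  exact h.comp (φ := fun x => (rowMap (estRows p) x, rowMap (errRows p) x)) (ψ := id)
    ((measurable_rowMap _).prodMk (measurable_rowMap _)) measurable_id

lemma setIntegral_normalizedPair_snd [IsProbabilityMeasure P] {p : Params K}
    (hp : p.Admissible) {S : Sources M K p.τ Ω} (hS : S.IsModel P) (q : Fin M × Fin K)
    {s : Set Ω} (hs : MeasurableSet[pilotSigmaAlgebra p S] s) :
    ∫ ω in s, (normalizedPair p S ω).2 q ∂P = 0 := by
  obtain ⟨t, ht, rfl⟩ := hs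
  have hmp := measurePreserving_trainingSources hS
  have hpre : (fun ω (j : Fin M × Fin p.τ) => pilotSignal p S ω j.1 j.2) ⁻¹' t =
      trainingSources S ⁻¹' (rowMap (pilotRows p) ⁻¹' t) := by
    ext ω
    simp only [Set.mem_preimage]
    rw [show (fun j : Fin M × Fin p.τ => pilotSignal p S ω j.1 j.2) =
      rowMap (pilotRows p) (trainingSources S ω) from funext fun j => pilotSignal_apply p S ω j]
  have hm : MeasurableSet (rowMap (N := Fin M) (pilotRows p) ⁻¹' t) := measurable_rowMap _ ht
  rw [hpre, ← setIntegral_rowMap_eq_zero (N := Fin M) (errRows_mul_conjTranspose hp)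
    (pilotRows_mul_errRows hp) ht q, ← hmp.map_eq, setIntegral_map hm _ hmp.measurable.aemeasurable]
  · rfl
  · exact ((measurable_pi_apply q).comp (measurable_rowMap _)).aestronglyMeasurable

lemma integrable_normalizedPair [IsProbabilityMeasure P] {p : Params K}
    (hp : p.Admissible) {S : Sources M K p.τ Ω} (hS : S.IsModel P) (q : Fin M × Fin K) :
    Integrable (fun ω => (normalizedPair p S ω).1 q) P ∧
      Integrable (fun ω => (normalizedPair p S ω).2 q) P := by
  have h := measurePreserving_normalizedPair hp hS
  have h1 : MemLp (fun x : Fin M × Fin K → ℂ => x q) 1 (gaussianFamily (Fin M × Fin K)) :=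
    hasAllMoments_eval q 1 (by simp)
  exact ⟨((h1.comp_measurePreserving (measurePreserving_fst.comp h))).integrable le_rfl,
    ((h1.comp_measurePreserving (measurePreserving_snd.comp h))).integrable le_rfl⟩

/-- The conditional mean of the channel given the pilot signal. -/
theorem ae_estimate_eq [IsProbabilityMeasure P] {p : Params K}
    (hp : p.Admissible) {S : Sources M K p.τ Ω} (hS : S.IsModel P) :
    ∀ᵐ ω ∂P, estimate P p S ω = scaledMat (estAmp p) (normalizedPair p S ω).1 := by
  have key : ∀ m k, ∀ᵐ ω ∂P, estAmp p k * (normalizedPair p S ω).1 (m, k) =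
      estimate P p S ω m k := by
    intro m k
    have hi := integrable_normalizedPair hp hS (m, k)
    have hch : (fun ω => channel p S ω m k) = fun ω =>
        (estAmp p k : ℂ) * (normalizedPair p S ω).1 (m, k) +
          errAmp p k * (normalizedPair p S ω).2 (m, k) := by
      ext ω
      rw [channel_eq hp]
      rfl
    have hi1 := hi.1.const_mul (estAmp p k : ℂ)
    have hi2 := hi.2.const_mul (errAmp p k : ℂ)
    have hY : Measurable fun ω (j : Fin M × Fin p.τ) => pilotSignal p S ω j.1 j.2 := by
      simp only [pilotSignal_apply]
      exact (measurable_rowMap _).comp (measurePreserving_trainingSources hS).measurable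
    have hle : pilotSigmaAlgebra p S ≤ (inferInstance : MeasurableSpace Ω) := hY.comap_le
    -- The conditional expectation is identified by its integrals over pilot events, where the error
    -- contributes zero, and by measurability with respect to the pilot signal.
    refine ae_eq_condExp_of_forall_setIntegral_eq hle (f := fun ω => channel p S ω m k) ?_
      (fun s _ _ => hi1.integrableOn) (fun s hs _ => ?_) ?_
    · rw [hch]; exact hi1.add hi2
    · rw [hch, integral_add hi1.integrableOn hi2.integrableOn, integral_const_mul (errAmp p k : ℂ),
        setIntegral_normalizedPair_snd hp hS (m, k) hs, mul_zero, add_zero]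
    · have h1 : (fun ω => (estAmp p k : ℂ) * (normalizedPair p S ω).1 (m, k)) =
          (fun y => (estAmp p k : ℂ) *
            rowMap (diagonal (fun k => (estSin p k : ℂ)) * p.Φ.map star) y (m, k)) ∘
          fun ω (j : Fin M × Fin p.τ) => pilotSignal p S ω j.1 j.2 := by
        ext ω
        simp only [Function.comp_apply, normalizedPair]
        rw [estRows_eq hp, rowMap_mul]
        congr 3
        exact funext fun j => (pilotSignal_apply p S ω j).symm
      rw [h1]
      have h2 : Measurable fun y : Fin M × Fin p.τ → ℂ => (estAmp p k : ℂ) *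
          rowMap (diagonal (fun k => (estSin p k : ℂ)) * p.Φ.map star) y (m, k) :=
        ((measurable_pi_apply _).comp (measurable_rowMap _)).const_mul _
      exact (h2.comp (comap_measurable _)).aestronglyMeasurable
  have h := ae_all_iff.2 fun m => ae_all_iff.2 fun k => key m k
  filter_upwards [h] with ω hω
  ext m k
  exact (hω m k).symm

/-! ### The payload -/

lemma payload_moments [IsProbabilityMeasure P] {τ : ℕ} {S : Sources M K τ Ω} (hS : S.IsModel P)
    (j : Fin K ⊕ Fin M ⊕ Fin K) :
    MemLp (fun ω => payload S ω j) 2 P ∧ ∫ ω, payload S ω j ∂P = 0 ∧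
      ∫ ω, ‖payload S ω j‖ ^ 2 ∂P = 1 := by
  have hm : Measurable fun ω => payload S ω j := hS.measurable _
  have hgauss : P.map (fun ω => payload S ω j) = stdComplexGaussian →
      MemLp (fun ω => payload S ω j) 2 P ∧ ∫ ω, payload S ω j ∂P = 0 ∧
      ∫ ω, ‖payload S ω j‖ ^ 2 ∂P = 1 := by
    intro hlaw
    have hmp : MeasurePreserving (fun ω => payload S ω j) P stdComplexGaussian := ⟨hm, hlaw⟩
    refine ⟨(memLp_id_stdComplexGaussian (by simp)).comp_measurePreserving hmp, ?_, ?_⟩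
    · rw [integral_comp_of_measurePreserving hmp (g := fun z => z) (by fun_prop),
        integral_id_stdComplexGaussian]
    · rw [integral_comp_of_measurePreserving hmp (g := fun z => ‖z‖ ^ 2) (by fun_prop),
        integral_norm_sq_stdComplexGaussian]
  rcases j with k | m | k
  · refine ⟨?_, hS.mean_x k, hS.power_x k⟩
    refine (memLp_two_iff_integrable_sq_norm hm.aestronglyMeasurable).2 ?_
    -- Square integrability of the data symbols is implicit in their unit power: the integral of a
    -- nonintegrable function is `0` by convention.
    by_contra hn
    exact zero_ne_one ((integral_undef hn).symm.trans (hS.power_x k))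
  · exact hgauss (hS.law_nr m)
  · exact hgauss (hS.law_nu k)

lemma payload_orthonormal [IsProbabilityMeasure P] {τ : ℕ} {S : Sources M K τ Ω}
    (hS : S.IsModel P) (j l : Fin K ⊕ Fin M ⊕ Fin K) :
    ∫ ω, payload S ω j * star (payload S ω l) ∂P = if j = l then 1 else 0 := by
  by_cases h : j = l
  · subst h
    rw [if_pos rfl, integral_mul_star_self (f := fun ω => payload S ω j),
      (payload_moments hS j).2.2]
    simp
  · rw [if_neg h]
    have hind : IndepFun (fun ω => payload S ω j) (fun ω => payload S ω l) P :=
      hS.indep.indepFun (by simpa using h)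
    have h1 := hind.integral_fun_comp_mul_comp (f := fun z : ℂ => z) (g := fun z : ℂ => star z)
      (hS.measurable _).aemeasurable (hS.measurable _).aemeasurable (by fun_prop) (by fun_prop)
    rw [h1, (payload_moments hS j).2.1, zero_mul]

end Model

/-! ### The relay signal, the effective gain and the effective noise -/

section Transmit

variable {M K : ℕ} {Ω : Type*} [MeasurableSpace Ω] {P : Measure Ω}

/-- Moments of a linear combination of the payload with coefficients that depend on the channel
and its estimate. -/
theorem moments_payload_combination [IsProbabilityMeasure P] {p : Params K} (hp : p.Admissible)
    {S : Sources M K p.τ Ω} (hS : S.IsModel P)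
    {a : Fin K ⊕ Fin M ⊕ Fin K → (Fin M × Fin K → ℂ) × (Fin M × Fin K → ℂ) → ℂ}
    (ham : ∀ j, Measurable (a j)) (ha : ∀ j, MemLp (a j) 2 (gaussianPair M K)) :
    MemLp (fun ω => ∑ j, a j (normalizedPair p S ω) * payload S ω j) 2 P ∧
    ∫ ω, ∑ j, a j (normalizedPair p S ω) * payload S ω j ∂P = 0 ∧
    ∫ ω, ‖∑ j, a j (normalizedPair p S ω) * payload S ω j‖ ^ 2 ∂P =
      ∑ j, ∫ z, ‖a j z‖ ^ 2 ∂(gaussianPair M K) := by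
  have hmp := measurePreserving_normalizedPair hp hS
  have hind := indepFun_normalizedPair_payload hS
  have hV := measurable_payload hS
  have hZm : ∀ j, Measurable fun v : Fin K ⊕ Fin M ⊕ Fin K → ℂ => v j := fun j =>
    measurable_pi_apply j
  have haL : ∀ j, MemLp (fun ω => a j (normalizedPair p S ω)) 2 P := fun j =>
    (ha j).comp_measurePreserving hmp
  have hZL : ∀ j, MemLp (fun ω => payload S ω j) 2 P := fun j => (payload_moments hS j).1
  have hL := memLp_two_combination (U := normalizedPair p S) (V := payload S) (a := a)
    (Z := fun j v => v j) hind ham hZm haL hZL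
  refine ⟨hL, ?_, ?_⟩
  · rw [integral_combination (Z := fun j v => v j) hmp.measurable hV hind ham hZm haL hZL]
    exact Finset.sum_eq_zero fun j _ => by rw [(payload_moments hS j).2.1, mul_zero]
  · rw [integral_norm_sq_combination_of_orthonormal (Z := fun j v => v j) hmp.measurable hV hind
      ham hZm haL hZL (payload_orthonormal hS)]
    exact Finset.sum_congr rfl fun j _ => integral_comp_of_measurePreserving hmp
      (g := fun z => ‖a j z‖ ^ 2) ((ham j).norm.pow_const 2).aestronglyMeasurable

lemma integral_norm_sq_const_mul {α : Type*} [MeasurableSpace α] {μ : Measure α} (c : ℝ)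
    (f : α → ℂ) : ∫ x, ‖(c : ℂ) * f x‖ ^ 2 ∂μ = c ^ 2 * ∫ x, ‖f x‖ ^ 2 ∂μ := by
  rw [← integral_const_mul]
  simp only [norm_mul, mul_pow, Complex.norm_real, Real.norm_eq_abs, sq_abs]

variable [NeZero K]

lemma unscaledSignal_eq (p : Params K) (S : Sources M K p.τ Ω) (ω : Ω) :
    unscaledSignal P p S ω = relayMat (estimate P p S ω) *ᵥ relayReceived p S ω := by
  rw [unscaledSignal, zfPrecoder, map_star_mul_inv_eq_zf_transpose, relayMat,
    ← Matrix.mulVec_mulVec, ← Matrix.mulVec_mulVec]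
  rfl

lemma effectiveGain_eq (p : Params K) (S : Sources M K p.τ Ω) (ω : Ω) :
    effectiveGain P p S ω =
      (channel p S ω)ᵀ * (relayMat (estimate P p S ω) * channel p S ω) := by
  rw [effectiveGain, zfPrecoder, map_star_mul_inv_eq_zf_transpose, relayMat]
  rfl

/-- The coefficients of the relay signal before power scaling. -/
def signalCoeff (p : Params K) (m : Fin M) : Fin K ⊕ Fin M ⊕ Fin K →
    (Fin M × Fin K → ℂ) × (Fin M × Fin K → ℂ) → ℂ
  | .inl i => fun z => ((Real.sqrt p.Pu : ℝ) : ℂ) * zf (scaledMat (estAmp p) z.1) (i - 1) m +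
      ∑ n, ((Real.sqrt p.Pu * errAmp p i : ℝ) : ℂ) * relayMat (scaledMat (estAmp p) z.1) m n *
        z.2 (n, i)
  | .inr (.inl n) => fun z => relayMat (scaledMat (estAmp p) z.1) m n
  | .inr (.inr _) => 0

/-- The coefficients of the effective noise of user `k`, for the power scaling `α`. -/
def noiseCoeffs (p : Params K) (α : ℝ) (k : Fin K) : Fin K ⊕ Fin M ⊕ Fin K →
    (Fin M × Fin K → ℂ) × (Fin M × Fin K → ℂ) → ℂ
  | .inl i => fun z => ((Real.sqrt (α * p.Pu) : ℝ) : ℂ) *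
      gainDeviation (scaledMat (estAmp p) z.1) (scaledMat (errAmp p) z.2) k i
  | .inr (.inl n) => fun z => ((Real.sqrt α : ℝ) : ℂ) * zf (scaledMat (estAmp p) z.1) (k + 1) n +
      ∑ m, ((Real.sqrt α * errAmp p k : ℝ) : ℂ) * relayMat (scaledMat (estAmp p) z.1) m n *
        z.2 (m, k)
  | .inr (.inr l) => fun _ => if l = k then 1 else 0

lemma ae_normalizedPair_regular [IsProbabilityMeasure P] {p : Params K} (hp : p.Admissible)
    {S : Sources M K p.τ Ω} (hS : S.IsModel P) (hM : K ≤ M) :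
    ∀ᵐ ω ∂P, estimate P p S ω = scaledMat (estAmp p) (normalizedPair p S ω).1 ∧
      IsUnit (gram (scaledMat (estAmp p) (normalizedPair p S ω).1)).det := by
  have hmp := measurePreserving_fst.comp (measurePreserving_normalizedPair hp hS)
  exact (ae_estimate_eq hp hS).and (hmp.quasiMeasurePreserving.ae
    (ae_isUnit_det_gram_scaledMat (estAmp_ne_zero hp) (Nat.pos_of_neZero K) hM))

lemma ae_unscaledSignal_eq [IsProbabilityMeasure P] {p : Params K} (hp : p.Admissible)
    {S : Sources M K p.τ Ω} (hS : S.IsModel P) (hM : K ≤ M) :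
    ∀ᵐ ω ∂P, ∀ m, unscaledSignal P p S ω m =
      ∑ j, signalCoeff p m j (normalizedPair p S ω) * payload S ω j := by
  filter_upwards [ae_normalizedPair_regular hp hS hM] with ω ⟨hest, hreg⟩ m
  rw [unscaledSignal_eq, hest, relayReceived, Matrix.mulVec_add, Matrix.mulVec_smul,
    Matrix.mulVec_mulVec, channel_eq hp, Fintype.sum_sum_type, Fintype.sum_sum_type, Pi.add_apply,
    Pi.smul_apply, smul_eq_mul]
  simp only [Matrix.mulVec, dotProduct, relayMat_mul_add_apply hreg, signalCoeff, payload,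
    Sources.family, Pi.zero_apply, zero_mul, Finset.sum_const_zero, add_zero, scaledMat_apply]
  congr 1
  rw [Finset.mul_sum]
  refine Finset.sum_congr rfl fun i _ => ?_
  rw [← mul_assoc, mul_add, Finset.mul_sum]
  congr 2
  refine Finset.sum_congr rfl fun n _ => ?_
  push_cast
  ring

lemma ae_effectiveGain_eq [IsProbabilityMeasure P] {p : Params K} (hp : p.Admissible)
    {S : Sources M K p.τ Ω} (hS : S.IsModel P) (hM : K ≤ M) :
    ∀ᵐ ω ∂P, ∀ k i, effectiveGain P p S ω k i = slotPerm K k i +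
      gainDeviation (scaledMat (estAmp p) (normalizedPair p S ω).1)
        (scaledMat (errAmp p) (normalizedPair p S ω).2) k i := by
  filter_upwards [ae_normalizedPair_regular hp hS hM] with ω ⟨hest, hreg⟩ k i
  rw [effectiveGain_eq, hest, channel_eq hp, transpose_mul_relayMat_mul_apply hreg]

lemma slotPerm_apply_add_one (k : Fin K) : slotPerm K k (k + 1) = 1 := by simp [slotPerm]

lemma measurable_gainDeviation (σ ε : Fin K → ℝ) (k i : Fin K) :
    Measurable fun z : (Fin M × Fin K → ℂ) × (Fin M × Fin K → ℂ) =>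
      gainDeviation (scaledMat σ z.1) (scaledMat ε z.2) k i := by
  have hE : ∀ m l, Measurable fun z : (Fin M × Fin K → ℂ) × (Fin M × Fin K → ℂ) =>
      scaledMat ε z.2 m l := fun m l =>
    Measurable.const_mul (f := fun z : (Fin M × Fin K → ℂ) × (Fin M × Fin K → ℂ) => z.2 (m, l))
      ((measurable_pi_apply _).comp measurable_snd) _
  have hzf : ∀ l m, Measurable fun z : (Fin M × Fin K → ℂ) × (Fin M × Fin K → ℂ) =>
      zf (scaledMat σ z.1) l m := fun l m => (measurable_zf_apply σ l m).comp measurable_fst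
  have hR : ∀ m n, Measurable fun z : (Fin M × Fin K → ℂ) × (Fin M × Fin K → ℂ) =>
      relayMat (scaledMat σ z.1) m n := fun m n =>
    (measurable_relayMat_apply σ m n).comp measurable_fst
  unfold gainDeviation
  exact ((Finset.measurable_sum _ fun m _ => (hzf _ m).mul (hE m k)).add
    (Finset.measurable_sum _ fun m _ => (hzf _ m).mul (hE m i))).add
    (Finset.measurable_sum _ fun x _ => (hR _ _).mul ((hE _ k).mul (hE _ i)))

/-- The gain is `1`, the entry of `Π`, plus a centered deviation, so its mean is exactly `1` for
every large `M`. -/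
lemma integrable_effectiveGain [IsProbabilityMeasure P] (hK3 : 3 ≤ K) {p : Params K}
    (hp : p.Admissible) {S : Sources M K p.τ Ω} (hS : S.IsModel P) (hM : 32 * K ≤ M) (k : Fin K) :
    Integrable (fun ω => effectiveGain P p S ω k (k + 1)) P ∧ meanGain P p S k = 1 := by
  have hmp := measurePreserving_normalizedPair hp hS
  obtain ⟨h1, h2, -⟩ := moments_gainDeviation hK3 (estAmp_ne_zero hp) (errAmp p) hM k (k + 1)
  have hae : (fun ω => effectiveGain P p S ω k (k + 1)) =ᵐ[P] fun ω => 1 +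
      gainDeviation (scaledMat (estAmp p) (normalizedPair p S ω).1)
        (scaledMat (errAmp p) (normalizedPair p S ω).2) k (k + 1) := by
    filter_upwards [ae_effectiveGain_eq hp hS (by omega : K ≤ M)] with ω hω
    rw [hω, slotPerm_apply_add_one]
  have hi : Integrable (fun ω => gainDeviation (scaledMat (estAmp p) (normalizedPair p S ω).1)
      (scaledMat (errAmp p) (normalizedPair p S ω).2) k (k + 1)) P :=
    (h1.comp_measurePreserving hmp).integrable (by norm_num)
  refine ⟨((integrable_const 1).add hi).congr hae.symm, ?_⟩
  rw [meanGain, integral_congr_ae hae, integral_add (integrable_const 1) hi,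
    integral_comp_of_measurePreserving hmp
      (measurable_gainDeviation _ _ k (k + 1)).aestronglyMeasurable,
    h2]
  simp

lemma powerScaling_nonneg {p : Params K} (hp : p.Admissible) (S : Sources M K p.τ Ω) :
    0 ≤ powerScaling P p S :=
  div_nonneg hp.Pr_pos.le (integral_nonneg fun _ => Finset.sum_nonneg fun _ _ => by positivity)

lemma ae_effectiveNoise_eq [IsProbabilityMeasure P] (hK3 : 3 ≤ K) {p : Params K}
    (hp : p.Admissible) {S : Sources M K p.τ Ω} (hS : S.IsModel P) (hM : 32 * K ≤ M) (k : Fin K) :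
    effectiveNoise P p S k =ᵐ[P] fun ω =>
      ∑ j, noiseCoeffs p (powerScaling P p S) k j (normalizedPair p S ω) * payload S ω j := by
  filter_upwards [ae_normalizedPair_regular hp hS (by omega : K ≤ M),
    ae_effectiveGain_eq hp hS (by omega : K ≤ M)] with ω ⟨hest, hreg⟩ hgain
  rw [effectiveNoise, (integrable_effectiveGain hK3 hp hS hM k).2, userReceived, relaySent,
    Matrix.mulVec_smul, unscaledSignal_eq, relayReceived, Matrix.mulVec_add, Matrix.mulVec_smul,
    Matrix.mulVec_mulVec, Matrix.mulVec_add, Matrix.mulVec_smul, Matrix.mulVec_mulVec,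
    Matrix.mulVec_mulVec, ← effectiveGain_eq, hest, channel_eq hp,
    Fintype.sum_sum_type, Fintype.sum_sum_type]
  simp only [Pi.add_apply, Pi.smul_apply, smul_eq_mul, Matrix.mulVec, dotProduct,
    transpose_mul_relayMat_apply hreg, noiseCoeffs, payload,
    Sources.family, scaledMat_apply, hgain]
  -- The permutation part isolates `xₖ₊₁` with coefficient `1`. It cancels against the subtracted
  -- desired signal because the mean gain is `1`.
  have hx : ∑ i, (slotPerm K k i + gainDeviation (scaledMat (estAmp p) (normalizedPair p S ω).1)
      (scaledMat (errAmp p) (normalizedPair p S ω).2) k i) * S.x ω i = S.x ω (k + 1) +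
      ∑ i, gainDeviation (scaledMat (estAmp p) (normalizedPair p S ω).1)
        (scaledMat (errAmp p) (normalizedPair p S ω).2) k i * S.x ω i := by
    simp only [add_mul, Finset.sum_add_distrib]
    congr 1
    simp [slotPerm]
  have hnu : ∑ l, (if l = k then (1 : ℂ) else 0) * S.nu ω l = S.nu ω k := by simp
  have hα : ((Real.sqrt (powerScaling P p S * p.Pu) : ℝ) : ℂ) =
      ((Real.sqrt (powerScaling P p S) : ℝ) : ℂ) * ((Real.sqrt p.Pu : ℝ) : ℂ) := by
    rw [Real.sqrt_mul (powerScaling_nonneg hp S), Complex.ofReal_mul]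
  have hnr : ∀ n, ((Real.sqrt (powerScaling P p S) : ℝ) : ℂ) *
        zf (scaledMat (estAmp p) (normalizedPair p S ω).1) (k + 1) n +
      ∑ m, ((Real.sqrt (powerScaling P p S) * errAmp p k : ℝ) : ℂ) *
        relayMat (scaledMat (estAmp p) (normalizedPair p S ω).1) m n *
          (normalizedPair p S ω).2 (m, k) =
      ((Real.sqrt (powerScaling P p S) : ℝ) : ℂ) *
        (zf (scaledMat (estAmp p) (normalizedPair p S ω).1) (k + 1) n +
        ∑ m, relayMat (scaledMat (estAmp p) (normalizedPair p S ω).1) m n *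
          ((errAmp p k : ℂ) * (normalizedPair p S ω).2 (m, k))) := by
    intro n
    rw [mul_add, Finset.mul_sum]
    congr 1
    refine Finset.sum_congr rfl fun m _ => ?_
    push_cast
    ring
  simp only [hx, hnu, hα, hnr]
  simp only [mul_assoc, ← Finset.mul_sum]
  ring

theorem moments_signalCoeff {p : Params K} (hp : p.Admissible) (hM : 32 * K ≤ M) (m : Fin M) :
    (∀ j, Measurable (signalCoeff p m j)) ∧
    (∀ j, MemLp (signalCoeff p m j) 2 (gaussianPair M K)) ∧
    ∑ j, ∫ z, ‖signalCoeff p m j z‖ ^ 2 ∂(gaussianPair M K) =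
      p.Pu * ∑ i, (∫ X, ‖zf (scaledMat (estAmp p) X) (i - 1) m‖ ^ 2
          ∂(gaussianFamily (Fin M × Fin K)) +
        errVar p i * ∑ n, ∫ X, ‖relayMat (scaledMat (estAmp p) X) m n‖ ^ 2
          ∂(gaussianFamily (Fin M × Fin K))) +
      ∑ n, ∫ X, ‖relayMat (scaledMat (estAmp p) X) m n‖ ^ 2
          ∂(gaussianFamily (Fin M × Fin K)) := by
  have hσ := estAmp_ne_zero hp
  have hK : 0 < K := Nat.pos_of_neZero K
  have hRm := measurable_relayMat_apply (M := M) (estAmp p)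
  have hzm := measurable_zf_apply (M := M) (estAmp p)
  have hx : ∀ i, _ := fun i => moments_affine_gaussianPair
    (b₀ := fun X => ((Real.sqrt p.Pu : ℝ) : ℂ) * zf (scaledMat (estAmp p) X) (i - 1) m)
    (b := fun n X => ((Real.sqrt p.Pu * errAmp p i : ℝ) : ℂ) *
      relayMat (scaledMat (estAmp p) X) m n)
    ((hzm (i - 1) m).const_mul _) (fun n => (hRm m n).const_mul _)
    ((memLp_two_zf hσ hK hM (i - 1) m).const_mul _)
    (fun n => (memLp_relayMat hσ hM m n).const_mul _) i
  refine ⟨?_, ?_, ?_⟩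
  · rintro (i | n | l)
    · exact (((hzm (i - 1) m).comp measurable_fst).const_mul _).add
        (Finset.measurable_sum _ fun n _ => (((hRm m n).comp measurable_fst).const_mul _).mul
          ((measurable_pi_apply (n, i)).comp measurable_snd))
    · exact (hRm m n).comp measurable_fst
    · exact measurable_zero
  · rintro (i | n | l)
    · exact (hx i).1
    · exact (memLp_relayMat hσ hM m n).comp_measurePreserving measurePreserving_fst
    · exact MemLp.zero
  · rw [Fintype.sum_sum_type, Fintype.sum_sum_type]
    simp only [signalCoeff, (hx _).2, integral_norm_sq_const_mul]
    have h0 : ∀ n, ∫ z, ‖relayMat (scaledMat (estAmp p) z.1) m n‖ ^ 2 ∂(gaussianPair M K) =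
        ∫ X, ‖relayMat (scaledMat (estAmp p) X) m n‖ ^ 2 ∂(gaussianFamily (Fin M × Fin K)) :=
      fun n => integral_fst_gaussianPair
        (f := fun X => ‖relayMat (scaledMat (estAmp p) X) m n‖ ^ 2)
        ((hRm m n).norm.pow_const 2).aestronglyMeasurable
    simp only [h0, Pi.zero_apply, norm_zero, ne_eq, OfNat.ofNat_ne_zero, not_false_eq_true,
      zero_pow, integral_zero, Finset.sum_const_zero, add_zero]
    congr 1
    rw [Finset.mul_sum]
    refine Finset.sum_congr rfl fun i _ => ?_
    rw [← Finset.mul_sum, mul_pow, Real.sq_sqrt hp.Pu_pos.le, errAmp_sq hp]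
    ring

/-- The mean power of the relay signal before scaling. -/
theorem integral_unscaledSignal [IsProbabilityMeasure P] {p : Params K} (hp : p.Admissible)
    {S : Sources M K p.τ Ω} (hS : S.IsModel P) (hM : 32 * K ≤ M) :
    Integrable (fun ω => ∑ m, ‖unscaledSignal P p S ω m‖ ^ 2) P ∧
    ∫ ω, ∑ m, ‖unscaledSignal P p S ω m‖ ^ 2 ∂P =
      p.Pu * ∑ i, (receiverEnergy M (estAmp p) (i - 1) +
        errVar p i * relayEnergy M (estAmp p)) + relayEnergy M (estAmp p) := by
  have hc := fun m => moments_signalCoeff (M := M) hp hM m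
  have hmom := fun m => moments_payload_combination hp hS (hc m).1 (hc m).2.1
  have hae : (fun ω => ∑ m, ‖unscaledSignal P p S ω m‖ ^ 2) =ᵐ[P] fun ω =>
      ∑ m, ‖∑ j, signalCoeff p m j (normalizedPair p S ω) * payload S ω j‖ ^ 2 := by
    filter_upwards [ae_unscaledSignal_eq hp hS (by omega : K ≤ M)] with ω hω
    simp only [hω]
  have hi : ∀ m, Integrable (fun ω =>
      ‖∑ j, signalCoeff p m j (normalizedPair p S ω) * payload S ω j‖ ^ 2) P := fun m =>
    (memLp_two_iff_integrable_sq_norm (hmom m).1.aestronglyMeasurable).1 (hmom m).1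
  refine ⟨(integrable_finsetSum _ fun m _ => hi m).congr hae.symm, ?_⟩
  rw [integral_congr_ae hae, integral_finsetSum _ fun m _ => hi m]
  simp only [(hmom _).2.2, (hc _).2.2]
  rw [Finset.sum_add_distrib, ← Finset.mul_sum, Finset.sum_comm]
  simp only [Finset.sum_add_distrib, ← Finset.mul_sum, receiverEnergy, relayEnergy]

theorem moments_noiseCoeffs (hK3 : 3 ≤ K) {p : Params K} (hp : p.Admissible) (hM : 32 * K ≤ M)
    {α : ℝ} (hα : 0 ≤ α) (k : Fin K) :
    (∀ j, Measurable (noiseCoeffs (M := M) p α k j)) ∧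
    (∀ j, MemLp (noiseCoeffs p α k j) 2 (gaussianPair M K)) ∧
    ∑ j, ∫ z, ‖noiseCoeffs p α k j z‖ ^ 2 ∂(gaussianPair M K) =
      α * p.Pu * ∑ i, (errVar p k * receiverEnergy M (estAmp p) (i - 1) +
        errVar p i * receiverEnergy M (estAmp p) (k + 1) +
        errVar p k * errVar p i * (relayEnergy M (estAmp p) +
          if k = i then (relayCorrelation M (estAmp p)).re else 0)) +
      α * (receiverEnergy M (estAmp p) (k + 1) + errVar p k * relayEnergy M (estAmp p)) + 1 := by
  have hσ := estAmp_ne_zero hp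
  have hK : 0 < K := Nat.pos_of_neZero K
  have hRm := measurable_relayMat_apply (M := M) (estAmp p)
  have hzm := measurable_zf_apply (M := M) (estAmp p)
  have hD := fun i => moments_gainDeviation hK3 hσ (errAmp p) hM k i
  have hx : ∀ n, _ := fun n => moments_affine_gaussianPair
    (b₀ := fun X => ((Real.sqrt α : ℝ) : ℂ) * zf (scaledMat (estAmp p) X) (k + 1) n)
    (b := fun m X => ((Real.sqrt α * errAmp p k : ℝ) : ℂ) * relayMat (scaledMat (estAmp p) X) m n)
    ((hzm (k + 1) n).const_mul _) (fun m => (hRm m n).const_mul _)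
    ((memLp_two_zf hσ hK hM (k + 1) n).const_mul _)
    (fun m => (memLp_relayMat hσ hM m n).const_mul _) k
  refine ⟨?_, ?_, ?_⟩
  · rintro (i | n | l)
    · exact (measurable_gainDeviation _ _ k i).const_mul _
    · exact (((hzm (k + 1) n).comp measurable_fst).const_mul _).add
        (Finset.measurable_sum _ fun m _ => (((hRm m n).comp measurable_fst).const_mul _).mul
          ((measurable_pi_apply (m, k)).comp measurable_snd))
    · exact measurable_const
  · rintro (i | n | l)
    · exact (hD i).1.const_mul _
    · exact (hx n).1
    · exact memLp_const _
  · rw [Fintype.sum_sum_type, Fintype.sum_sum_type]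
    simp only [noiseCoeffs, (hx _).2, integral_norm_sq_const_mul, (hD _).2.2]
    -- The receiver noise of user `k` enters with coefficient one and accounts for the final `+ 1`.
    have h1 : ∑ l : Fin K, ∫ _, ‖(if l = k then (1 : ℂ) else 0)‖ ^ 2 ∂(gaussianPair M K) = 1 := by
      rw [Finset.sum_eq_single k]
      · simp
      · intro l _ hl
        simp [hl]
      · simp
    rw [h1, ← add_assoc, ← Finset.mul_sum, Real.sq_sqrt (mul_nonneg hα hp.Pu_pos.le)]
    simp only [errAmp_sq hp]
    congr 2
    rw [Finset.sum_add_distrib]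
    simp only [← Finset.mul_sum, mul_pow, Real.sq_sqrt hα, errAmp_sq hp]
    rw [Finset.sum_comm, receiverEnergy, relayEnergy]
    ring

/-- The variance of the effective noise. -/
theorem complexVariance_effectiveNoise [IsProbabilityMeasure P] (hK3 : 3 ≤ K) {p : Params K}
    (hp : p.Admissible) {S : Sources M K p.τ Ω} (hS : S.IsModel P) (hM : 32 * K ≤ M) (k : Fin K) :
    MemLp (effectiveNoise P p S k) 2 P ∧ complexVariance (effectiveNoise P p S k) P =
      powerScaling P p S * p.Pu * ∑ i, (errVar p k * receiverEnergy M (estAmp p) (i - 1) +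
        errVar p i * receiverEnergy M (estAmp p) (k + 1) +
        errVar p k * errVar p i * (relayEnergy M (estAmp p) +
          if k = i then (relayCorrelation M (estAmp p)).re else 0)) +
      powerScaling P p S *
        (receiverEnergy M (estAmp p) (k + 1) + errVar p k * relayEnergy M (estAmp p)) + 1 := by
  obtain ⟨h1, h2, h3⟩ := moments_noiseCoeffs hK3 hp hM (powerScaling_nonneg (P := P) hp S) k
  obtain ⟨m1, m2, m3⟩ := moments_payload_combination hp hS h1 h2
  have hae := ae_effectiveNoise_eq hK3 hp hS hM k
  refine ⟨m1.ae_eq hae.symm, ?_⟩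
  rw [complexVariance, integral_congr_ae hae, m2, ← h3, ← m3]
  refine integral_congr_ae ?_
  filter_upwards [hae] with ω hω
  rw [hω, sub_zero]

end Transmit

/-! ### Asymptotics -/

/-- `log t ≤ t - 1` at the quotient of the two arguments; the factor `c / (y + c) ≤ 1` makes the
bound independent of `c`. -/
lemma log_one_add_div_sub_le {c x y : ℝ} (hc : 0 < c) (hx : 0 < x) (hy : 0 < y) :
    Real.log (1 + c / x) - Real.log (1 + c / y) ≤ |x - y| / x := by
  have h1 : (0 : ℝ) < 1 + c / x := by positivity
  have h2 : (0 : ℝ) < 1 + c / y := by positivity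
  rw [← Real.log_div h1.ne' h2.ne']
  refine (Real.log_le_sub_one_of_pos (div_pos h1 h2)).trans ?_
  have h3 : (1 + c / x) / (1 + c / y) - 1 = c / (y + c) * ((y - x) / x) := by
    field_simp
    ring
  rw [h3, abs_sub_comm]
  have h4 : c / (y + c) ≤ 1 := (div_le_one (by positivity)).2 (by linarith)
  calc c / (y + c) * ((y - x) / x) ≤ c / (y + c) * (|y - x| / x) := by
        gcongr
        exact le_abs_self _
    _ ≤ 1 * (|y - x| / x) := by gcongr
    _ = |y - x| / x := one_mul _

lemma abs_log_one_add_div_sub_le {c x y : ℝ} (hc : 0 < c) (hx : 0 < x) (hy : 0 < y) :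
    |Real.log (1 + c / x) - Real.log (1 + c / y)| ≤ |x - y| / x + |x - y| / y := by
  have h1 := log_one_add_div_sub_le hc hx hy
  have h2 := log_one_add_div_sub_le hc hy hx
  rw [abs_sub_comm y x] at h2
  have h3 : 0 ≤ |x - y| / x := by positivity
  have h4 : 0 ≤ |x - y| / y := by positivity
  rw [abs_le]
  constructor <;> linarith

/-- Two sequences of order `1 / M` that agree up to `o(1 / M²)` lead to rates that agree up to
`o(1 / M)`. -/
lemma tendsto_mul_log_one_add_div_sub {c d : ℝ} (hc : 0 < c) (hd : 0 < d) {x y : ℕ → ℝ}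
    (hx : Tendsto (fun M : ℕ => (M : ℝ) * x M) atTop (𝓝 d))
    (hy : Tendsto (fun M : ℕ => (M : ℝ) * y M) atTop (𝓝 d))
    (hxy : Tendsto (fun M : ℕ => (M : ℝ) ^ 2 * (x M - y M)) atTop (𝓝 0)) :
    Tendsto (fun M : ℕ => (M : ℝ) * (Real.log (1 + c / x M) - Real.log (1 + c / y M))) atTop
      (𝓝 0) := by
  have hb : Tendsto (fun M : ℕ => |(M : ℝ) ^ 2 * (x M - y M)| / (M * x M) +
      |(M : ℝ) ^ 2 * (x M - y M)| / (M * y M)) atTop (𝓝 0) := by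
    have h1 := (hxy.abs.div hx hd.ne').add (hxy.abs.div hy hd.ne')
    simpa using h1
  refine squeeze_zero_norm' ?_ hb
  filter_upwards [hx.eventually (lt_mem_nhds hd), hy.eventually (lt_mem_nhds hd),
    eventually_gt_atTop 0] with M h1 h2 hM
  have hM' : (0 : ℝ) < M := by exact_mod_cast hM
  have hx0 : 0 < x M := pos_of_mul_pos_right h1 hM'.le
  have hy0 : 0 < y M := pos_of_mul_pos_right h2 hM'.le
  rw [norm_mul, Real.norm_of_nonneg hM'.le, Real.norm_eq_abs]
  calc (M : ℝ) * |Real.log (1 + c / x M) - Real.log (1 + c / y M)|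
      ≤ M * (|x M - y M| / x M + |x M - y M| / y M) := by
        gcongr
        exact abs_log_one_add_div_sub_le hc hx0 hy0
    _ = _ := by
        rw [abs_mul, abs_of_nonneg (by positivity : (0 : ℝ) ≤ (M : ℝ) ^ 2)]
        field_simp

lemma errVar_nonneg {K : ℕ} {p : Params K} (hp : p.Admissible) (k : Fin K) : 0 ≤ errVar p k := by
  rw [← errAmp_sq hp]; positivity

/-! ### Exact and approximate rate as one function of the energies -/

section Rate

variable {K : ℕ} [NeZero K] (p : Params K)

/-- The mean power of the relay signal before scaling, in terms of the receiver energies `q` and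
the relay energy `r`. -/
def signalPower (q : Fin K → ℝ) (r : ℝ) : ℝ :=
  p.Pu * ∑ i, (q (i - 1) + errVar p i * r) + r

/-- The noise of user `k`, relative to the scaled power of the users' signals, in terms of the
receiver energies `q`, the relay energy `r` and the relay correlation `s`. -/
def relativeNoise (k : Fin K) (q : Fin K → ℝ) (r s : ℝ) : ℝ :=
  p.Pu * ∑ i, (errVar p k * q (i - 1) + errVar p i * q (k + 1) +
      errVar p k * errVar p i * (r + if k = i then s else 0)) +
    (q (k + 1) + errVar p k * r) + signalPower p q r / p.Pr

variable {p}

lemma signalPower_smul (c : ℝ) (q : Fin K → ℝ) (r : ℝ) :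
    signalPower p (c • q) (c * r) = c * signalPower p q r := by
  simp only [signalPower, Pi.smul_apply, smul_eq_mul]
  rw [mul_add, mul_left_comm c, Finset.mul_sum (a := c)]
  congr 2
  exact Finset.sum_congr rfl fun i _ => by ring

/-- Homogeneity, with the additivity in `relativeNoise_sub`, lets the factors `M` and `M²` be moved
onto the energies, where the limits are known. -/
lemma relativeNoise_smul (k : Fin K) (c : ℝ) (q : Fin K → ℝ) (r s : ℝ) :
    relativeNoise p k (c • q) (c * r) (c * s) = c * relativeNoise p k q r s := by
  simp only [relativeNoise, signalPower_smul, Pi.smul_apply, smul_eq_mul]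
  rw [mul_add, mul_add, mul_left_comm c, Finset.mul_sum (a := c)]
  congr 2
  · congr 1
    refine Finset.sum_congr rfl fun i _ => ?_
    split_ifs <;> ring
  · ring
  · ring

lemma signalPower_sub (q q' : Fin K → ℝ) (r r' : ℝ) :
    signalPower p q r - signalPower p q' r' = signalPower p (q - q') (r - r') := by
  simp only [signalPower, Pi.sub_apply]
  rw [add_sub_add_comm, ← mul_sub, ← Finset.sum_sub_distrib]
  congr 2
  exact Finset.sum_congr rfl fun i _ => by ring

lemma relativeNoise_sub (k : Fin K) (q q' : Fin K → ℝ) (r r' s s' : ℝ) :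
    relativeNoise p k q r s - relativeNoise p k q' r' s' =
      relativeNoise p k (q - q') (r - r') (s - s') := by
  have h : ∀ a b c a' b' c' : ℝ, a + b + c - (a' + b' + c') = a - a' + (b - b') + (c - c') :=
    fun _ _ _ _ _ _ => by ring
  simp only [relativeNoise, ← signalPower_sub, Pi.sub_apply]
  rw [h, ← mul_sub, ← Finset.sum_sub_distrib, ← sub_div]
  congr 2
  · congr 1
    refine Finset.sum_congr rfl fun i _ => ?_
    split_ifs <;> ring
  · ring

lemma tendsto_signalPower {q : ℕ → Fin K → ℝ} {r : ℕ → ℝ} {q₀ : Fin K → ℝ} {r₀ : ℝ}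
    (hq : ∀ i, Tendsto (fun M => q M i) atTop (𝓝 (q₀ i))) (hr : Tendsto r atTop (𝓝 r₀)) :
    Tendsto (fun M => signalPower p (q M) (r M)) atTop (𝓝 (signalPower p q₀ r₀)) := by
  unfold signalPower
  exact ((tendsto_finsetSum _ fun i _ => (hq _).add (hr.const_mul _)).const_mul _).add hr

lemma tendsto_relativeNoise (k : Fin K) {q : ℕ → Fin K → ℝ} {r s : ℕ → ℝ} {q₀ : Fin K → ℝ}
    {r₀ s₀ : ℝ} (hq : ∀ i, Tendsto (fun M => q M i) atTop (𝓝 (q₀ i)))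
    (hr : Tendsto r atTop (𝓝 r₀)) (hs : Tendsto s atTop (𝓝 s₀)) :
    Tendsto (fun M => relativeNoise p k (q M) (r M) (s M)) atTop
      (𝓝 (relativeNoise p k q₀ r₀ s₀)) := by
  unfold relativeNoise
  refine ((Tendsto.const_mul _ (tendsto_finsetSum _ fun i _ => ?_)).add
    ((hq _).add (hr.const_mul _))).add ((tendsto_signalPower hq hr).div_const _)
  refine (((hq _).const_mul _).add ((hq _).const_mul _)).add (Tendsto.const_mul _ (hr.add ?_))
  split_ifs
  exacts [hs, tendsto_const_nhds]

lemma signalPower_pos (hp : p.Admissible) : 0 < signalPower p (fun i => 1 / estVar p i) 0 := by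
  have h : ∀ i, 0 < 1 / estVar p i := fun i => one_div_pos.2 (estVar_pos hp i)
  have h1 : 0 < ∑ i, (1 / estVar p (i - 1) + errVar p i * 0) :=
    Finset.sum_pos (fun i _ => by rw [mul_zero, add_zero]; exact h _) Finset.univ_nonempty
  have := mul_pos hp.Pu_pos h1
  rw [signalPower, add_zero]
  exact this

lemma relativeNoise_pos (hp : p.Admissible) (k : Fin K) :
    0 < relativeNoise p k (fun i => 1 / estVar p i) 0 0 := by
  have h : ∀ i, 0 < 1 / estVar p i := fun i => one_div_pos.2 (estVar_pos hp i)
  have h1 := div_pos (signalPower_pos hp) hp.Pr_pos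
  have h2 := h (k + 1)
  have h3 : 0 ≤ ∑ i, (errVar p k * (1 / estVar p (i - 1)) + errVar p i * (1 / estVar p (k + 1)) +
      errVar p k * errVar p i * (0 + if k = i then 0 else 0)) :=
    Finset.sum_nonneg fun i _ => by
      have := mul_nonneg (errVar_nonneg hp k) (h (i - 1)).le
      have := mul_nonneg (errVar_nonneg hp i) h2.le
      simp only [ite_self, add_zero, mul_zero]
      positivity
  have h4 := mul_nonneg hp.Pu_pos.le h3
  rw [relativeNoise, mul_zero, add_zero]
  linarith

/-- The signal-to-noise ratio in terms of the relative noise. -/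
lemma snr_eq {a c x : ℝ} (ha : a ≠ 0) : a * c / (a * x + 1) = c / (x + 1 / a) := by
  have : a * x + 1 = a * (x + 1 / a) := by field_simp
  rw [this, mul_div_mul_left _ _ ha]

lemma spectralEfficiencyApprox_eq (hp : p.Admissible) {M : ℕ} (hM : K < M) (k : Fin K) :
    spectralEfficiencyApprox p M k = (((p.T : ℝ) - p.τ) / p.T) * (((K : ℝ) - 1) / K) *
      Real.logb 2 (1 + p.Pu / relativeNoise p k (fun i => 1 / (estVar p i * ((M : ℝ) - K)))
        (rhoConst p / (M * ((M : ℝ) - K))) 0) := by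
  have hK0 : (0 : ℝ) < M := by exact_mod_cast (Nat.zero_le K).trans_lt hM
  have hMK : (0 : ℝ) < (M : ℝ) - K := sub_pos.2 (by exact_mod_cast hM)
  have hv := estVar_pos hp
  have hv1 : ∀ i, estVar p i ≠ 0 := fun i => (hv i).ne'
  have hρ : 0 ≤ rhoConst p := Finset.sum_nonneg fun i _ => by
    have := hv i
    have := hv (i + 1)
    positivity
  have hs : 0 < ∑ i, 1 / estVar p i :=
    Finset.sum_pos (fun i _ => one_div_pos.2 (hv i)) Finset.univ_nonempty
  have he : 0 ≤ ∑ i, errVar p i * rhoConst p :=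
    Finset.sum_nonneg fun i _ => mul_nonneg (errVar_nonneg hp i) hρ
  have hden : 0 < M * p.Pu * (∑ k, 1 / estVar p k) + p.Pu * (∑ k, errVar p k * rhoConst p) +
      rhoConst p := by
    have := hp.Pu_pos
    positivity
  have hα : alphaApprox p M ≠ 0 := by
    have := hp.Pr_pos
    rw [alphaApprox]
    positivity
  have hP : signalPower p (fun i => 1 / (estVar p i * ((M : ℝ) - K)))
      (rhoConst p / (M * ((M : ℝ) - K))) / p.Pr = 1 / alphaApprox p M := by
    -- The cyclic shift `i ↦ i - 1` permutes the users, so the shifted sum equals the unshifted one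
    -- of the closed form.
    have hsum : ∑ i, (1 / (estVar p (i - 1) * ((M : ℝ) - K)) +
        errVar p i * (rhoConst p / (M * ((M : ℝ) - K)))) =
        (∑ i, 1 / estVar p i) / ((M : ℝ) - K) +
          (∑ i, errVar p i * rhoConst p) / (M * ((M : ℝ) - K)) := by
      rw [Finset.sum_add_distrib, Finset.sum_div, Finset.sum_div]
      congr 1
      · rw [← Equiv.sum_comp (Equiv.subRight (1 : Fin K)) fun i => 1 / estVar p i / ((M : ℝ) - K)]
        exact Finset.sum_congr rfl fun i _ => by rw [Equiv.subRight_apply, div_div]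
      · exact Finset.sum_congr rfl fun i _ => by ring
    have := hp.Pr_pos.ne'
    rw [signalPower, hsum, alphaApprox, one_div_div]
    generalize ∑ i, errVar p i * rhoConst p = e
    generalize ∑ i, 1 / estVar p i = v
    field_simp
  have hI : ∀ i, interference p M k i = errVar p k * (1 / (estVar p (i - 1) * ((M : ℝ) - K))) +
      errVar p i * (1 / (estVar p (k + 1) * ((M : ℝ) - K))) +
      errVar p k * errVar p i * (rhoConst p / (M * ((M : ℝ) - K)) + if k = i then 0 else 0) := by
    intro i
    have h1 := hv1 (i - 1)
    have h2 := hv1 (k + 1)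
    rw [ite_self, add_zero, interference]
    field_simp
    ring
  have hJ : noiseCoeff p M k = 1 / (estVar p (k + 1) * ((M : ℝ) - K)) +
      errVar p k * (rhoConst p / (M * ((M : ℝ) - K))) := by
    have h2 := hv1 (k + 1)
    rw [noiseCoeff]
    field_simp
  rw [spectralEfficiencyApprox, relativeNoise, hP, ← hJ]
  simp only [← hI]
  rw [← snr_eq hα]
  congr 4
  ring

variable {M : ℕ} {Ω : Type*} [MeasurableSpace Ω] {P : Measure Ω}

/-- Dividing numerator and denominator by `α` turns the additive `1` into `1/α = signalPower / Pr`.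
Positivity of the signal power ensures `α ≠ 0`. -/
lemma spectralEfficiency_eq [IsProbabilityMeasure P] (hK3 : 3 ≤ K) (hp : p.Admissible)
    {S : Sources M K p.τ Ω} (hS : S.IsModel P) (hM : 32 * K ≤ M)
    (hpow : 0 < signalPower p (receiverEnergy M (estAmp p)) (relayEnergy M (estAmp p)))
    (k : Fin K) :
    spectralEfficiency P p S k = (((p.T : ℝ) - p.τ) / p.T) * (((K : ℝ) - 1) / K) *
      Real.logb 2 (1 + p.Pu / relativeNoise p k (receiverEnergy M (estAmp p))
        (relayEnergy M (estAmp p)) (relayCorrelation M (estAmp p)).re) := by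
  have hα : powerScaling P p S = p.Pr /
      signalPower p (receiverEnergy M (estAmp p)) (relayEnergy M (estAmp p)) := by
    rw [powerScaling, (integral_unscaledSignal hp hS hM).2, signalPower]
  have hα0 : powerScaling P p S ≠ 0 := by
    rw [hα]; exact (div_pos hp.Pr_pos hpow).ne'
  rw [spectralEfficiency, (integrable_effectiveGain hK3 hp hS hM k).2,
    (complexVariance_effectiveNoise hK3 hp hS hM k).2, relativeNoise, ← one_div_div p.Pr, ← hα,
    ← snr_eq hα0, norm_one, one_pow, mul_one]
  congr 4
  ring

end Rate

/-! ### Limits of the rescaled energies and of the difference of the rates -/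

section Limits

variable {K : ℕ} [NeZero K] {p : Params K}

lemma tendsto_natCast_div_sub (K : ℕ) :
    Tendsto (fun M : ℕ => (M : ℝ) / ((M : ℝ) - K)) atTop (𝓝 1) := by
  have h1 : Tendsto (fun M : ℕ => (K : ℝ) / (M : ℝ)) atTop (𝓝 0) :=
    tendsto_const_div_atTop_nhds_zero_nat _
  have h2 : Tendsto (fun M : ℕ => (1 - (K : ℝ) / (M : ℝ))⁻¹) atTop (𝓝 1) := by
    simpa using (h1.const_sub 1).inv₀ (by norm_num)
  refine h2.congr' ?_
  filter_upwards [eventually_gt_atTop K] with M hM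
  have h3 : (M : ℝ) ≠ 0 := by
    have : 0 < M := (Nat.zero_le K).trans_lt hM
    exact_mod_cast this.ne'
  rw [← inv_div ((M : ℝ) - K), sub_div, div_self h3]

lemma tendsto_mul_of_tendsto_sq_mul {f : ℕ → ℝ} {a : ℝ}
    (h : Tendsto (fun M : ℕ => (M : ℝ) ^ 2 * f M) atTop (𝓝 a)) :
    Tendsto (fun M : ℕ => (M : ℝ) * f M) atTop (𝓝 0) := by
  have h1 := tendsto_inv_atTop_nhds_zero_nat (𝕜 := ℝ) |>.mul h
  rw [zero_mul] at h1
  refine h1.congr' ?_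
  filter_upwards [eventually_gt_atTop 0] with M hM
  have : (M : ℝ) ≠ 0 := by exact_mod_cast hM.ne'
  field_simp

lemma tendsto_mul_receiverEnergy {σ : Fin K → ℝ} (hσ : ∀ k, σ k ≠ 0) (k : Fin K) :
    Tendsto (fun M : ℕ => (M : ℝ) * receiverEnergy M σ k) atTop (𝓝 (1 / σ k ^ 2)) := by
  have h := (tendsto_inv_atTop_nhds_zero_nat (𝕜 := ℝ)).mul (tendsto_receiverEnergy hσ k)
  rw [zero_mul] at h
  have h2 := h.add_const (1 / σ k ^ 2)
  rw [zero_add] at h2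
  refine h2.congr' ?_
  filter_upwards [eventually_gt_atTop 0] with M hM
  have : (M : ℝ) ≠ 0 := by exact_mod_cast hM.ne'
  rw [inv_mul_cancel_left₀ this, sub_add_cancel]

/-- Since `1/(M - K) = 1/M + (K/M²) (M/(M - K))`, the second-order term `K/σₖ²` of the receiver
energy is matched exactly. This is the use of the refined expansion. -/
lemma tendsto_sq_mul_receiverEnergy_sub {σ : Fin K → ℝ} (hσ : ∀ k, σ k ≠ 0) (k : Fin K) :
    Tendsto (fun M : ℕ => (M : ℝ) ^ 2 *
      (receiverEnergy M σ k - 1 / (σ k ^ 2 * ((M : ℝ) - K)))) atTop (𝓝 0) := by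
  have h := (tendsto_receiverEnergy hσ k).sub
    ((tendsto_natCast_div_sub K).const_mul ((K : ℝ) / σ k ^ 2))
  rw [mul_one, sub_self] at h
  refine h.congr' ?_
  filter_upwards [eventually_gt_atTop K] with M hM
  have h1 : (M : ℝ) - K ≠ 0 := (sub_pos.2 (by exact_mod_cast hM)).ne'
  have h2 := hσ k
  field_simp
  ring

lemma tendsto_sq_mul_rhoConst_div (K : ℕ) (c : ℝ) :
    Tendsto (fun M : ℕ => (M : ℝ) ^ 2 * (c / (M * ((M : ℝ) - K)))) atTop (𝓝 c) := by
  have h := (tendsto_natCast_div_sub K).const_mul c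
  rw [mul_one] at h
  refine h.congr' ?_
  filter_upwards [eventually_gt_atTop K] with M hM
  have h1 : (M : ℝ) - K ≠ 0 := (sub_pos.2 (by exact_mod_cast hM)).ne'
  have h3 : (M : ℝ) ≠ 0 := by
    have : 0 < M := (Nat.zero_le K).trans_lt hM
    exact_mod_cast this.ne'
  field_simp

lemma tendsto_relayEnergy_estAmp (hp : p.Admissible) :
    Tendsto (fun M : ℕ => (M : ℝ) ^ 2 * relayEnergy M (estAmp p)) atTop (𝓝 (rhoConst p)) := by
  have h := tendsto_relayEnergy (estAmp_ne_zero hp)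
  simp only [estAmp_sq hp] at h
  exact h

lemma tendsto_relayCorrelation_re (hp : p.Admissible) (hK3 : 3 ≤ K) :
    Tendsto (fun M : ℕ => (M : ℝ) ^ 2 * (relayCorrelation M (estAmp p)).re) atTop (𝓝 0) := by
  have h := (Complex.continuous_re.tendsto _).comp
    (tendsto_relayCorrelation (estAmp_ne_zero hp) hK3)
  rw [Complex.zero_re] at h
  refine h.congr fun M => ?_
  rw [Function.comp_apply, ← Complex.ofReal_natCast, ← Complex.ofReal_pow, Complex.re_ofReal_mul]

lemma eventually_signalPower_pos (hp : p.Admissible) :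
    ∀ᶠ M : ℕ in atTop,
      0 < signalPower p (receiverEnergy M (estAmp p)) (relayEnergy M (estAmp p)) := by
  have hq : ∀ i, Tendsto (fun M : ℕ => ((M : ℝ) • receiverEnergy M (estAmp p)) i) atTop
      (𝓝 (1 / estVar p i)) := fun i => by
    rw [← estAmp_sq hp]
    exact tendsto_mul_receiverEnergy (estAmp_ne_zero hp) i
  have h := tendsto_signalPower (p := p) hq
    (tendsto_mul_of_tendsto_sq_mul (tendsto_relayEnergy_estAmp hp))
  filter_upwards [h.eventually (lt_mem_nhds (signalPower_pos hp))] with M hM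
  rw [signalPower_smul] at hM
  exact pos_of_mul_pos_right hM (Nat.cast_nonneg M)

/-- The relative noise and its closed form agree to first order, up to a smaller error. -/
theorem tendsto_mul_logb_sub (hp : p.Admissible) (hK3 : 3 ≤ K) (k : Fin K) :
    Tendsto (fun M : ℕ => (M : ℝ) *
      (Real.logb 2 (1 + p.Pu / relativeNoise p k (receiverEnergy M (estAmp p))
        (relayEnergy M (estAmp p)) (relayCorrelation M (estAmp p)).re) -
      Real.logb 2 (1 + p.Pu / relativeNoise p k (fun i => 1 / (estVar p i * ((M : ℝ) - K)))
        (rhoConst p / (M * ((M : ℝ) - K))) 0))) atTop (𝓝 0) := by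
  have hσ := estAmp_ne_zero hp
  have hr := tendsto_relayEnergy_estAmp hp
  have hr' := tendsto_sq_mul_rhoConst_div K (rhoConst p)
  have hs := tendsto_relayCorrelation_re hp hK3
  have hx : Tendsto (fun M : ℕ => (M : ℝ) * relativeNoise p k (receiverEnergy M (estAmp p))
      (relayEnergy M (estAmp p)) (relayCorrelation M (estAmp p)).re) atTop
      (𝓝 (relativeNoise p k (fun i => 1 / estVar p i) 0 0)) := by
    simp only [← relativeNoise_smul]
    refine tendsto_relativeNoise k (fun i => ?_) (tendsto_mul_of_tendsto_sq_mul hr)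
      (tendsto_mul_of_tendsto_sq_mul hs)
    rw [← estAmp_sq hp]
    exact tendsto_mul_receiverEnergy hσ i
  have hy : Tendsto (fun M : ℕ => (M : ℝ) *
      relativeNoise p k (fun i => 1 / (estVar p i * ((M : ℝ) - K)))
        (rhoConst p / (M * ((M : ℝ) - K))) 0) atTop
      (𝓝 (relativeNoise p k (fun i => 1 / estVar p i) 0 0)) := by
    simp only [← relativeNoise_smul]
    refine tendsto_relativeNoise k (fun i => ?_) (tendsto_mul_of_tendsto_sq_mul hr') ?_
    · have h := (tendsto_natCast_div_sub K).const_mul (1 / estVar p i)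
      rw [mul_one] at h
      refine h.congr fun M => ?_
      rw [Pi.smul_apply, smul_eq_mul, div_mul_div_comm, one_mul, mul_one_div]
    · simp
  have hxy : Tendsto (fun M : ℕ => (M : ℝ) ^ 2 * (relativeNoise p k (receiverEnergy M (estAmp p))
      (relayEnergy M (estAmp p)) (relayCorrelation M (estAmp p)).re -
      relativeNoise p k (fun i => 1 / (estVar p i * ((M : ℝ) - K)))
        (rhoConst p / (M * ((M : ℝ) - K))) 0)) atTop (𝓝 0) := by
    -- By linearity the rescaled difference is `relativeNoise` of the rescaled differences, each of
    -- which tends to zero; the limit is the value at the origin.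
    have h0 : relativeNoise p k 0 0 0 = 0 := by
      simpa using relativeNoise_smul (p := p) k 0 0 0 0
    simp only [relativeNoise_sub, ← relativeNoise_smul]
    refine Eq.subst (motive := fun x => Tendsto _ atTop (𝓝 x)) h0
      (tendsto_relativeNoise k (fun i => ?_) ?_ ?_)
    · have h := tendsto_sq_mul_receiverEnergy_sub hσ i
      rw [estAmp_sq hp] at h
      exact h
    · have h := hr.sub hr'
      rw [sub_self] at h
      exact h.congr fun M => (mul_sub _ _ _).symm
    · simpa using hs
  have h := (tendsto_mul_log_one_add_div_sub hp.Pu_pos (relativeNoise_pos hp k) hx hy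
    hxy).div_const (Real.log 2)
  rw [zero_div] at h
  refine h.congr fun M => ?_
  simp only [Real.logb]
  ring

end Limits

/-! ### The power constraint -/

section Power

variable {M K : ℕ} [NeZero K] {p : Params K} {Ω : Type*} [MeasurableSpace Ω] {P : Measure Ω}

/-- The power constraint of the relay is attained. -/
lemma integral_relaySent [IsProbabilityMeasure P] (hp : p.Admissible)
    {S : Sources M K p.τ Ω} (hS : S.IsModel P) (hM : 32 * K ≤ M)
    (hpow : 0 < signalPower p (receiverEnergy M (estAmp p)) (relayEnergy M (estAmp p))) :
    Integrable (fun ω => ∑ m, ‖relaySent P p S ω m‖ ^ 2) P ∧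
      ∫ ω, ∑ m, ‖relaySent P p S ω m‖ ^ 2 ∂P = p.Pr := by
  obtain ⟨hi, h⟩ := integral_unscaledSignal hp hS hM
  have hs : ∀ ω, ∑ m, ‖relaySent P p S ω m‖ ^ 2 =
      powerScaling P p S * ∑ m, ‖unscaledSignal P p S ω m‖ ^ 2 := by
    intro ω
    rw [Finset.mul_sum]
    refine Finset.sum_congr rfl fun m _ => ?_
    rw [relaySent, Pi.smul_apply, smul_eq_mul, norm_mul, mul_pow, Complex.norm_real,
      Real.norm_eq_abs, sq_abs, Real.sq_sqrt (powerScaling_nonneg hp S)]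
  simp only [hs]
  refine ⟨hi.const_mul _, ?_⟩
  rw [integral_const_mul, powerScaling, div_mul_cancel₀]
  rw [h]
  exact hpow.ne'

end Power

end MultiWayRelay

end

/-! ### Conclusion -/

theorem theorem1 {K : ℕ} [NeZero K] (hK : 3 ≤ K)
    (p : MultiWayRelay.Params K) (hp : p.Admissible)
    {Ω : ℕ → Type*} [∀ M, MeasurableSpace (Ω M)]
    (P : ∀ M, Measure (Ω M)) [∀ M, IsProbabilityMeasure (P M)]
    (S : ∀ M, MultiWayRelay.Sources M K p.τ (Ω M)) (hS : ∀ M, (S M).IsModel (P M))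
    (k : Fin K) :
    -- for all large `M` the quantities that define the spectral efficiency are well defined
    (∀ᶠ M : ℕ in atTop,
      (Integrable (fun ω => ∑ m, ‖MultiWayRelay.relaySent (P M) p (S M) ω m‖ ^ 2) (P M) ∧
        ∫ ω, ∑ m, ‖MultiWayRelay.relaySent (P M) p (S M) ω m‖ ^ 2 ∂(P M) = p.Pr) ∧
      Integrable (fun ω => MultiWayRelay.effectiveGain (P M) p (S M) ω k (k + 1)) (P M) ∧
      MemLp (MultiWayRelay.effectiveNoise (P M) p (S M) k) 2 (P M)) ∧
    -- the approximation error tends to zero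
    Tendsto (fun M : ℕ => MultiWayRelay.spectralEfficiency (P M) p (S M) k -
        MultiWayRelay.spectralEfficiencyApprox p M k) atTop (𝓝 0) ∧
    -- and it does so faster than `1 / M`, the order of the terms of the closed form with `ϱ`
    Tendsto (fun M : ℕ => (M : ℝ) * (MultiWayRelay.spectralEfficiency (P M) p (S M) k -
        MultiWayRelay.spectralEfficiencyApprox p M k)) atTop (𝓝 0) := by
  have hpow := MultiWayRelay.eventually_signalPower_pos hp
  have hmain : Tendsto (fun M : ℕ => (M : ℝ) * (MultiWayRelay.spectralEfficiency (P M) p (S M) k -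
      MultiWayRelay.spectralEfficiencyApprox p M k)) atTop (𝓝 0) := by
    have h := (MultiWayRelay.tendsto_mul_logb_sub hp hK k).const_mul
      ((((p.T : ℝ) - p.τ) / p.T) * (((K : ℝ) - 1) / K))
    rw [mul_zero] at h
    refine h.congr' ?_
    filter_upwards [hpow, eventually_ge_atTop (32 * K), eventually_gt_atTop K] with M h1 h2 h3
    rw [MultiWayRelay.spectralEfficiency_eq hK hp (hS M) h2 h1 k,
      MultiWayRelay.spectralEfficiencyApprox_eq hp h3 k]
    ring
  refine ⟨?_, ?_, hmain⟩
  · filter_upwards [hpow, eventually_ge_atTop (32 * K)] with M h1 h2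
    exact ⟨MultiWayRelay.integral_relaySent hp (hS M) h2 h1,
      (MultiWayRelay.integrable_effectiveGain hK hp (hS M) h2 k).1,
      (MultiWayRelay.complexVariance_effectiveNoise hK hp (hS M) h2 k).1⟩
  · have h := (tendsto_inv_atTop_nhds_zero_nat (𝕜 := ℝ)).mul hmain
    rw [zero_mul] at h
    refine h.congr' ?_
    filter_upwards [eventually_gt_atTop 0] with M hM
    have : (M : ℝ) ≠ 0 := by exact_mod_cast hM.ne'
    rw [inv_mul_cancel_left₀ this]
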